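/- Let $X$ be a Riemannian manifold of dimension $n$ (smooth, Hausdorff, without boundary) with Levi-Civita connection $\nabla$. Functions on the supermanifold $\mathbb{R}_{>0}\times \pi TX$ are smooth families, parametrized by $r>0$, of complex-valued differential forms on $X$; the body of such a function is its component of form degree $0$. Let $F=\tfrac12\sum R(e_i,e_j)\,\theta^i\theta^j$ be the curvature of $\nabla$, viewed as an $\mathrm{End}(TX)$-valued function on $\pi TX$, and put $\mathcal R=-F$. **Operators.** For $(r,x)\in\mathbb{R}_{>0}\times X$ consider the smooth $T_xX$-valued functions on the circle of circumference $r$ with coordinate $t$ that are orthogonal to the constants, and on their extension of scalars to functions on $\pi T_xX$ the bosonic kinetic operator $$\Delta_{\mathrm{bos}}=-\mathrm{Id}_{TX}\otimes \frac{d^2}{dt^2}+i\,\mathcal R\otimes\frac{d}{dt}.$$ For $D=\Delta_{\rm bos}$, $\frac{d^2}{dt^2}$ or $\frac{d}{dt}$ (tensored with $\mathrm{Id}$ in the last two cases) let $D^*$ be the adjoint and $\det_\zeta(DD^*)=\exp(-\zeta'(0))$, where $\zeta(s)$ is the meromorphic continuation of $\mathrm{Tr}\big((DD^*)^{-s}\big)$,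 a trace over the nonzero Fourier modes. Complex powers and exponentials of a function are computed by expanding in its nilpotent part around its body; in the same way $\mathrm{Tr}\big((DD^*)^{-s}\big)$ is computed mode by mode. **Lines and metrics.** On $\mathbb{R}_{>0}\times X$ let $$\mathrm{sDet}(|\Delta_X|)=\mathrm{Pf}\Big(\frac{d}{dt}\otimes \mathrm{Id}_{\pi TX}\Big)\otimes\mathrm{Det}\Big(\frac{d}{dt}\otimes\mathrm{Id}_{TX}\Big)^{-1}$$ be the real line bundle built from the Pfaffian and determinant lines of these real operators on the loops orthogonal to the constants, with the section $\mathrm{sdet}(|\Delta_X|)=\mathrm{pf}\otimes\det^{-1}$ and the Quillen metric determined by $\|\det D\|^2=\det_\zeta(DD^*)$ and $\|\mathrm{pf}\,D\|^2=\det_\zeta(DD^*)^{1/2}$. Since the operators are invertible, these sections are nowhere zero, and they are taken as smooth frames. Define $\mathrm{sDet}(|\Delta_n|)$ in the same way with the trivial bundle $\underline{\mathbb{R}}^n$ in place of $TX$. The super determinant lines $\mathrm{sDet}(\Delta_X)$ and $\mathrm{sDet}(\Delta_n)$ over $\mathbb{R}_{>0}\times\pi TX$, with their sections $\mathrm{sdet}(\Delta_X)$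 and $\mathrm{sdet}(\Delta_n)$, are the pullbacks along $p\colon \mathbb{R}_{>0}\times\pi TX\to\mathbb{R}_{>0}\times X$, with the metrics $$g_{\mathrm{sDet}(\Delta_X)}=\frac{\det_\zeta\big(\frac{d^2}{dt^2}(\frac{d^2}{dt^2})^*\big)^{1/2}}{\det_\zeta\big(\Delta_{\mathrm{bos}}\Delta_{\mathrm{bos}}^*\big)^{1/2}}\;p^*g_{\mathrm{sDet}(|\Delta_X|)},\qquad g_{\mathrm{sDet}(\Delta_n)}=p^*g_{\mathrm{sDet}(|\Delta_n|)},$$ extended to Hermitian metrics with values in functions. The real structure on the relative line $\mathrm{sDet}(\Delta_X)\otimes\mathrm{sDet}(\Delta_n)^{-1}$ is that of the complexification of a pulled back real line. Here the conjugation of functions on $\mathbb{R}_{>0}\times\pi TX$, which also enters the adjoint $D^*$ and the Hermitian extension, is either the complex conjugation of forms, $\alpha\mapsto\bar\alpha$, or the conjugation $\alpha\mapsto i^{-\deg\alpha}\,\bar\alpha$; the result holds for both. **The function $\hat A(X)$.** Let $\hat A(X)$ denote both the form $\exp\big(\tfrac12\mathrm{tr}\log f(F/2\pi i)\big)$, with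 $f(z)=\frac{z/2}{\sinh(z/2)}$, and the function on $\mathbb{R}_{>0}\times\pi TX$ obtained from it by sending a form $\alpha$ of degree $k$ to $(2\pi r)^{k/2}\alpha$. **Proposition.** The section $$s=\frac{\mathrm{sdet}(\Delta_X)\otimes\mathrm{sdet}(\Delta_n)^{-1}}{\hat A(X)}$$ of $\mathrm{sDet}(\Delta_X)\otimes\mathrm{sDet}(\Delta_n)^{-1}$ over $\mathbb{R}_{>0}\times\pi TX$ is smooth, real, and of unit norm. Consequently it defines a geometric trivialization of this line as a real line bundle: over every point $(r,x)$ the map $h\mapsto h\,s$, from functions on $\pi T_xX$ to the restriction of the relative line to $\{r\}\times\pi T_xX$, is bijective, isometric (the inner product of $h\,s$ and $k\,s$ is $h\,\bar k$), and compatible with the real structures; and $h\,s$ is smooth if and only if $h$ is smooth. -/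

import Mathlib

open scoped Manifold ContDiff Bundle TensorProduct Polynomial
open Bundle Module

noncomputable section

namespace SigmaModel

/-! ### Power series of nilpotent elements, functions of even elements with invertible body -/

/-- Evaluation of a power series at a nilpotent element (a finite sum). -/
def nilEval {A : Type*} [Ring A] [Algebra ℂ A] (p : PowerSeries ℂ) (a : A) : A :=
  ∑ d ∈ Finset.range (nilpotencyClass a), PowerSeries.coeff d p • a ^ d

/-- The power series of `log (1 + x)`. -/
def logSeries : PowerSeries ℂ := PowerSeries.mk fun d => (-1) ^ (d + 1) / (d : ℂ)

/-- The power series of `(1 + x) ^ s`. -/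
def powSeries (s : ℂ) : PowerSeries ℂ := PowerSeries.mk fun d => Ring.choose s d

/-- The power series of `sinh (x / 2) / (x / 2)`. -/
def sinhSeries : PowerSeries ℂ :=
  PowerSeries.mk fun d => if Even d then 1 / (2 ^ d * (Nat.factorial (d + 1) : ℂ)) else 0

/-- The characteristic series `(x / 2) / sinh (x / 2)`. -/
def ahatSeries : PowerSeries ℂ := sinhSeries⁻¹

/-- The exponential of an element `a` whose difference from its body `b` is nilpotent. -/
def expAt {A : Type*} [Ring A] [Algebra ℂ A] (b : ℂ) (a : A) : A :=
  Complex.exp b • nilEval (PowerSeries.exp ℂ) (a - algebraMap ℂ A b)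

/-- The power `a ^ s = b ^ s (1 + (a / b - 1)) ^ s` of an element `a` whose difference from its
nonzero body `b` is nilpotent (principal branch of `b ^ s`). -/
def powAt {A : Type*} [Ring A] [Algebra ℂ A] (b : ℂ) (a : A) (s : ℂ) : A :=
  b ^ s • nilEval (powSeries s) (b⁻¹ • a - 1)

/-! ### Constant coefficient differential operators on a circle and their `ζ`-determinants

`S` is a (super)algebra of parameters with body `ε : S → ℂ` (its quotient by nilpotents) and `T` a
real vector space. Differential operators on a circle with coefficients `S`-linear endomorphisms of
`S ⊗ T` and independent of the coordinate `t` are polynomials in `d/dt` over `S ⊗ End T`. -/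

/-- The algebra of `S`-linear endomorphisms of the free module `S ⊗ T`. -/
def Coeff (S T : Type*) [Ring S] [Algebra ℝ S] [AddCommGroup T] [Module ℝ T] : Type _ :=
  S ⊗[ℝ] Module.End ℝ T

section CoeffInstances

variable (S T : Type*) [Ring S] [Algebra ℝ S] [AddCommGroup T] [Module ℝ T]

instance : Ring (Coeff S T) := inferInstanceAs (Ring (S ⊗[ℝ] Module.End ℝ T))

instance : Algebra ℝ (Coeff S T) := inferInstanceAs (Algebra ℝ (S ⊗[ℝ] Module.End ℝ T))

instance [Algebra ℂ S] [IsScalarTower ℝ ℂ S] : Algebra ℂ (Coeff S T) :=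
  Algebra.TensorProduct.leftAlgebra (R := ℝ) (S := ℂ) (A := S) (B := Module.End ℝ T)

variable {S T} in
/-- The decomposable element `a ⊗ φ`. -/
def Coeff.tmul (a : S) (φ : Module.End ℝ T) : Coeff S T := a ⊗ₜ[ℝ] φ

end CoeffInstances

section Zeta

/-- The `S`-valued trace on `S ⊗ End T`. -/
def coeffTrace (S T : Type*) [Ring S] [Algebra ℝ S] [AddCommGroup T] [Module ℝ T] :
    Coeff S T →ₗ[ℝ] S :=
  ((TensorProduct.rid ℝ S).toLinearMap ∘ₗ LinearMap.lTensor S (LinearMap.trace ℝ T) :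
    S ⊗[ℝ] Module.End ℝ T →ₗ[ℝ] S)

/-- The transpose with respect to the metric, as a linear map on `End T`. -/
def transposeMap (T : Type*) [NormedAddCommGroup T] [InnerProductSpace ℝ T]
    [FiniteDimensional ℝ T] : Module.End ℝ T →ₗ[ℝ] Module.End ℝ T where
  toFun φ := LinearMap.adjoint φ
  map_add' φ ψ := by simp
  map_smul' c φ := by simp

/-- The pointwise adjoint on `S ⊗ End T`, for a given conjugation of the parameters `S`. -/
def coeffAdjoint {S T : Type*} [Ring S] [Algebra ℝ S]
    [NormedAddCommGroup T] [InnerProductSpace ℝ T] [FiniteDimensional ℝ T]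
    (conj : S →ₐ[ℝ] S) : Coeff S T →ₗ[ℝ] Coeff S T :=
  (TensorProduct.map conj.toLinearMap (transposeMap T) :
    S ⊗[ℝ] Module.End ℝ T →ₗ[ℝ] S ⊗[ℝ] Module.End ℝ T)

/-- The formal adjoint `∑ (-d/dt)^j a_j^*` of the operator `∑ a_j (d/dt)^j`. -/
def opAdjoint {S T : Type*} [Ring S] [Algebra ℝ S]
    [NormedAddCommGroup T] [InnerProductSpace ℝ T] [FiniteDimensional ℝ T]
    (conj : S →ₐ[ℝ] S) (P : (Coeff S T)[X]) : (Coeff S T)[X] :=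
  ∑ j ∈ P.support, Polynomial.monomial j ((-1) ^ j * coeffAdjoint conj (P.coeff j))

variable {S T : Type*} [Ring S] [Algebra ℝ S] [Algebra ℂ S] [IsScalarTower ℝ ℂ S]

/-- The value on the mode `exp (2 π i m t / r)` of the operator `P (d/dt)` on the circle of
circumference `r`: it acts there as multiplication by `P (2 π i m / r)`. -/
def modeBlock [AddCommGroup T] [Module ℝ T] (r : ℝ) (P : (Coeff S T)[X]) (m : ℤ) : Coeff S T :=
  P.eval ((2 * (Real.pi : ℂ) * Complex.I * (m : ℂ) / (r : ℂ)) • (1 : Coeff S T))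

/-- The contribution of the mode `m` to the trace of `P ^ (-s)`, for operators whose mode blocks
are scalar modulo nilpotents (the scalar is then the normalized trace of the body). -/
def zetaTerm [AddCommGroup T] [Module ℝ T] (ε : S →ₐ[ℂ] ℂ) (r : ℝ) (P : (Coeff S T)[X])
    (m : ℤ) (s : ℂ) : S :=
  coeffTrace S T
    (powAt (ε (coeffTrace S T (modeBlock r P m)) / (finrank ℝ T : ℂ)) (modeBlock r P m) (-s))

/-- `F` is the `ζ`-function of `P` on the orthogonal complement of the constants: for `re s` large,
`F s` is the absolutely convergent sum over the nonzero modes of the trace of `P ^ (-s)`, and `F`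
is meromorphic on the plane and holomorphic at `0`. Everything is tested on the linear functionals
of the finite-dimensional parameter algebra `S`. -/
structure IsZetaFunction [AddCommGroup T] [Module ℝ T] (ε : S →ₐ[ℂ] ℂ) (r : ℝ)
    (P : (Coeff S T)[X]) (F : ℂ → S) : Prop where
  meromorphic : ∀ l : S →ₗ[ℂ] ℂ, MeromorphicOn (fun s => l (F s)) Set.univ
  analyticAt_zero : ∀ l : S →ₗ[ℂ] ℂ, AnalyticAt ℂ (fun s => l (F s)) 0
  hasSum : ∃ c : ℝ, ∀ s : ℂ, c < s.re → ∀ l : S →ₗ[ℂ] ℂ,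
    HasSum (fun m : {m : ℤ // m ≠ 0} => l (zetaTerm ε r P m s)) (l (F s))

/-- `d = exp (- ζ' (0))` for the `ζ`-function of `P`. -/
def IsZetaDet [AddCommGroup T] [Module ℝ T] (ε : S →ₐ[ℂ] ℂ) (r : ℝ) (P : (Coeff S T)[X])
    (d : S) : Prop :=
  ∃ (F : ℂ → S) (z : S), IsZetaFunction ε r P F ∧
    (∀ l : S →ₗ[ℂ] ℂ, deriv (fun s => l (F s)) 0 = l z) ∧ d = expAt (ε (-z)) (-z)

open Classical in
/-- The `ζ`-determinant of `P` on the orthogonal complement of the constants. -/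
def zetaDet [AddCommGroup T] [Module ℝ T] (ε : S →ₐ[ℂ] ℂ) (r : ℝ) (P : (Coeff S T)[X]) : S :=
  if h : ∃ d, IsZetaDet ε r P d then h.choose else 0

/-- The `ζ`-determinant of `P P^*`. -/
def zetaDetSq [NormedAddCommGroup T] [InnerProductSpace ℝ T] [FiniteDimensional ℝ T]
    (ε : S →ₐ[ℂ] ℂ) (conj : S →ₐ[ℝ] S) (r : ℝ) (P : (Coeff S T)[X]) : S :=
  zetaDet ε r (P * opAdjoint conj P)

end Zeta

/-! ### Loops and the operator `d/dt` -/

section Loops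

variable (r : ℝ) (V : Type*) [NormedAddCommGroup V] [NormedSpace ℝ V]

/-- Smooth `V`-valued functions on the circle of circumference `r` that are orthogonal to the
constant functions. -/
def Loop : Submodule ℝ (ℝ → V) where
  carrier := {f | ContDiff ℝ ∞ f ∧ Function.Periodic f r ∧ ∫ t in (0 : ℝ)..r, f t = 0}
  add_mem' := by
    rintro f g ⟨hf, hf', hf''⟩ ⟨hg, hg', hg''⟩
    refine ⟨hf.add hg, hf'.add hg', ?_⟩
    simp only [Pi.add_apply]
    rw [intervalIntegral.integral_add (hf.continuous.intervalIntegrable _ _)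
      (hg.continuous.intervalIntegrable _ _), hf'', hg'', add_zero]
  zero_mem' := ⟨contDiff_const, fun _ => rfl, by simp⟩
  smul_mem' := by
    rintro c f ⟨hf, hf', hf''⟩
    refine ⟨hf.const_smul c, fun t => by simp [hf' t], ?_⟩
    simp only [Pi.smul_apply]
    rw [intervalIntegral.integral_smul, hf'', smul_zero]

variable [FiniteDimensional ℝ V]

/-- The operator `d/dt` on loops orthogonal to the constants, that is `d/dt ⊗ Id_V`. -/
def loopDeriv : Loop r V →ₗ[ℝ] Loop r V where
  toFun f := ⟨deriv f.1, by
    obtain ⟨f, hf, hp, -⟩ := f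
    have : CompleteSpace V := FiniteDimensional.complete ℝ V
    have hd : ContDiff ℝ ∞ (deriv f) := (contDiff_infty_iff_deriv.1 hf).2
    have hd' : Differentiable ℝ f := (contDiff_infty_iff_deriv.1 hf).1
    refine ⟨hd, fun t => ?_, ?_⟩
    · have : (fun t => f (t + r)) = f := funext hp
      rw [← deriv_comp_add_const f r t, this]
    · rw [intervalIntegral.integral_deriv_eq_sub (fun t _ => hd' t)
        (hd.continuous.intervalIntegrable _ _)]
      have := hp 0
      simp only [zero_add] at this
      rw [this, sub_self]⟩
  map_add' f g := by
    obtain ⟨f, hf, -⟩ := f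
    obtain ⟨g, hg, -⟩ := g
    ext t
    exact deriv_add ((contDiff_infty_iff_deriv.1 hf).1 t) ((contDiff_infty_iff_deriv.1 hg).1 t)
  map_smul' c f := by
    obtain ⟨f, hf, -⟩ := f
    ext t
    exact deriv_const_smul c ((contDiff_infty_iff_deriv.1 hf).1 t)

end Loops

/-! ### Determinant and Pfaffian lines -/

section Lines

/-- The projection of a top exterior power to scalars; it is the canonical isomorphism in degree
`0` and vanishes in positive degrees. -/
def topScalar (k : ℕ) (M : Type*) [AddCommGroup M] [Module ℝ M] : Module.Dual ℝ (⋀[ℝ]^k M) :=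
  (ExteriorAlgebra.algebraMapInv (R := ℝ) (M := M)).toLinearMap ∘ₗ
    (⋀[ℝ]^k M : Submodule ℝ (ExteriorAlgebra ℝ M)).subtype

variable {H : Type*} [AddCommGroup H] [Module ℝ H]

/-- The determinant line `(Λ^top ker A)^* ⊗ Λ^top coker A` of a Fredholm operator. -/
def DetLine (A : H →ₗ[ℝ] H) : Type _ :=
  Module.Dual ℝ (⋀[ℝ]^(finrank ℝ (LinearMap.ker A)) (LinearMap.ker A)) ⊗[ℝ]
    (⋀[ℝ]^(finrank ℝ (H ⧸ LinearMap.range A)) (H ⧸ LinearMap.range A) :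
      Submodule ℝ (ExteriorAlgebra ℝ (H ⧸ LinearMap.range A)))

instance (A : H →ₗ[ℝ] H) : AddCommGroup (DetLine A) :=
  (inferInstance : AddCommGroup (Module.Dual ℝ (⋀[ℝ]^(finrank ℝ (LinearMap.ker A)) (LinearMap.ker A)) ⊗[ℝ]
    (⋀[ℝ]^(finrank ℝ (H ⧸ LinearMap.range A)) (H ⧸ LinearMap.range A) :
      Submodule ℝ (ExteriorAlgebra ℝ (H ⧸ LinearMap.range A)))))

instance (A : H →ₗ[ℝ] H) : Module ℝ (DetLine A) :=
  (inferInstance : Module ℝ (Module.Dual ℝ (⋀[ℝ]^(finrank ℝ (LinearMap.ker A)) (LinearMap.ker A)) ⊗[ℝ]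
    (⋀[ℝ]^(finrank ℝ (H ⧸ LinearMap.range A)) (H ⧸ LinearMap.range A) :
      Submodule ℝ (ExteriorAlgebra ℝ (H ⧸ LinearMap.range A)))))

/-- The determinant section: the canonical generator `1 ⊗ 1` if kernel and cokernel vanish, and
`0` otherwise (the wedge of `k` zero vectors is `1` for `k = 0` and `0` for `k > 0`). -/
def detSection (A : H →ₗ[ℝ] H) : DetLine A :=
  (topScalar (finrank ℝ (LinearMap.ker A)) (LinearMap.ker A) ⊗ₜ[ℝ]
    exteriorPower.ιMulti ℝ (finrank ℝ (H ⧸ LinearMap.range A)) (fun _ => 0) :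
    Module.Dual ℝ (⋀[ℝ]^(finrank ℝ (LinearMap.ker A)) (LinearMap.ker A)) ⊗[ℝ]
    (⋀[ℝ]^(finrank ℝ (H ⧸ LinearMap.range A)) (H ⧸ LinearMap.range A) :
      Submodule ℝ (ExteriorAlgebra ℝ (H ⧸ LinearMap.range A))))

/-- The Pfaffian line `(Λ^top ker A)^*` of a skew-adjoint Fredholm operator. -/
def PfLine (A : H →ₗ[ℝ] H) : Type _ :=
  Module.Dual ℝ (⋀[ℝ]^(finrank ℝ (LinearMap.ker A)) (LinearMap.ker A))

instance (A : H →ₗ[ℝ] H) : AddCommGroup (PfLine A) :=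
  (inferInstance : AddCommGroup (Module.Dual ℝ (⋀[ℝ]^(finrank ℝ (LinearMap.ker A)) (LinearMap.ker A))))

instance (A : H →ₗ[ℝ] H) : Module ℝ (PfLine A) :=
  (inferInstance : Module ℝ (Module.Dual ℝ (⋀[ℝ]^(finrank ℝ (LinearMap.ker A)) (LinearMap.ker A))))

/-- The Pfaffian section: the canonical generator if the kernel vanishes, and `0` otherwise. -/
def pfSection (A : H →ₗ[ℝ] H) : PfLine A :=
  topScalar (finrank ℝ (LinearMap.ker A)) (LinearMap.ker A)

variable {L : Type*} [AddCommGroup L] [Module ℝ L]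

open Classical in
/-- The inverse `e⁻¹ ∈ L^*` of a nonzero element `e` of a line `L`: the functional with value `1`
at `e`. -/
def lineInv (e : L) : Module.Dual ℝ L :=
  if h : ∃ φ : Module.Dual ℝ L, φ e = 1 then h.choose else 0

/-- The metric on a line `L` with `‖e‖² = a`, where `e` is a generator of `L`. -/
def metricWith (e : L) (a : ℝ) : LinearMap.BilinForm ℝ L :=
  a • LinearMap.BilinForm.linMulLin (lineInv e) (lineInv e)

/-- The dual of the metric `B` on a line `L` with generator `e`. -/
def dualMetric (B : LinearMap.BilinForm ℝ L) (e : L) : LinearMap.BilinForm ℝ (Module.Dual ℝ L) :=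
  (B e e)⁻¹ • LinearMap.BilinForm.linMulLin (Module.Dual.eval ℝ L e) (Module.Dual.eval ℝ L e)

end Lines

/-! ### The super determinant line of the reduced family -/

section Reduced

variable (r : ℝ) (V : Type*) [NormedAddCommGroup V] [InnerProductSpace ℝ V] [FiniteDimensional ℝ V]

/-- `det_ζ (D D^*)` for the invertible operator `D = d/dt ⊗ Id_V` on loops of length `r` orthogonal
to the constants; it is a positive number. -/
def reducedZetaDet : ℝ :=
  ‖zetaDetSq (S := ℂ) (T := V) (AlgHom.id ℂ ℂ) Complex.conjAe.toAlgHom r Polynomial.X‖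

/-- The Quillen metric on the determinant line of `d/dt ⊗ Id_V`: `‖det D‖² = det_ζ (D D^*)`. -/
def detMetric : LinearMap.BilinForm ℝ (DetLine (loopDeriv r V)) :=
  metricWith (detSection (loopDeriv r V)) (reducedZetaDet r V)

/-- The Quillen metric on the Pfaffian line of `d/dt ⊗ Id_V`: `‖pf D‖² = det_ζ (D D^*)^{1/2}`. -/
def pfMetric : LinearMap.BilinForm ℝ (PfLine (loopDeriv r V)) :=
  metricWith (pfSection (loopDeriv r V)) (Real.sqrt (reducedZetaDet r V))

/-- The super determinant line `Pf (d/dt ⊗ Id) ⊗ Det (d/dt ⊗ Id)⁻¹`. -/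
abbrev SDetLine : Type _ := PfLine (loopDeriv r V) ⊗[ℝ] Module.Dual ℝ (DetLine (loopDeriv r V))

/-- The super determinant section `pf ⊗ det⁻¹`. -/
def sdetSection : SDetLine r V :=
  pfSection (loopDeriv r V) ⊗ₜ[ℝ] lineInv (detSection (loopDeriv r V))

/-- The metric on the super determinant line. -/
def sdetMetric : LinearMap.BilinForm ℝ (SDetLine r V) :=
  LinearMap.BilinForm.tmul (pfMetric r V) (dualMetric (detMetric r V) (detSection (loopDeriv r V)))

/-- The relative super determinant line `sDet (V) ⊗ sDet (ℝⁿ)⁻¹`. -/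
def RelLine (n : ℕ) : Type _ :=
  SDetLine r V ⊗[ℝ] Module.Dual ℝ (SDetLine r (EuclideanSpace ℝ (Fin n)))

instance (n : ℕ) : AddCommGroup (RelLine r V n) :=
  (inferInstance : AddCommGroup (SDetLine r V ⊗[ℝ] Module.Dual ℝ (SDetLine r (EuclideanSpace ℝ (Fin n)))))

instance (n : ℕ) : Module ℝ (RelLine r V n) :=
  (inferInstance : Module ℝ (SDetLine r V ⊗[ℝ] Module.Dual ℝ (SDetLine r (EuclideanSpace ℝ (Fin n)))))

/-- The relative super determinant section `sdet (V) ⊗ sdet (ℝⁿ)⁻¹`. -/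
def relSection (n : ℕ) : RelLine r V n :=
  (sdetSection r V ⊗ₜ[ℝ] lineInv (sdetSection r (EuclideanSpace ℝ (Fin n))) :
    SDetLine r V ⊗[ℝ] Module.Dual ℝ (SDetLine r (EuclideanSpace ℝ (Fin n))))

/-- The metric on the relative super determinant line. -/
def relMetric (n : ℕ) : LinearMap.BilinForm ℝ (RelLine r V n) :=
  (LinearMap.BilinForm.tmul (sdetMetric r V)
    (dualMetric (sdetMetric r (EuclideanSpace ℝ (Fin n)))
      (sdetSection r (EuclideanSpace ℝ (Fin n)))) :
    LinearMap.BilinForm ℝ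
      (SDetLine r V ⊗[ℝ] Module.Dual ℝ (SDetLine r (EuclideanSpace ℝ (Fin n)))))

end Reduced

/-! ### Functions on the odd vector space `πT` -/

section Forms

variable (T : Type*) [NormedAddCommGroup T] [InnerProductSpace ℝ T]

/-- Complex-valued alternating forms on `T`, that is functions on the odd vector space `πT`. -/
def Forms : Type _ := ℂ ⊗[ℝ] ExteriorAlgebra ℝ (Module.Dual ℝ T)

instance : Ring (Forms T) := inferInstanceAs (Ring (ℂ ⊗[ℝ] ExteriorAlgebra ℝ (Module.Dual ℝ T)))

instance : Algebra ℝ (Forms T) :=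
  inferInstanceAs (Algebra ℝ (ℂ ⊗[ℝ] ExteriorAlgebra ℝ (Module.Dual ℝ T)))

instance : Algebra ℂ (Forms T) :=
  inferInstanceAs (Algebra ℂ (ℂ ⊗[ℝ] ExteriorAlgebra ℝ (Module.Dual ℝ T)))

instance : IsScalarTower ℝ ℂ (Forms T) :=
  inferInstanceAs (IsScalarTower ℝ ℂ (ℂ ⊗[ℝ] ExteriorAlgebra ℝ (Module.Dual ℝ T)))

/-- The body of a form: its component of degree `0`. -/
def body : Forms T →ₐ[ℂ] ℂ :=
  (Algebra.TensorProduct.lift (AlgHom.id ℂ ℂ)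
    ((Algebra.ofId ℝ ℂ).comp (ExteriorAlgebra.algebraMapInv (R := ℝ) (M := Module.Dual ℝ T)))
    (fun _ _ => Commute.all _ _) : ℂ ⊗[ℝ] ExteriorAlgebra ℝ (Module.Dual ℝ T) →ₐ[ℂ] ℂ)

variable {T}

/-- A real alternating form as an element of `Forms T`. -/
def realForm (w : ExteriorAlgebra ℝ (Module.Dual ℝ T)) : Forms T := (1 : ℂ) ⊗ₜ[ℝ] w

/-- The algebra homomorphism that sends a real form `w` of degree `k` to `c ^ k w`. -/
def twistReal (c : ℂ) : ExteriorAlgebra ℝ (Module.Dual ℝ T) →ₐ[ℝ]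
    ℂ ⊗[ℝ] ExteriorAlgebra ℝ (Module.Dual ℝ T) :=
  ExteriorAlgebra.lift ℝ
    ⟨TensorProduct.mk ℝ ℂ _ c ∘ₗ ExteriorAlgebra.ι ℝ, fun v => by
      simp [Algebra.TensorProduct.tmul_mul_tmul]⟩

/-- The conjugate-linear algebra homomorphism that sends a real form `w` of degree `k` to
`c ^ k w`. For `c = 1` it is the complex conjugation of forms, and for `c = -i` it is the
conjugation `w ↦ i ^ (-k) (conj w)` that comes from the real structure `(t, θ) ↦ (t, i θ)` of the
group of super Euclidean isometries. -/
def formConj (c : ℂ) : Forms T →ₐ[ℝ] Forms T :=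
  (Algebra.TensorProduct.lift
    ((Algebra.TensorProduct.includeLeft (R := ℝ) (S := ℝ) (A := ℂ)
      (B := ExteriorAlgebra ℝ (Module.Dual ℝ T))).comp Complex.conjAe.toAlgHom)
    (twistReal c) (fun z w => by
      change Commute (algebraMap ℂ (ℂ ⊗[ℝ] ExteriorAlgebra ℝ (Module.Dual ℝ T)) _) _
      exact Algebra.commutes _ _) :
    ℂ ⊗[ℝ] ExteriorAlgebra ℝ (Module.Dual ℝ T) →ₐ[ℝ] ℂ ⊗[ℝ] ExteriorAlgebra ℝ (Module.Dual ℝ T))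

/-- Push-forward of forms along a linear map `Dual T → Dual T'`. -/
def mapForms {T' : Type*} [NormedAddCommGroup T'] [InnerProductSpace ℝ T']
    (φ : Module.Dual ℝ T →ₗ[ℝ] Module.Dual ℝ T') : Forms T →ₐ[ℂ] Forms T' :=
  (Algebra.TensorProduct.map (AlgHom.id ℂ ℂ) (ExteriorAlgebra.map φ) :
    ℂ ⊗[ℝ] ExteriorAlgebra ℝ (Module.Dual ℝ T) →ₐ[ℂ] ℂ ⊗[ℝ] ExteriorAlgebra ℝ (Module.Dual ℝ T'))

/-- The algebra homomorphism that multiplies forms of degree `k` by `c ^ k`. -/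
def scaleForms (c : ℝ) : Forms T →ₐ[ℂ] Forms T := mapForms (c • LinearMap.id)

end Forms

/-! ### The kinetic operators over an odd tangent space -/

section Kinetic

variable {T : Type*} [NormedAddCommGroup T] [InnerProductSpace ℝ T] [FiniteDimensional ℝ T]

/-- The `End T`-valued form `F = ½ ∑ R (e_i, e_j) θ^i θ^j` of a curvature tensor `R`. -/
def curvatureForm (R : T → T → T → T) : Coeff (Forms T) T :=
  ∑ i, ∑ j, Coeff.tmul
    (realForm ((2⁻¹ : ℝ) • (ExteriorAlgebra.ι ℝ ((finBasis ℝ T).coord i) *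
      ExteriorAlgebra.ι ℝ ((finBasis ℝ T).coord j))))
    ((finBasis ℝ T).constr ℝ fun k => R (finBasis ℝ T i) (finBasis ℝ T j) (finBasis ℝ T k))

/-- The bosonic kinetic operator `- d²/dt² + i 𝓡 d/dt` with `𝓡 = - F`. -/
def bosonicOp (F : Coeff (Forms T) T) : (Coeff (Forms T) T)[X] :=
  -Polynomial.X ^ 2 + Polynomial.C (Complex.I • (-F)) * Polynomial.X

/-- The function `det_ζ ((d²/dt²) (d²/dt²)^*)^{1/2} / det_ζ (Δ Δ^*)^{1/2}`, for the bosonic kinetic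
operator `Δ`. -/
def metricFactor (c : ℂ) (r : ℝ) (F : Coeff (Forms T) T) : Forms T :=
  let N : Forms T := zetaDetSq (body T) (formConj c) r (Polynomial.X ^ 2 : (Coeff (Forms T) T)[X])
  let D : Forms T := zetaDetSq (body T) (formConj c) r (bosonicOp F)
  powAt (body T N) N (1 / 2) * Ring.inverse (powAt (body T D) D (1 / 2))

/-- The form `det^{1/2} (f (F / 2 π i)) = exp (½ tr log f (F / 2 π i))` with the characteristic
series `f = (x / 2) / sinh (x / 2)`. -/
def ahatForm (F : Coeff (Forms T) T) : Forms T :=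
  expAt 0 ((2⁻¹ : ℂ) • coeffTrace (Forms T) T
    (nilEval logSeries (nilEval ahatSeries ((2 * (Real.pi : ℂ) * Complex.I)⁻¹ • F) - 1)))

/-- The value at `r` of the function on `ℝ_{>0} × πT` of a form: a form `w` of degree `k` is sent to
`(2 π r)^{k/2} w`. -/
def formFunction (r : ℝ) (w : Forms T) : Forms T := scaleForms (Real.sqrt (2 * Real.pi * r)) w

end Kinetic

/-! ### The relative super determinant line over the super family -/

section SuperFamily

variable (r : ℝ) (T : Type*) [NormedAddCommGroup T] [InnerProductSpace ℝ T]
  [FiniteDimensional ℝ T] (n : ℕ)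

/-- The restriction to `{r} × πT` of the relative super determinant line: the pullback of the line
of the reduced family, as a module over the functions on `πT`. -/
abbrev SuperLine : Type _ := Forms T ⊗[ℝ] RelLine r T n

/-- The pullback of the relative super determinant section. -/
def superSection : SuperLine r T n := (1 : Forms T) ⊗ₜ[ℝ] relSection r T n

variable {r T n}

/-- The real structure of the complexification `Forms T ⊗ L` of a pulled back real line `L`. -/
def superConj {L : Type*} [AddCommGroup L] [Module ℝ L] (c : ℂ) :
    Forms T ⊗[ℝ] L →ₗ[ℝ] Forms T ⊗[ℝ] L :=
  LinearMap.rTensor L (formConj c : Forms T →ₐ[ℝ] Forms T).toLinearMap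

/-- The Hermitian metric on `Forms T ⊗ L` that rescales the pullback of the metric `B` of the real
line `L` by the function `ρ`: `⟨a ⊗ u, b ⊗ v⟩ = a ρ (conj b) B (u, v)`. -/
def superMetric {L : Type*} [AddCommGroup L] [Module ℝ L] (c : ℂ) (ρ : Forms T)
    (B : LinearMap.BilinForm ℝ L) : Forms T ⊗[ℝ] L →ₗ[ℝ] Forms T ⊗[ℝ] L →ₗ[ℝ] Forms T :=
  (LinearMap.BilinMap.tmul
    ((LinearMap.mul ℝ (Forms T)).compl₁₂ (LinearMap.mulRight ℝ ρ)
      (formConj c : Forms T →ₐ[ℝ] Forms T).toLinearMap)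
    B).compr₂ (TensorProduct.rid ℝ (Forms T)).toLinearMap

end SuperFamily

/-! ### Riemannian manifolds -/

section Manifold

variable {n : ℕ} {M : Type*} [TopologicalSpace M] [ChartedSpace (EuclideanSpace ℝ (Fin n)) M]
  [IsManifold (𝓡 n) ∞ M] [RiemannianBundle (fun x : M ↦ TangentSpace (𝓡 n) x)]
  [IsContMDiffRiemannianBundle (𝓡 n) ∞ (EuclideanSpace ℝ (Fin n))
    (fun x : M ↦ TangentSpace (𝓡 n) x)]

instance (x : M) : FiniteDimensional ℝ (TangentSpace (𝓡 n) x) :=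
  inferInstanceAs (FiniteDimensional ℝ (EuclideanSpace ℝ (Fin n)))

variable (M) in
/-- Affine connections on `M`. -/
abbrev Connection : Type _ :=
  CovariantDerivative (𝓡 n) (EuclideanSpace ℝ (Fin n)) (fun x : M ↦ TangentSpace (𝓡 n) x)

instance : IsContMDiffRiemannianBundle (𝓡 n) 1 (EuclideanSpace ℝ (Fin n))
    (fun x : M ↦ TangentSpace (𝓡 n) x) :=
  IsContMDiffRiemannianBundle.of_le (n := ∞) (by norm_cast)

/-- The Levi-Civita connection: the smooth, torsion free, metric connection. -/
structure IsLeviCivita (conn : Connection (n := n) M) : Prop where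
  smooth : conn.ContMDiffCovariantDerivative ∞
  torsion_eq_zero : conn.torsion = 0
  metric : conn.IsMetricCompatible

/-- The curvature `R (u, v) w = ∇_u ∇_v w - ∇_v ∇_u w - ∇_{[u, v]} w`, computed with vector fields
that extend the given tangent vectors. -/
def curvature (conn : Connection (n := n) M) (x : M) (u v w : TangentSpace (𝓡 n) x) :
    TangentSpace (𝓡 n) x :=
  let U : (y : M) → TangentSpace (𝓡 n) y := FiberBundle.extend (EuclideanSpace ℝ (Fin n)) u
  let V : (y : M) → TangentSpace (𝓡 n) y := FiberBundle.extend (EuclideanSpace ℝ (Fin n)) v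
  let W : (y : M) → TangentSpace (𝓡 n) y := FiberBundle.extend (EuclideanSpace ℝ (Fin n)) w
  conn (fun y => conn W y (V y)) x (U x) - conn (fun y => conn W y (U y)) x (V x)
    - conn W x (VectorField.mlieBracket (𝓡 n) U V x)

variable (n M) in
/-- Functions on `ℝ_{>0} × πTM`, as families of forms on the tangent spaces. The values at `r ≤ 0`
are irrelevant. -/
abbrev SuperFunction : Type _ := (_ : ℝ) → (x : M) → Forms (TangentSpace (𝓡 n) x)

/-- The trivialization of the bundle of forms that is induced by the trivialization of the tangent
bundle around `x₀`. -/
def trivForms (x₀ x : M) :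
    Forms (TangentSpace (𝓡 n) x) →ₐ[ℂ] Forms (EuclideanSpace ℝ (Fin n)) :=
  mapForms (LinearMap.dualMap ((trivializationAt (EuclideanSpace ℝ (Fin n))
    (fun y : M ↦ TangentSpace (𝓡 n) y) x₀).symmL ℝ x : EuclideanSpace ℝ (Fin n) →ₗ[ℝ] _))

/-- Smooth functions on `ℝ_{>0} × πTM`. -/
def SuperFunction.IsSmooth (f : SuperFunction n M) : Prop :=
  ∀ (x₀ : M) (l : Forms (EuclideanSpace ℝ (Fin n)) →ₗ[ℂ] ℂ),
    ContMDiffOn (𝓘(ℝ, ℝ).prod (𝓡 n)) 𝓘(ℝ, ℂ) ∞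
      (fun p : ℝ × M => l (trivForms x₀ p.2 (f p.1 p.2)))
      (Set.Ioi 0 ×ˢ (trivializationAt (EuclideanSpace ℝ (Fin n))
        (fun y : M ↦ TangentSpace (𝓡 n) y) x₀).baseSet)

/-- The function on `ℝ_{>0} × πTM` given by the `Â`-form of `M`. -/
def ahatFunction (conn : Connection (n := n) M) : SuperFunction n M := fun r x =>
  formFunction r (ahatForm (curvatureForm (curvature conn x)))

variable (n M) in
/-- Sections of the relative super determinant line over `ℝ_{>0} × πTM`. -/
abbrev SuperLineSection : Type _ := (r : ℝ) → (x : M) → SuperLine r (TangentSpace (𝓡 n) x) n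

/-- Smooth sections: the smooth structure is the one for which the determinant section of the
family of invertible operators is a smooth frame. -/
def SuperLineSection.IsSmooth (s : SuperLineSection n M) : Prop :=
  ∃ f : SuperFunction n M, f.IsSmooth ∧
    ∀ r, 0 < r → ∀ x, s r x = f r x • superSection r (TangentSpace (𝓡 n) x) n

/-- The real structure of the relative super determinant line over `ℝ_{>0} × πTM`. -/
def lineConj (c : ℂ) (r : ℝ) (x : M) (u : SuperLine r (TangentSpace (𝓡 n) x) n) :
    SuperLine r (TangentSpace (𝓡 n) x) n :=
  superConj (T := TangentSpace (𝓡 n) x) (L := RelLine r (TangentSpace (𝓡 n) x) n) c u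

/-- The Hermitian metric of the relative super determinant line over `ℝ_{>0} × πTM`. -/
def lineMetric (conn : Connection (n := n) M) (c : ℂ) (r : ℝ) (x : M)
    (u v : SuperLine r (TangentSpace (𝓡 n) x) n) : Forms (TangentSpace (𝓡 n) x) :=
  superMetric (T := TangentSpace (𝓡 n) x) (L := RelLine r (TangentSpace (𝓡 n) x) n) c
    (metricFactor c r (curvatureForm (curvature conn x)))
    (relMetric r (TangentSpace (𝓡 n) x) n) u v

/-- The relative super determinant section divided by the function `Â`. -/
def ahatSection (conn : Connection (n := n) M) : SuperLineSection n M := fun r x =>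
  Ring.inverse (ahatFunction conn r x) • superSection r (TangentSpace (𝓡 n) x) n

/-- Multiplication by the section `s` is an isomorphism of the trivial real line bundle (with the
standard real structure and the standard metric) with the relative super determinant line. -/
structure IsGeometricTrivialization (conn : Connection (n := n) M) (c : ℂ)
    (s : SuperLineSection n M) : Prop where
  bijective : ∀ r, 0 < r → ∀ x,
    Function.Bijective fun f : Forms (TangentSpace (𝓡 n) x) => f • s r x
  smooth : ∀ f : SuperFunction n M,
    f.IsSmooth ↔ SuperLineSection.IsSmooth fun r x => f r x • s r x
  real : ∀ r, 0 < r → ∀ x, ∀ f : Forms (TangentSpace (𝓡 n) x),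
    lineConj c r x (f • s r x) = formConj c f • s r x
  isometry : ∀ r, 0 < r → ∀ x, ∀ f g : Forms (TangentSpace (𝓡 n) x),
    lineMetric conn c r x (f • s r x) (g • s r x) = f * formConj c g

end Manifold

end SigmaModel

namespace SigmaModel

/-! ### Calculus of power series of nilpotent elements -/

section NilEval

variable {A B : Type*} [Ring A] [Algebra ℂ A] [Ring B] [Algebra ℂ B]

/-! On the Fourier mode of frequency `λ = 2πm/r` the bosonic operator is `λ²(1 + F/λ)`. The
curvature is skew-adjoint and `F` has form degree two, so the pointwise adjoint of `F` is `-c²F`.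
Hence `Δ Δ*` acts by `λ⁴(1 + q(F/λ))`, where `1 + q` is `1 - x²` for `c = 1` and `(1 + x)²` for `c =
-i`. Both logarithms have the coefficient `-1/d` in degree `2d`, and odd degrees cancel between the
modes `m` and `-m`. The two conjugations therefore lead to the same determinant
(`modeBlock_bosonicOp`, `coeff_log_blockSeries`).

Since `F` is nilpotent, expanding the power `-s` of a block writes the zeta function as a finite sum
over `e` of multiples of `tr F^e`. Each coefficient is the `x^e` coefficient of `(1 + q)^(-s)` times
a sum over modes, which is elementary in the Riemann zeta function at `4s + e`. For `e > 0` the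
first factor vanishes at `s = 0`, with derivative minus the coefficient of `log (1 + q)`
(`isZetaDet_sum`). The term `e = 0` is a number shared with `d²/dt²` and drops out of the metric
factor, which becomes `exp τ` with `τ = ∑ ζ(2d)/d (r/2π)^(2d) tr F^(2d)` (`metricFactor_eq`).

On the other side, `x (log f)' = 1 - x/2 - x/(e^x - 1)`, so the coefficients of `log f` are
Bernoulli numbers, that is, values of `ζ` at even integers. Rescaling a form of degree `4d` by
`(2πr)^(2d)` then turns `Â` into `exp (τ/2)` (`formFunction_ahatForm`). Only real forms of degree
divisible by four occur in `τ`, so it is central and fixed by both conjugations. The operator `d/dt`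
is invertible on loops of mean zero, hence the reduced lines have canonical generators; the relative
one has norm one because `TX` and the trivial bundle have the same rank (`relMetric_self`). So the
squared norm of `s` is `exp (-τ/2) exp τ exp (-τ/2) = 1`.

The geometric input is that the curvature, computed with arbitrary extensions of tangent vectors, is
a smooth skew-adjoint tensor (`curvatureOp_congr`, `inner_curvatureOp_self`,
`pushCoeff_curvatureForm`). Then all `exp (zτ)` are smooth (`isSmooth_expTau`), which gives both
directions of the smoothness statement. -/

lemma nilEval_eq_sum (p : PowerSeries ℂ) {a : A} {N : ℕ} (h : a ^ N = 0) :
    nilEval p a = ∑ d ∈ Finset.range N, PowerSeries.coeff d p • a ^ d := by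
  have hle : nilpotencyClass a ≤ N := Nat.sInf_le h
  refine Finset.sum_subset (Finset.range_subset_range.2 hle) fun d _ hd => ?_
  have hn : a ^ nilpotencyClass a = 0 := pow_nilpotencyClass ⟨N, h⟩
  rw [Finset.mem_range, not_lt] at hd
  rw [pow_eq_zero_of_le hd hn, smul_zero]

/-- Through truncation, identities between power series become identities between polynomials modulo
`X ^ N`; `aeval_eq_zero_of_coeff` then disposes of the terms of high degree. -/
lemma nilEval_eq_aeval_trunc (p : PowerSeries ℂ) {a : A} {N : ℕ} (h : a ^ N = 0) :
    nilEval p a = Polynomial.aeval a (PowerSeries.trunc N p) := by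
  have e : PowerSeries.trunc N p =
      ∑ d ∈ Finset.range N, Polynomial.monomial d (PowerSeries.coeff d p) := by
    ext d
    simp [PowerSeries.coeff_trunc, Polynomial.coeff_monomial]
  rw [nilEval_eq_sum p h, e, map_sum]
  refine Finset.sum_congr rfl fun d _ => ?_
  rw [Polynomial.aeval_monomial, Algebra.smul_def]

lemma aeval_eq_zero_of_coeff {a : A} {N : ℕ} (h : a ^ N = 0) {P : ℂ[X]}
    (hP : ∀ d < N, P.coeff d = 0) : Polynomial.aeval a P = 0 := by
  rw [Polynomial.aeval_eq_sum_range]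
  refine Finset.sum_eq_zero fun d _ => ?_
  rcases lt_or_ge d N with hd | hd
  · rw [hP d hd, zero_smul]
  · rw [pow_eq_zero_of_le hd h, smul_zero]

lemma nilEval_coe {a : A} (h : IsNilpotent a) (P : ℂ[X]) :
    nilEval (P : PowerSeries ℂ) a = Polynomial.aeval a P := by
  obtain ⟨N, hN⟩ := h
  rw [nilEval_eq_aeval_trunc _ hN, ← sub_eq_zero, ← map_sub]
  refine aeval_eq_zero_of_coeff hN fun d hd => ?_
  simp [PowerSeries.coeff_trunc, hd]

lemma nilEval_add (p q : PowerSeries ℂ) (a : A) :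
    nilEval (p + q) a = nilEval p a + nilEval q a := by
  simp [nilEval, add_smul, Finset.sum_add_distrib]

lemma nilEval_smul (c : ℂ) (p : PowerSeries ℂ) (a : A) :
    nilEval (c • p) a = c • nilEval p a := by
  simp [nilEval, Finset.smul_sum, mul_smul]

lemma nilEval_mul (p q : PowerSeries ℂ) {a : A} (h : IsNilpotent a) :
    nilEval (p * q) a = nilEval p a * nilEval q a := by
  obtain ⟨N, hN⟩ := h
  rw [nilEval_eq_aeval_trunc _ hN, nilEval_eq_aeval_trunc _ hN, nilEval_eq_aeval_trunc _ hN,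
    ← map_mul, ← sub_eq_zero, ← map_sub]
  refine aeval_eq_zero_of_coeff hN fun d hd => ?_
  rw [Polynomial.coeff_sub, PowerSeries.coeff_trunc, if_pos hd, PowerSeries.coeff_mul,
    Polynomial.coeff_mul, sub_eq_zero]
  refine Finset.sum_congr rfl fun x hx => ?_
  have : x.1 + x.2 = d := by simpa using hx
  rw [PowerSeries.coeff_trunc, PowerSeries.coeff_trunc, if_pos (by omega), if_pos (by omega)]

lemma nilEval_one {a : A} (h : IsNilpotent a) : nilEval (1 : PowerSeries ℂ) a = 1 := by
  simpa using nilEval_coe h (1 : ℂ[X])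

lemma nilEval_X {a : A} (h : IsNilpotent a) : nilEval (PowerSeries.X : PowerSeries ℂ) a = a := by
  simpa using nilEval_coe h (Polynomial.X : ℂ[X])

/-- Evaluation of power series at a nilpotent element, as an algebra homomorphism. -/
def nilHom (a : A) (h : IsNilpotent a) : PowerSeries ℂ →ₐ[ℂ] A :=
  AlgHom.ofLinearMap
    { toFun := fun p => nilEval p a
      map_add' := fun p q => nilEval_add p q a
      map_smul' := fun c p => nilEval_smul c p a }
    (nilEval_one h) (fun p q => nilEval_mul p q h)

lemma nilHom_apply (a : A) (h : IsNilpotent a) (p : PowerSeries ℂ) :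
    nilHom a h p = nilEval p a := rfl

lemma nilEval_zero (p : PowerSeries ℂ) :
    nilEval p (0 : A) = PowerSeries.constantCoeff p • (1 : A) := by
  rw [nilEval_eq_sum p (a := (0 : A)) (N := 1) (by simp)]
  simp

/-- The cofactor comes from dividing `p - p(0)` by `X`. Commutation is recorded because `A` need not
be commutative, and nilpotency of `a * b` depends on it. -/
lemma nilEval_eq_constantCoeff_add (p : PowerSeries ℂ) {a : A} (h : IsNilpotent a) :
    ∃ b, Commute a b ∧ nilEval p a = PowerSeries.constantCoeff p • (1 : A) + a * b := by
  obtain ⟨q, hq⟩ := PowerSeries.X_dvd_iff.2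
    (show PowerSeries.constantCoeff (p - PowerSeries.C (PowerSeries.constantCoeff p)) = 0 by simp)
  have hX := nilEval_X h
  refine ⟨nilEval q a, ?_, ?_⟩
  · rw [Commute, SemiconjBy]
    conv_lhs => rw [← hX]
    conv_rhs => rw [← hX]
    rw [hX, ← nilEval_X h, nilEval_X h]
    have := nilEval_mul PowerSeries.X q h
    rw [mul_comm, nilEval_mul _ _ h, nilEval_X h] at this
    exact this.symm
  · have h1 : p = PowerSeries.constantCoeff p • 1 + PowerSeries.X * q := by
      rw [← hq]
      simp [PowerSeries.smul_eq_C_mul]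
    conv_lhs => rw [h1]
    rw [nilEval_add, nilEval_smul, nilEval_one h, nilEval_mul _ _ h, hX]

lemma isNilpotent_nilEval {p : PowerSeries ℂ} (hp : PowerSeries.constantCoeff p = 0) {a : A}
    (h : IsNilpotent a) : IsNilpotent (nilEval p a) := by
  obtain ⟨b, hb, e⟩ := nilEval_eq_constantCoeff_add p h
  rw [e, hp, zero_smul, zero_add]
  exact hb.isNilpotent_mul_right h

lemma nilEval_subst (p : PowerSeries ℂ) {q : PowerSeries ℂ}
    (hq : PowerSeries.constantCoeff q = 0) {a : A} (h : IsNilpotent a) :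
    nilEval (p.subst q) a = nilEval p (nilEval q a) := by
  have hs : PowerSeries.HasSubst q := PowerSeries.HasSubst.of_constantCoeff_zero' hq
  obtain ⟨N, hN⟩ := isNilpotent_nilEval hq h
  -- `N` is an exponent that kills `nilEval q a`, not `a`: the tail `X ^ N * t` of `p` dies after
  -- the substitution, and the truncation is a polynomial.
  obtain ⟨t, ht⟩ := PowerSeries.X_pow_dvd_iff (n := N)
    (φ := p - (PowerSeries.trunc N p : PowerSeries ℂ)) |>.2
    (fun d hd => by simp [PowerSeries.coeff_trunc, hd])
  have e : p = (PowerSeries.trunc N p : PowerSeries ℂ) + PowerSeries.X ^ N * t := by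
    rw [← ht]; ring
  rw [nilEval_eq_aeval_trunc p hN]
  conv_lhs => rw [e]
  rw [PowerSeries.subst_add hs, PowerSeries.subst_mul hs, PowerSeries.subst_pow hs,
    PowerSeries.subst_X hs, nilEval_add, nilEval_mul _ _ h, ← nilHom_apply a h (q ^ N), map_pow,
    nilHom_apply, hN, zero_mul, add_zero, PowerSeries.subst_coe hs, ← nilHom_apply a h,
    ← Polynomial.aeval_algHom_apply, nilHom_apply]

lemma map_nilEval (f : A →ₐ[ℂ] B) (p : PowerSeries ℂ) {a : A} (h : IsNilpotent a) :
    f (nilEval p a) = nilEval p (f a) := by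
  obtain ⟨N, hN⟩ := h
  rw [nilEval_eq_sum p hN, nilEval_eq_sum p (a := f a) (N := N) (by rw [← map_pow, hN, map_zero])]
  simp

lemma nilEval_rescale (p : PowerSeries ℂ) (c : ℂ) {a : A} (h : IsNilpotent a) :
    nilEval p (c • a) = nilEval (PowerSeries.rescale c p) a := by
  obtain ⟨N, hN⟩ := h
  rw [nilEval_eq_sum p (a := c • a) (N := N) (by rw [smul_pow, hN, smul_zero]),
    nilEval_eq_sum _ hN]
  refine Finset.sum_congr rfl fun d _ => ?_
  rw [smul_pow, smul_smul, PowerSeries.coeff_rescale, mul_comm]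

lemma nilEval_exp_eq {a : A} (h : IsNilpotent a) [Algebra ℚ A] :
    nilEval (PowerSeries.exp ℂ) a = IsNilpotent.exp a := by
  obtain ⟨N, hN⟩ := h
  rw [nilEval_eq_sum _ hN, IsNilpotent.exp_eq_sum hN]
  refine Finset.sum_congr rfl fun d _ => ?_
  rw [PowerSeries.coeff_exp, ← Rat.cast_smul_eq_qsmul ℂ]
  simp

lemma nilEval_exp_add {a b : A} (hab : Commute a b) (ha : IsNilpotent a) (hb : IsNilpotent b) :
    nilEval (PowerSeries.exp ℂ) (a + b) =
      nilEval (PowerSeries.exp ℂ) a * nilEval (PowerSeries.exp ℂ) b := by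
  let : Algebra ℚ A := Algebra.compHom A (algebraMap ℚ ℂ)
  rw [nilEval_exp_eq ha, nilEval_exp_eq hb, nilEval_exp_eq (hab.isNilpotent_add ha hb),
    IsNilpotent.exp_add_of_commute hab ha hb]

lemma nilEval_exp_zero : nilEval (PowerSeries.exp ℂ) (0 : A) = 1 := by
  rw [nilEval_zero]; simp

lemma nilEval_exp_mul_neg {a : A} (ha : IsNilpotent a) :
    nilEval (PowerSeries.exp ℂ) a * nilEval (PowerSeries.exp ℂ) (-a) = 1 := by
  rw [← nilEval_exp_add (Commute.refl a).neg_right ha ha.neg, add_neg_cancel, nilEval_exp_zero]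

lemma inverse_nilEval_exp {a : A} (ha : IsNilpotent a) :
    Ring.inverse (nilEval (PowerSeries.exp ℂ) a) = nilEval (PowerSeries.exp ℂ) (-a) := by
  have h := nilEval_exp_mul_neg ha.neg
  rw [neg_neg] at h
  exact Ring.inverse_unit ⟨_, _, nilEval_exp_mul_neg ha, h⟩

end NilEval

/-! ### Power series identities -/

section Series

open PowerSeries

/-- The differential equation is a recursion for the coefficients, started by the constant term. -/
lemma eq_exp_rescale_of_derivative {G : ℂ⟦X⟧} {s : ℂ} (h : d⁄dX ℂ G = s • G)
    (h0 : constantCoeff G = 1) : G = rescale s (exp ℂ) := by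
  ext d
  induction d with
  | zero => simpa using h0
  | succ d ih =>
    have h1 := congrArg (coeff d) h
    rw [coeff_derivative, coeff_smul, ih] at h1
    have h2 : ((d : ℂ) + 1) ≠ 0 := by exact_mod_cast d.succ_ne_zero
    have h3 : (d.factorial : ℂ) ≠ 0 := by exact_mod_cast d.factorial_ne_zero
    rw [← mul_left_inj' h2, h1]
    simp only [coeff_rescale, coeff_exp, map_div₀, map_one, map_natCast, Nat.factorial_succ,
      smul_eq_mul]
    push_cast
    field_simp
    ring

/-- The recursion of the descending Pochhammer polynomial. It yields both the differential equation
of `(1 + x)^s` in `x` and the regularity of the coefficients in `s`. -/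
lemma choose_succ_mul (s : ℂ) (d : ℕ) :
    Ring.choose s (d + 1) * ((d : ℂ) + 1) = Ring.choose s d * (s - d) := by
  have h1 := Ring.descPochhammer_eq_factorial_smul_choose s (d + 1)
  have h2 := Ring.descPochhammer_eq_factorial_smul_choose s d
  rw [descPochhammer_succ_right, Polynomial.smeval_mul, h2] at h1
  have h3 : (d.factorial : ℂ) ≠ 0 := by exact_mod_cast d.factorial_ne_zero
  simp only [Polynomial.smeval_sub, Polynomial.smeval_X, Polynomial.smeval_natCast,
    nsmul_eq_mul, Nat.factorial_succ, Nat.cast_mul, Nat.cast_succ, pow_one, pow_zero, mul_one] at h1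
  apply mul_left_cancel₀ h3
  linear_combination -h1

lemma one_add_X_mul_derivative_powSeries (s : ℂ) :
    (1 + X) * d⁄dX ℂ (powSeries s) = s • powSeries s := by
  ext d
  rw [add_mul, one_mul, map_add, coeff_smul]
  cases d with
  | zero =>
    have := choose_succ_mul s 0
    simp [powSeries, coeff_derivative] at this ⊢
  | succ d =>
    rw [coeff_succ_X_mul, coeff_derivative, coeff_derivative]
    have := choose_succ_mul s (d + 1)
    simp only [powSeries, coeff_mk, smul_eq_mul]
    push_cast at this ⊢
    linear_combination this

lemma constantCoeff_powSeries (s : ℂ) : constantCoeff (powSeries s) = 1 := by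
  simp [powSeries, ← coeff_zero_eq_constantCoeff_apply]

lemma subst_C_eq {q : ℂ⟦X⟧} (hs : HasSubst q) (c : ℂ) : (C c : ℂ⟦X⟧).subst q = C c := by
  rw [← Polynomial.coe_C, subst_coe hs, Polynomial.aeval_C, Polynomial.coe_C]
  rfl

lemma subst_one_eq {q : ℂ⟦X⟧} (hs : HasSubst q) : (1 : ℂ⟦X⟧).subst q = 1 := by
  simpa using subst_C_eq hs 1

lemma constantCoeff_subst_of_zero (p : ℂ⟦X⟧) {q : ℂ⟦X⟧} (hq : constantCoeff q = 0) :
    constantCoeff (p.subst q) = constantCoeff p := by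
  have hs : HasSubst q := HasSubst.of_constantCoeff_zero' hq
  obtain ⟨t, ht⟩ := X_dvd_iff.2 (show constantCoeff (p - C (constantCoeff p)) = 0 by simp)
  have e : p = C (constantCoeff p) + X * t := by rw [← ht]; ring
  conv_lhs => rw [e]
  rw [subst_add hs, subst_mul hs, subst_X hs, map_add, map_mul, hq, zero_mul, add_zero,
    subst_C_eq hs]
  simp

/-- This is `(e^x)^s = e^(sx)`: the substitution turns `(1 + x) G' = s G` into `G' = s G`. It lets
square roots of determinants be taken by halving exponents. -/
lemma powSeries_subst_exp_sub_one (s : ℂ) :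
    (powSeries s).subst (exp ℂ - 1) = rescale s (exp ℂ) := by
  have h0 : constantCoeff (exp ℂ - 1) = 0 := by simp
  have hs : HasSubst (exp ℂ - 1) := HasSubst.of_constantCoeff_zero' h0
  refine eq_exp_rescale_of_derivative ?_ (by
    rw [constantCoeff_subst_of_zero _ h0, constantCoeff_powSeries])
  have h := congrArg (subst (exp ℂ - 1)) (one_add_X_mul_derivative_powSeries s)
  rw [subst_mul hs, subst_add hs, subst_X hs, subst_smul hs] at h
  rw [derivative_subst hs, ← h]
  rw [subst_one_eq hs, map_sub, derivative_exp]
  simp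
  ring

lemma derivative_logSeries : (1 + X) * d⁄dX ℂ logSeries = 1 := by
  have key : ∀ d, coeff d (d⁄dX ℂ logSeries) = (-1) ^ d := by
    intro d
    have h2 : ((d : ℂ) + 1) ≠ 0 := by exact_mod_cast d.succ_ne_zero
    rw [coeff_derivative, logSeries, coeff_mk]
    push_cast
    field_simp
    ring
  ext d
  rw [add_mul, one_mul, map_add, key]
  cases d with
  | zero => simp
  | succ d =>
    rw [coeff_succ_X_mul, key, coeff_one]
    simp [pow_succ]

/-- The logarithmic derivative of `1 + q`. -/
lemma derivative_logSeries_subst {q : ℂ⟦X⟧} (hq : constantCoeff q = 0) :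
    (1 + q) * d⁄dX ℂ (logSeries.subst q) = d⁄dX ℂ q := by
  have hs : HasSubst q := HasSubst.of_constantCoeff_zero' hq
  have h := congrArg (subst q) derivative_logSeries
  rw [subst_mul hs, subst_add hs, subst_X hs, subst_one_eq hs] at h
  rw [derivative_subst hs, ← mul_assoc, h, one_mul]

lemma constantCoeff_logSeries : constantCoeff logSeries = 0 := by
  simp [logSeries, ← coeff_zero_eq_constantCoeff_apply]

/-- The series `q ^ k` starts in degree `k`, so only finitely many terms count. This finiteness
makes the coefficients of `(1 + q)^(-s)` polynomial in `s`. -/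
lemma coeff_subst_eq_sum (p : ℂ⟦X⟧) {q : ℂ⟦X⟧} (hq : constantCoeff q = 0) (e : ℕ) :
    coeff e (p.subst q) = ∑ k ∈ Finset.range (e + 1), coeff k p * coeff e (q ^ k) := by
  have hs : HasSubst q := HasSubst.of_constantCoeff_zero' hq
  obtain ⟨t, ht⟩ := X_pow_dvd_iff (n := e + 1)
    (φ := p - (trunc (e + 1) p : ℂ⟦X⟧)) |>.2
    (fun d hd => by simp [coeff_trunc, hd])
  have h1 : p = (trunc (e + 1) p : ℂ⟦X⟧) + X ^ (e + 1) * t := by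
    rw [← ht]; ring
  have h2 : trunc (e + 1) p = ∑ d ∈ Finset.range (e + 1), Polynomial.monomial d (coeff d p) := by
    ext d
    simp [coeff_trunc, Polynomial.coeff_monomial]
  have h3 : coeff e (q ^ (e + 1) * t.subst q) = 0 :=
    X_pow_dvd_iff.1 ((pow_dvd_pow_of_dvd (X_dvd_iff.2 hq) (e + 1)).mul_right _) e e.lt_succ_self
  conv_lhs => rw [h1]
  rw [subst_add hs, subst_mul hs, subst_pow hs, subst_X hs, map_add, h3, add_zero, subst_coe hs,
    h2, map_sum, map_sum]
  refine Finset.sum_congr rfl fun k _ => ?_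
  rw [Polynomial.aeval_monomial, ← coeff_C_mul]
  rfl

lemma differentiable_choose (d : ℕ) : Differentiable ℂ fun s : ℂ => Ring.choose s d := by
  induction d with
  | zero => simp
  | succ d ih =>
    have h : (fun s : ℂ => Ring.choose s (d + 1)) =
        fun s => Ring.choose s d * (s - d) / ((d : ℂ) + 1) := by
      ext s
      rw [eq_div_iff (by exact_mod_cast d.succ_ne_zero), choose_succ_mul]
    rw [h]
    fun_prop

/-- The logarithm is the derivative of `(1 + x)^s` at `s = 0`, read off coefficientwise. -/
lemma hasDerivAt_choose_zero (d : ℕ) :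
    HasDerivAt (fun s : ℂ => Ring.choose s (d + 1)) ((-1) ^ d / ((d : ℂ) + 1)) 0 := by
  induction d with
  | zero => simpa using hasDerivAt_id' (0 : ℂ)
  | succ d ih =>
    have h : (fun s : ℂ => Ring.choose s (d + 1 + 1)) =
        fun s => Ring.choose s (d + 1) * (s - (d + 1 : ℕ)) / (((d + 1 : ℕ) : ℂ) + 1) := by
      ext s
      rw [eq_div_iff (by exact_mod_cast (d + 1).succ_ne_zero), choose_succ_mul]
    rw [h]
    have h2 : ((d : ℂ) + 1) ≠ 0 := by exact_mod_cast d.succ_ne_zero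
    have h3 : ((d : ℂ) + 1 + 1) ≠ 0 := by exact_mod_cast (d + 1).succ_ne_zero
    refine ((ih.mul ((hasDerivAt_id' (0 : ℂ)).sub_const ((d + 1 : ℕ) : ℂ))).div_const
      (((d + 1 : ℕ) : ℂ) + 1)).congr_deriv ?_
    -- Since the binomial coefficient vanishes at `s = 0`, only its derivative survives in the
    -- product rule.
    rw [Ring.choose_zero_succ]
    simp
    field_simp
    ring

/-- The coefficients of `(1 + q) ^ (-s)` as functions of `s`. -/
def powCoeff (q : ℂ⟦X⟧) (e : ℕ) (s : ℂ) : ℂ := coeff e ((powSeries (-s)).subst q)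

lemma powCoeff_eq {q : ℂ⟦X⟧} (hq : constantCoeff q = 0) (e : ℕ) (s : ℂ) :
    powCoeff q e s = ∑ k ∈ Finset.range (e + 1), Ring.choose (-s) k * coeff e (q ^ k) := by
  rw [powCoeff, coeff_subst_eq_sum _ hq]
  simp [powSeries]

lemma differentiable_powCoeff {q : ℂ⟦X⟧} (hq : constantCoeff q = 0) (e : ℕ) :
    Differentiable ℂ (powCoeff q e) := by
  have h : powCoeff q e = fun s => ∑ k ∈ Finset.range (e + 1), Ring.choose (-s) k *
      coeff e (q ^ k) := funext (powCoeff_eq hq e)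
  rw [h]
  refine Differentiable.fun_sum fun k _ => Differentiable.mul_const ?_ _
  exact (differentiable_choose k).comp differentiable_neg

lemma powCoeff_zero_left {q : ℂ⟦X⟧} (hq : constantCoeff q = 0) (s : ℂ) : powCoeff q 0 s = 1 := by
  simp [powCoeff_eq hq]

lemma powCoeff_apply_zero {q : ℂ⟦X⟧} (hq : constantCoeff q = 0) {e : ℕ} (he : e ≠ 0) :
    powCoeff q e 0 = 0 := by
  rw [powCoeff_eq hq, Finset.sum_range_succ']
  simp [Ring.choose_zero_succ, coeff_one, he]

lemma hasDerivAt_powCoeff_zero {q : ℂ⟦X⟧} (hq : constantCoeff q = 0) {e : ℕ} (he : e ≠ 0) :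
    HasDerivAt (powCoeff q e) (-coeff e (logSeries.subst q)) 0 := by
  have h : powCoeff q e = fun s => ∑ k ∈ Finset.range e, Ring.choose (-s) (k + 1) *
      coeff e (q ^ (k + 1)) := by
    ext s
    rw [powCoeff_eq hq, Finset.sum_range_succ']
    simp [coeff_one, he]
  -- The summand `k = 0` carries `q ^ 0 = 1`, which has nothing in positive degree; the remaining
  -- sums match term by term.
  have h0 : coeff 0 logSeries * coeff e (q ^ 0) = 0 := by simp [coeff_one, he]
  rw [h, coeff_subst_eq_sum _ hq, Finset.sum_range_succ', h0, add_zero, ← Finset.sum_neg_distrib]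
  refine HasDerivAt.fun_sum fun k _ => ?_
  have h1 : HasDerivAt (fun s : ℂ => Ring.choose s (k + 1)) ((-1) ^ k / ((k : ℂ) + 1)) (-0) := by
    rw [neg_zero]; exact hasDerivAt_choose_zero k
  refine ((h1.comp (0 : ℂ) (hasDerivAt_neg (0 : ℂ))).mul_const
    (coeff e (q ^ (k + 1)))).congr_deriv ?_
  simp [logSeries, pow_succ]

/-- Logarithms are compared through their derivatives after clearing the denominator `u`. -/
lemma eq_of_mul_derivative_eq {u G H : ℂ⟦X⟧} (hu : u ≠ 0) (h : u * d⁄dX ℂ G = u * d⁄dX ℂ H)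
    (h0 : constantCoeff G = constantCoeff H) : G = H :=
  derivative.ext (mul_left_cancel₀ hu h) h0

lemma constantCoeff_logSeries_subst {q : ℂ⟦X⟧} (hq : constantCoeff q = 0) :
    constantCoeff (logSeries.subst q) = 0 := by
  rw [constantCoeff_subst_of_zero _ hq, constantCoeff_logSeries]

lemma C_two : (C 2 : ℂ⟦X⟧) = 2 := map_ofNat _ _

/-- The case `c = 1`: the derivative of `log (1 - x²)` is `-2x / (1 - x²)`, a geometric series. -/
lemma coeff_logSeries_subst_neg_sq {d : ℕ} (hd : d ≠ 0) :
    coeff (2 * d) (logSeries.subst (-X ^ 2 : ℂ⟦X⟧)) = -(1 / (d : ℂ)) := by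
  have hq : constantCoeff (-X ^ 2 : ℂ⟦X⟧) = 0 := by simp
  have h : logSeries.subst (-X ^ 2 : ℂ⟦X⟧) =
      mk fun e => if Even e then -(2 / (e : ℂ)) else 0 := by
    refine eq_of_mul_derivative_eq (u := 1 + -X ^ 2) ?_ ?_ ?_
    · intro h
      simpa using congrArg constantCoeff h
    · rw [derivative_logSeries_subst hq]
      have key : ∀ e, coeff e (d⁄dX ℂ (mk fun e => if Even e then -(2 / (e : ℂ)) else 0)) =
          if Even e then 0 else -2 := by
        intro e
        have h2 : ((e : ℂ) + 1) ≠ 0 := by exact_mod_cast e.succ_ne_zero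
        rw [coeff_derivative, coeff_mk]
        by_cases he : Even e
        · simp [he, Nat.even_add_one]
        · simp [he, Nat.even_add_one]
          field_simp
      ext e
      have h3 : d⁄dX ℂ (-X ^ 2 : ℂ⟦X⟧) = C (-2) * X := by
        simp [Derivation.leibniz_pow, C_two]
      rw [h3, add_mul, one_mul, neg_mul, map_add, map_neg (coeff e), key,
        coeff_X_pow_mul', coeff_C_mul, coeff_X]
      rcases e with _ | _ | e
      · simp
      · simp
      · simp [key, Nat.even_add_one]
    · rw [constantCoeff_logSeries_subst hq, ← coeff_zero_eq_constantCoeff_apply, coeff_mk]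
      simp
  have hd' : (d : ℂ) ≠ 0 := by exact_mod_cast hd
  rw [h, coeff_mk, if_pos (even_two_mul d)]
  push_cast
  field_simp

/-- The case `c = -i`: `log ((1 + x)²) = 2 log (1 + x)`. The even coefficients agree with those of
`log (1 - x²)`, although the odd ones do not. -/
lemma coeff_logSeries_subst_two_mul_add_sq {d : ℕ} (hd : d ≠ 0) :
    coeff (2 * d) (logSeries.subst (2 * X + X ^ 2 : ℂ⟦X⟧)) = -(1 / (d : ℂ)) := by
  have hq : constantCoeff (2 * X + X ^ 2 : ℂ⟦X⟧) = 0 := by simp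
  have h : logSeries.subst (2 * X + X ^ 2 : ℂ⟦X⟧) = 2 * logSeries := by
    refine eq_of_mul_derivative_eq (u := 1 + (2 * X + X ^ 2)) ?_ ?_ ?_
    · intro h
      simpa using congrArg constantCoeff h
    · rw [derivative_logSeries_subst hq]
      have h1 := derivative_logSeries
      have h2 : d⁄dX ℂ (2 * logSeries) = 2 * d⁄dX ℂ logSeries := by
        rw [← C_two, ← smul_eq_C_mul, Derivation.map_smul, smul_eq_C_mul]
      have h3 : d⁄dX ℂ (2 * X + X ^ 2 : ℂ⟦X⟧) = 2 + 2 * X := by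
        rw [← C_two, ← smul_eq_C_mul, map_add, Derivation.map_smul, smul_eq_C_mul]
        simp [Derivation.leibniz_pow, smul_eq_C_mul, C_two]
      rw [h2, h3]
      linear_combination (-2 * (1 + X)) * h1
    · rw [constantCoeff_logSeries_subst hq]
      simp [constantCoeff_logSeries]
  have hd' : (d : ℂ) ≠ 0 := by exact_mod_cast hd
  rw [h, ← C_two, coeff_C_mul, logSeries, coeff_mk, pow_succ, pow_mul]
  push_cast
  field_simp
  simp

/-- Both sides are `2 sinh (x/2)`. -/
lemma X_mul_sinhSeries :
    X * sinhSeries = rescale (1 / 2 : ℂ) (exp ℂ) - rescale (-(1 / 2) : ℂ) (exp ℂ) := by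
  ext e
  cases e with
  | zero => rw [coeff_zero_X_mul, map_sub, coeff_rescale, coeff_rescale]; simp
  | succ e =>
    rw [coeff_succ_X_mul, map_sub, coeff_rescale, coeff_rescale, coeff_exp, sinhSeries, coeff_mk]
    have h3 : ((e + 1).factorial : ℂ) ≠ 0 := by exact_mod_cast (e + 1).factorial_ne_zero
    by_cases he : Even e
    · rw [if_pos he, (Even.add_one he).neg_pow]
      have h4 : ((1 / 2 : ℂ)) ^ e * 2 ^ e = 1 := by rw [← mul_pow]; norm_num
      simp only [map_div₀, map_one, map_natCast]
      field_simp
      rw [pow_succ]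
      linear_combination -h4
    · rw [if_neg he, (Nat.even_add_one.2 he).neg_pow, sub_self]

lemma constantCoeff_sinhSeries : constantCoeff sinhSeries = 1 := by
  simp [sinhSeries, ← coeff_zero_eq_constantCoeff_apply]

lemma derivative_rescale_exp (c : ℂ) : d⁄dX ℂ (rescale c (exp ℂ)) = C c * rescale c (exp ℂ) := by
  ext d
  have h3 : (d.factorial : ℂ) ≠ 0 := by exact_mod_cast d.factorial_ne_zero
  have h2 : ((d : ℂ) + 1) ≠ 0 := by exact_mod_cast d.succ_ne_zero
  rw [coeff_derivative, coeff_C_mul]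
  simp only [coeff_rescale, coeff_exp, map_div₀, map_one, map_natCast, Nat.factorial_succ]
  push_cast
  field_simp
  ring

/-- The product of `x / (e^x - 1)` and `(e^(x/2) - e^(-x/2)) / x` is `e^(-x/2)`; the factors `x` and
`e^(x/2)` are cancelled inside the ring of power series. -/
lemma bernoulli_mul_sinhSeries :
    bernoulliPowerSeries ℂ * sinhSeries = rescale (-(1 / 2) : ℂ) (exp ℂ) := by
  have h1 := bernoulliPowerSeries_mul_exp_sub_one ℂ
  have h2 := X_mul_sinhSeries
  have h3 : rescale (1 / 2 : ℂ) (exp ℂ) * rescale (-(1 / 2) : ℂ) (exp ℂ) = 1 := by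
    rw [exp_mul_exp_eq_exp_add]; simp
  have h4 : rescale (1 / 2 : ℂ) (exp ℂ) * rescale (1 / 2 : ℂ) (exp ℂ) = exp ℂ := by
    rw [exp_mul_exp_eq_exp_add]; norm_num
  refine mul_left_cancel₀ (X_ne_zero (R := ℂ)) ?_
  generalize rescale (1 / 2 : ℂ) (exp ℂ) = a at *
  generalize rescale (-(1 / 2) : ℂ) (exp ℂ) = b at *
  rw [← h4] at h1
  linear_combination bernoulliPowerSeries ℂ * h2 + b * h1 -
    bernoulliPowerSeries ℂ * a * h3

/-- With `g = sinh (x/2) / (x/2)` one has `log f = -log g` and `x g'/g = (x/2) coth (x/2) - 1`,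
while `(x/2) coth (x/2) = x/2 + x/(e^x - 1)`. -/
lemma X_mul_derivative_log_ahatSeries :
    X * d⁄dX ℂ (logSeries.subst (ahatSeries - 1)) =
      1 - C (1 / 2 : ℂ) * X - bernoulliPowerSeries ℂ := by
  have hf : ahatSeries * sinhSeries = 1 :=
    PowerSeries.inv_mul_cancel _ (by rw [constantCoeff_sinhSeries]; exact one_ne_zero)
  have hq : constantCoeff (ahatSeries - 1) = 0 := by
    simp [ahatSeries, constantCoeff_sinhSeries]
  have hL := derivative_logSeries_subst hq
  rw [add_sub_cancel, map_sub] at hL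
  have hd := congrArg (d⁄dX ℂ) hf
  have hX := congrArg (d⁄dX ℂ) X_mul_sinhSeries
  have hB := bernoulli_mul_sinhSeries
  have hS := X_mul_sinhSeries
  rw [map_sub, derivative_rescale_exp, derivative_rescale_exp, Derivation.leibniz] at hX
  rw [Derivation.leibniz] at hd
  have h1 : d⁄dX ℂ (1 : ℂ⟦X⟧) = 0 := by
    rw [← map_one C, derivative_C]
  rw [h1] at hL hd
  have h2 : (C (-(1 / 2)) : ℂ⟦X⟧) = -C (1 / 2) := by simp
  have h5 : (C (1 / 2) : ℂ⟦X⟧) * 2 = 1 := by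
    rw [← C_two, ← map_mul]; norm_num
  rw [h2] at hX
  simp only [smul_eq_mul, derivative_X, mul_one] at hX hd
  rw [sub_zero] at hL
  set Lp := d⁄dX ℂ (logSeries.subst (ahatSeries - 1))
  generalize rescale (1 / 2 : ℂ) (exp ℂ) = a at *
  generalize rescale (-(1 / 2) : ℂ) (exp ℂ) = b at *
  have hg : sinhSeries ≠ 0 := by
    intro h
    rw [h, mul_zero] at hf
    exact zero_ne_one hf
  have hf0 : ahatSeries ≠ 0 := by
    intro h
    rw [h, zero_mul] at hf
    exact zero_ne_one hf
  refine mul_left_cancel₀ hg ?_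
  -- Here `f g = 1` is differentiated to replace `f'/f` by `-g'/g`; what remains is `g (log f)' =
  -- -g'`.
  have e1 : sinhSeries * Lp = - ahatSeries * d⁄dX ℂ sinhSeries * sinhSeries := by
    have : ahatSeries * sinhSeries * Lp = sinhSeries * d⁄dX ℂ ahatSeries := by
      linear_combination sinhSeries * hL
    linear_combination sinhSeries * this + sinhSeries * hd - sinhSeries * Lp * hf
  have e2 : sinhSeries * Lp = - d⁄dX ℂ sinhSeries := by
    linear_combination e1 - d⁄dX ℂ sinhSeries * hf
  linear_combination X * e2 - hX + C (1 / 2) * hS + hB - b * h5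

lemma log_ahatSeries_constantCoeff : constantCoeff (ahatSeries - 1) = 0 := by
  simp [ahatSeries, constantCoeff_sinhSeries]

lemma coeff_log_ahatSeries {e : ℕ} (he : 2 ≤ e) :
    coeff e (logSeries.subst (ahatSeries - 1)) =
      -((bernoulli e : ℂ) / (e.factorial * e)) := by
  obtain ⟨e, rfl⟩ : ∃ k, e = k + 2 := ⟨e - 2, by omega⟩
  have h := congrArg (coeff (e + 2)) X_mul_derivative_log_ahatSeries
  rw [coeff_succ_X_mul, coeff_derivative, map_sub, map_sub, coeff_C_mul, coeff_X,
    bernoulliPowerSeries, coeff_mk, coeff_one] at h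
  have h2 : (((e + 2 : ℕ) : ℂ)) ≠ 0 := by exact_mod_cast (e + 1).succ_ne_zero
  rw [← mul_left_inj' h2]
  simp at h
  push_cast at *
  field_simp
  rw [show (e : ℂ) + 2 = e + 1 + 1 by ring, h]

/-- Odd Bernoulli numbers vanish beyond the first. In degree one, `B₁ = -1/2` is compensated by the
term `-x/2`. -/
lemma coeff_log_ahatSeries_of_odd {e : ℕ} (he : Odd e) :
    coeff e (logSeries.subst (ahatSeries - 1)) = 0 := by
  rcases Nat.lt_or_ge 1 e with h | h
  · rw [coeff_log_ahatSeries h, bernoulli_eq_zero_of_odd he h]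
    simp
  · obtain rfl : e = 1 := by obtain ⟨k, rfl⟩ := he; omega
    have h := congrArg (coeff 1) X_mul_derivative_log_ahatSeries
    have h' := coeff_succ_X_mul (R := ℂ) 0 (d⁄dX ℂ (logSeries.subst (ahatSeries - 1)))
    rw [zero_add, coeff_derivative, h, map_sub, map_sub, coeff_C_mul, bernoulliPowerSeries,
      coeff_mk, coeff_one] at h'
    norm_num at h'
    exact h'.symm

/-- Euler's formula for `ζ(2d)`. Written with `ζ`, the coefficients can be matched directly with the
sums over Fourier modes. -/
lemma coeff_log_ahatSeries_two_mul {d : ℕ} (hd : d ≠ 0) :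
    coeff (2 * d) (logSeries.subst (ahatSeries - 1)) =
      (-1) ^ d * riemannZeta (2 * d) / (d * (2 * (Real.pi : ℂ)) ^ (2 * d)) := by
  have h2 : (d : ℂ) ≠ 0 := by exact_mod_cast hd
  have h3 : ((2 * d).factorial : ℂ) ≠ 0 := by exact_mod_cast (2 * d).factorial_ne_zero
  have hpi : (Real.pi : ℂ) ≠ 0 := by exact_mod_cast Real.pi_ne_zero
  have h4 : (2 : ℂ) ^ (2 * d) = 2 * 2 ^ (2 * d - 1) := by
    rw [← pow_succ']; congr 1; omega
  have h5 : ((-1 : ℂ) ^ d) * (-1) ^ d = 1 := by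
    rw [← mul_pow]; simp
  rw [coeff_log_ahatSeries (by omega), riemannZeta_two_mul_nat hd, mul_pow, h4, pow_succ]
  push_cast
  field_simp
  linear_combination (bernoulli (2 * d) : ℂ) * h5

end Series


/-! ### Zeta functions of constant coefficient operators -/

section ModeSums

/-- The frequency `2 π m / r` of the mode `m`. -/
def freq (r : ℝ) (m : ℤ) : ℂ := ((2 * Real.pi / r * m : ℝ) : ℂ)

lemma freq_ne_zero {r : ℝ} (hr : 0 < r) {m : ℤ} (hm : m ≠ 0) : freq r m ≠ 0 := by
  have : (m : ℝ) ≠ 0 := by exact_mod_cast hm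
  have h := Real.pi_pos
  exact Complex.ofReal_ne_zero.2 (by positivity)

lemma freq_neg (r : ℝ) (m : ℤ) : freq r (-m) = -freq r m := by
  simp [freq]

/-- The value of `∑ |2 π m / r| ^ (- 2 p s) (2 π m / r) ^ (- e)` over the nonzero integers `m`. -/
def circleZeta (r : ℝ) (p e : ℕ) (s : ℂ) : ℂ :=
  if Even e then
    2 * (((2 * Real.pi / r : ℝ) : ℂ) ^ (-(2 * p * s + e)) * riemannZeta (2 * p * s + e))
  else 0

lemma ofReal_pow_cpow {x : ℝ} (hx : 0 < x) (k : ℕ) (s : ℂ) :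
    ((x : ℂ) ^ k) ^ s = (x : ℂ) ^ (k * s) := by
  rw [← Complex.ofReal_pow, Complex.cpow_def_of_ne_zero (by exact_mod_cast (pow_pos hx k).ne'),
    Complex.cpow_def_of_ne_zero (by exact_mod_cast hx.ne'), ← Complex.ofReal_log (pow_pos hx k).le,
    ← Complex.ofReal_log hx.le, Real.log_pow]
  push_cast
  ring_nf

lemma hasSum_zeta {w : ℂ} (hw : 1 < w.re) :
    HasSum (fun n : ℕ => (((n : ℝ) + 1 : ℝ) : ℂ) ^ (-w)) (riemannZeta w) := by
  have h := Complex.summable_one_div_nat_cpow.2 hw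
  have h1 := (summable_nat_add_iff 1).2 h
  have h2 := h1.hasSum
  have e : (fun n : ℕ => (((n : ℝ) + 1 : ℝ) : ℂ) ^ (-w)) =
      fun n : ℕ => 1 / ((n + 1 : ℕ) : ℂ) ^ w := by
    ext n
    rw [Complex.cpow_neg, one_div]
    push_cast
    rfl
  rw [e, zeta_eq_tsum_one_div_nat_add_one_cpow hw]
  simpa using h2

/-- For positive modes the frequency is a positive real number, so its complex powers multiply
without any branch problem. -/
lemma freq_term {r : ℝ} (hr : 0 < r) (p e : ℕ) (s : ℂ) (n : ℕ) :
    (freq r (n + 1) ^ (2 * p)) ^ (-s) * (freq r (n + 1))⁻¹ ^ e =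
      ((2 * Real.pi / r : ℝ) : ℂ) ^ (-(2 * p * s + e)) *
        (((n : ℝ) + 1 : ℝ) : ℂ) ^ (-(2 * p * s + e)) := by
  have h2 : 0 < 2 * Real.pi / r := by have := Real.pi_pos; positivity
  have h3 : (0 : ℝ) < (n : ℝ) + 1 := by positivity
  have h1 : 0 < 2 * Real.pi / r * ((n : ℝ) + 1) := by positivity
  have hf : freq r (n + 1) = ((2 * Real.pi / r * ((n : ℝ) + 1) : ℝ) : ℂ) := by
    simp [freq]
  rw [hf, ofReal_pow_cpow h1, ← Complex.mul_cpow_ofReal_nonneg h2.le h3.le, ← Complex.ofReal_mul,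
    ← Complex.cpow_natCast, Complex.inv_cpow _ _ (by
      rw [Complex.arg_ofReal_of_nonneg h1.le]; exact Real.pi_pos.ne),
    ← Complex.cpow_neg, ← Complex.cpow_add _ _ (by exact_mod_cast h1.ne')]
  congr 1
  push_cast
  ring

lemma hasSum_modes {r : ℝ} (hr : 0 < r) {p : ℕ} (e : ℕ) {s : ℂ}
    (hs : 1 < (2 * p * s).re) :
    HasSum (fun m : {m : ℤ // m ≠ 0} => (freq r m ^ (2 * p)) ^ (-s) * (freq r m)⁻¹ ^ e)
      (circleZeta r p e s) := by
  have hw : 1 < (2 * p * s + e).re := by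
    rw [Complex.add_re, Complex.natCast_re]
    have : (0 : ℝ) ≤ e := Nat.cast_nonneg e
    linarith
  have h := (hasSum_zeta hw).mul_left (((2 * Real.pi / r : ℝ) : ℂ) ^ (-(2 * p * s + e)))
  -- The summand is extended by zero to `m = 0`, so that the sum over all integers splits into
  -- positive and negative modes. The latter differ by the sign `(-1)^e`, since the exponent `2p` is
  -- even.
  let f : ℤ → ℂ := fun m => if m = 0 then 0 else (freq r m ^ (2 * p)) ^ (-s) * (freq r m)⁻¹ ^ e
  set W := ((2 * Real.pi / r : ℝ) : ℂ) ^ (-(2 * p * s + e)) * riemannZeta (2 * p * s + e) with hW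
  have h1 : HasSum (fun n : ℕ => f (n + 1)) W := by
    refine h.congr_fun fun n => ?_
    rw [← freq_term hr]
    exact if_neg (by omega)
  have h2 : HasSum (fun n : ℕ => f (-(n + 1))) ((-1) ^ e * W) := by
    refine (h.mul_left ((-1) ^ e)).congr_fun fun n => ?_
    rw [← freq_term hr]
    simp only [f]
    rw [if_neg (by omega), freq_neg, (even_two_mul p).neg_pow, inv_neg, neg_pow (freq r (n + 1))⁻¹]
    ring
  have h3 := HasSum.of_add_one_of_neg_add_one h1 h2
  have h4 : W + f 0 + (-1) ^ e * W = circleZeta r p e s := by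
    simp only [f, circleZeta, if_true, ← hW]
    by_cases he : Even e
    · rw [if_pos he, he.neg_one_pow]; ring
    · rw [if_neg he, (Nat.not_even_iff_odd.1 he).neg_one_pow]; ring
  rw [h4] at h3
  have h5 := (hasSum_subtype_iff_of_support_subset (s := {m : ℤ | m ≠ 0}) (f := f) (fun m hm => by
    intro h0
    exact hm (if_pos h0))).2 h3
  refine h5.congr_fun fun m => ?_
  exact (if_neg m.2).symm

lemma meromorphicAt_riemannZeta (s : ℂ) : MeromorphicAt riemannZeta s := by
  by_cases hs : s = 1
  · have h1 : MeromorphicAt (fun s => (completedRiemannZeta₀ s - 1 / s - 1 / (1 - s)) *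
        (Complex.Gammaℝ s)⁻¹) s := by
      have h2 : AnalyticAt ℂ completedRiemannZeta₀ s :=
        differentiable_completedZeta₀.analyticAt s
      have h3 : AnalyticAt ℂ (fun s => (Complex.Gammaℝ s)⁻¹) s :=
        Complex.differentiable_Gammaℝ_inv.analyticAt s
      have h4 : MeromorphicAt (fun s : ℂ => s) s := analyticAt_id.meromorphicAt
      exact ((h2.meromorphicAt.sub ((MeromorphicAt.const 1 s).div h4)).sub
        ((MeromorphicAt.const 1 s).div ((MeromorphicAt.const 1 s).sub h4))).mul h3.meromorphicAt
    refine h1.congr ?_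
    have h0 : ∀ᶠ z in nhds s, z ≠ 0 := isOpen_ne.mem_nhds (by rw [hs]; exact one_ne_zero)
    filter_upwards [h0.filter_mono nhdsWithin_le_nhds] with z hz
    rw [riemannZeta_def_of_ne_zero hz, completedRiemannZeta_eq, div_eq_mul_inv _ (Complex.Gammaℝ z)]
  · have h : AnalyticAt ℂ riemannZeta s := by
      refine (DifferentiableOn.analyticAt (s := {1}ᶜ) ?_ (isOpen_ne.mem_nhds hs))
      exact fun z hz => (differentiableAt_riemannZeta hz).differentiableWithinAt
    exact h.meromorphicAt

lemma analyticAt_riemannZeta {s : ℂ} (hs : s ≠ 1) : AnalyticAt ℂ riemannZeta s := by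
  refine (DifferentiableOn.analyticAt (s := {1}ᶜ) ?_ (isOpen_ne.mem_nhds hs))
  exact fun z hz => (differentiableAt_riemannZeta hz).differentiableWithinAt

lemma meromorphicAt_circleZeta {r : ℝ} (hr : 0 < r) {p : ℕ} (hp : p ≠ 0) (e : ℕ) (s : ℂ) :
    MeromorphicAt (circleZeta r p e) s := by
  unfold circleZeta
  split_ifs with he
  · have ha : AnalyticAt ℂ (fun s : ℂ => 2 * p * s + e) s := by fun_prop
    have hb : AnalyticAt ℂ
        (fun s : ℂ => ((2 * Real.pi / r : ℝ) : ℂ) ^ (-(2 * p * s + e))) s := by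
      have hpos : 0 < 2 * Real.pi / r := by have := Real.pi_pos; positivity
      refine AnalyticAt.cpow analyticAt_const ha.neg ?_
      exact Or.inl (by simpa using hpos)
    have hd : deriv (fun s : ℂ => 2 * p * s + e) s ≠ 0 := by
      have : HasDerivAt (fun s : ℂ => 2 * p * s + e) (2 * p * 1) s :=
        ((hasDerivAt_id' s).const_mul _).add_const _
      rw [this.deriv]
      simpa using hp
    have hz : MeromorphicAt (fun s : ℂ => riemannZeta (2 * p * s + e)) s :=
      (meromorphicAt_riemannZeta _).comp_analyticAt ha
    exact (MeromorphicAt.const 2 s).mul (hb.meromorphicAt.mul hz)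
  · exact MeromorphicAt.const 0 s

lemma analyticAt_circleZeta_zero {r : ℝ} (hr : 0 < r) (p e : ℕ) :
    AnalyticAt ℂ (circleZeta r p e) 0 := by
  unfold circleZeta
  split_ifs with he
  · have ha : AnalyticAt ℂ (fun s : ℂ => 2 * p * s + e) 0 := by fun_prop
    have hb : AnalyticAt ℂ
        (fun s : ℂ => ((2 * Real.pi / r : ℝ) : ℂ) ^ (-(2 * p * s + e))) 0 := by
      have hpos : 0 < 2 * Real.pi / r := by have := Real.pi_pos; positivity
      refine AnalyticAt.cpow analyticAt_const ha.neg ?_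
      exact Or.inl (by simpa using hpos)
    have hz : AnalyticAt ℂ (fun s : ℂ => riemannZeta (2 * p * s + e)) 0 := by
      refine AnalyticAt.fun_comp (analyticAt_riemannZeta ?_) ha
      rw [mul_zero, zero_add]
      -- At `s = 0` the argument of zeta is `e`. It avoids the pole at `1` because `e` is even.
      intro h
      have h' : e = 1 := by exact_mod_cast h
      rw [h'] at he
      exact absurd he (by decide)
    exact analyticAt_const.mul (hb.mul hz)
  · exact analyticAt_const

end ModeSums

/-! ### Traces on the coefficient algebra -/

section CoeffAlgebra

variable {S T : Type*} [Ring S] [Algebra ℝ S] [AddCommGroup T] [Module ℝ T]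

lemma Coeff.induction {motive : Coeff S T → Prop} (zero : motive 0)
    (tmul : ∀ a φ, motive (Coeff.tmul a φ)) (add : ∀ A B, motive A → motive B → motive (A + B))
    (A : Coeff S T) : motive A :=
  TensorProduct.induction_on (R := ℝ) A zero tmul add

lemma Coeff.tmul_mul_tmul (a b : S) (φ ψ : Module.End ℝ T) :
    Coeff.tmul a φ * Coeff.tmul b ψ = Coeff.tmul (a * b) (φ * ψ) :=
  Algebra.TensorProduct.tmul_mul_tmul _ _ _ _

lemma Coeff.one_eq : (1 : Coeff S T) = Coeff.tmul 1 1 := rfl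

lemma coeffTrace_tmul (a : S) (φ : Module.End ℝ T) :
    coeffTrace S T (Coeff.tmul a φ) = LinearMap.trace ℝ T φ • a := rfl

lemma coeffTrace_eq_zero_of_finrank_eq_zero [FiniteDimensional ℝ T] (h : finrank ℝ T = 0)
    (A : Coeff S T) : coeffTrace S T A = 0 := by
  have : Subsingleton T := finrank_zero_iff.1 h
  induction A using Coeff.induction with
  | zero => simp
  | tmul a φ => rw [coeffTrace_tmul, Subsingleton.elim φ 0]; simp
  | add A B hA hB => rw [map_add, hA, hB, add_zero]

variable [Algebra ℂ S] [IsScalarTower ℝ ℂ S]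

lemma Coeff.smul_tmul (z : ℂ) (a : S) (φ : Module.End ℝ T) :
    z • Coeff.tmul a φ = Coeff.tmul (z • a) φ := rfl

lemma coeffTrace_one [FiniteDimensional ℝ T] :
    coeffTrace S T 1 = (finrank ℝ T : ℂ) • (1 : S) := by
  rw [Coeff.one_eq, coeffTrace_tmul, LinearMap.trace_one]
  rw [Algebra.smul_def, Algebra.smul_def, IsScalarTower.algebraMap_apply ℝ ℂ S,
    Complex.coe_algebraMap, Complex.ofReal_natCast]

lemma coeffTrace_smul (z : ℂ) (A : Coeff S T) :
    coeffTrace S T (z • A) = z • coeffTrace S T A := by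
  induction A using Coeff.induction with
  | zero => simp
  | tmul a φ => rw [Coeff.smul_tmul, coeffTrace_tmul, coeffTrace_tmul, smul_comm]
  | add A B hA hB => rw [smul_add, map_add, map_add, smul_add, hA, hB]

end CoeffAlgebra

/-! ### Uniqueness of zeta functions near zero and of zeta determinants -/

section ZetaUnique

variable {S T : Type*} [Ring S] [Algebra ℝ S] [Algebra ℂ S] [IsScalarTower ℝ ℂ S]
  [AddCommGroup T] [Module ℝ T]

/-- A meromorphic function on the plane that vanishes on a half plane vanishes near every point at
which it is analytic. -/
lemma eventuallyEq_zero_of_meromorphicOn {h : ℂ → ℂ} (hm : MeromorphicOn h Set.univ) {c : ℝ}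
    (h0 : ∀ s : ℂ, c < s.re → h s = 0) {x : ℂ} (hx : AnalyticAt ℂ h x) : h =ᶠ[nhds x] 0 := by
  -- The order is infinite at a point of the half plane, hence everywhere on the connected plane.
  -- Analyticity at `x` then also covers the value at `x` itself.
  have h1 : meromorphicOrderAt h ((c + 1 : ℝ) : ℂ) = ⊤ := by
    rw [meromorphicOrderAt_eq_top_iff]
    have h2 : {s : ℂ | c < s.re} ∈ nhds (((c + 1 : ℝ) : ℂ)) :=
      (isOpen_lt continuous_const Complex.continuous_re).mem_nhds (by simp)
    have h3 : ∀ᶠ s in nhds (((c + 1 : ℝ) : ℂ)), h s = 0 :=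
      Filter.mem_of_superset h2 fun s hs => h0 s hs
    exact h3.filter_mono nhdsWithin_le_nhds
  have h2 : meromorphicOrderAt h x = ⊤ := by
    by_contra hne
    exact hm.meromorphicOrderAt_ne_top_of_isPreconnected isPreconnected_univ (Set.mem_univ x)
      (Set.mem_univ _) hne h1
  rw [meromorphicOrderAt_eq_top_iff] at h2
  rcases hx.eventually_eq_zero_or_eventually_ne_zero with h3 | h3
  · exact h3
  · obtain ⟨z, hz, hz'⟩ := (h2.and h3).exists
    exact absurd hz hz'

lemma IsZetaFunction.eventuallyEq {ε : S →ₐ[ℂ] ℂ} {r : ℝ} {P : (Coeff S T)[X]} {F G : ℂ → S}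
    (hF : IsZetaFunction ε r P F) (hG : IsZetaFunction ε r P G) (l : S →ₗ[ℂ] ℂ) :
    (fun s => l (F s)) =ᶠ[nhds 0] fun s => l (G s) := by
  obtain ⟨a, ha⟩ := hF.hasSum
  obtain ⟨b, hb⟩ := hG.hasSum
  have h := eventuallyEq_zero_of_meromorphicOn ((hF.meromorphic l).sub (hG.meromorphic l))
    (c := max a b) (fun s hs => by
      have h1 := ha s (lt_of_le_of_lt (le_max_left _ _) hs) l
      have h2 := hb s (lt_of_le_of_lt (le_max_right _ _) hs) l
      simp [h1.unique h2]) ((hF.analyticAt_zero l).sub (hG.analyticAt_zero l))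
  filter_upwards [h] with s hs
  simpa [sub_eq_zero] using hs

/-- Two zeta functions have the same germ at `0` under every functional, and functionals separate
the points of `S`. Thus the choice made in `zetaDet` is harmless. -/
lemma IsZetaDet.unique {ε : S →ₐ[ℂ] ℂ} {r : ℝ} {P : (Coeff S T)[X]} {d d' : S}
    (h : IsZetaDet ε r P d) (h' : IsZetaDet ε r P d') : d = d' := by
  obtain ⟨F, z, hF, hz, rfl⟩ := h
  obtain ⟨G, w, hG, hw, rfl⟩ := h'
  have : z = w := by
    rw [← sub_eq_zero, ← Module.forall_dual_apply_eq_zero_iff ℂ]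
    intro l
    rw [map_sub, ← hz l, ← hw l, (hF.eventuallyEq hG l).deriv_eq, sub_self]
  rw [this]

lemma IsZetaDet.zetaDet_eq {ε : S →ₐ[ℂ] ℂ} {r : ℝ} {P : (Coeff S T)[X]} {d : S}
    (h : IsZetaDet ε r P d) : zetaDet ε r P = d := by
  have h' : ∃ d, IsZetaDet ε r P d := ⟨d, h⟩
  rw [zetaDet, dif_pos h']
  exact h'.choose_spec.unique h

end ZetaUnique

/-! ### The zeta determinant of an operator with blocks `λ^(2p) (1 + q(A/λ))` -/

section ZetaFormula

variable {S T : Type*} [Ring S] [Algebra ℝ S] [Algebra ℂ S] [IsScalarTower ℝ ℂ S]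
  [AddCommGroup T] [Module ℝ T]

lemma coeffTrace_nilEval (p : PowerSeries ℂ) {A : Coeff S T} {K : ℕ} (hA : A ^ K = 0) :
    coeffTrace S T (nilEval p A) =
      ∑ e ∈ Finset.range K, PowerSeries.coeff e p • coeffTrace S T (A ^ e) := by
  rw [nilEval_eq_sum p hA, map_sum]
  simp only [coeffTrace_smul]

variable [FiniteDimensional ℝ T] {ε : S →ₐ[ℂ] ℂ} {r : ℝ} {P : (Coeff S T)[X]} {p : ℕ}
  {A : Coeff S T} {q : PowerSeries ℂ}
  {K : ℕ}

/-- The body of the block is `λ^(2p)`, because traces of positive powers of `A` have no body.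
Dividing by it leaves `(1 + q(A/λ))^(-s)`, a finite sum of powers of `A`. -/
lemma zetaTerm_eq (hr : 0 < r) (hA : A ^ K = 0) (hε : ∀ e ≠ 0, ε (coeffTrace S T (A ^ e)) = 0)
    (hq : PowerSeries.constantCoeff q = 0) {m : ℤ} (hm : m ≠ 0)
    (hP : modeBlock r P m = freq r m ^ (2 * p) • (1 + nilEval q ((freq r m)⁻¹ • A))) (s : ℂ) :
    zetaTerm ε r P m s = ∑ e ∈ Finset.range K, (powCoeff q e s *
      ((freq r m ^ (2 * p)) ^ (-s) * (freq r m)⁻¹ ^ e)) • coeffTrace S T (A ^ e) := by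
  -- In rank zero the normalized trace is the meaningless quotient `0 / 0`, but every trace
  -- vanishes.
  by_cases hn : finrank ℝ T = 0
  · simp [zetaTerm, coeffTrace_eq_zero_of_finrank_eq_zero hn]
  have hf := freq_ne_zero hr hm
  have hA' : ((freq r m)⁻¹ • A) ^ K = 0 := by rw [smul_pow, hA, smul_zero]
  have hn' : (finrank ℝ T : ℂ) ≠ 0 := by exact_mod_cast hn
  have hb : ε (coeffTrace S T (modeBlock r P m)) / (finrank ℝ T : ℂ) = freq r m ^ (2 * p) := by
    have h1 : ε (coeffTrace S T (nilEval q ((freq r m)⁻¹ • A))) = 0 := by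
      rw [coeffTrace_nilEval q hA', map_sum]
      refine Finset.sum_eq_zero fun e _ => ?_
      rcases eq_or_ne e 0 with rfl | he
      · simp [hq]
      · rw [smul_pow, coeffTrace_smul, map_smul, map_smul, hε e he]; simp
    have h2 : ε (coeffTrace S T 1) = (finrank ℝ T : ℂ) := by
      rw [coeffTrace_one, map_smul, map_one, smul_eq_mul, mul_one]
    rw [hP, coeffTrace_smul, map_smul, map_add, map_add, h1, h2, add_zero, smul_eq_mul,
      mul_div_cancel_right₀ _ hn']
  rw [zetaTerm, hb, powAt, hP, smul_smul, inv_mul_cancel₀ (pow_ne_zero _ hf), one_smul,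
    add_sub_cancel_left, ← nilEval_subst _ hq ⟨K, hA'⟩, coeffTrace_smul, coeffTrace_nilEval _ hA',
    Finset.smul_sum]
  refine Finset.sum_congr rfl fun e _ => ?_
  rw [smul_pow, coeffTrace_smul, smul_smul, smul_smul, powCoeff]
  congr 1
  ring

/-- The `ζ`-function of an operator with mode blocks `λ ^ (2 p) (1 + q (A / λ))`. -/
lemma isZetaFunction_sum (hr : 0 < r) (hp : p ≠ 0) (hA : A ^ K = 0)
    (hε : ∀ e ≠ 0, ε (coeffTrace S T (A ^ e)) = 0)
    (hq : PowerSeries.constantCoeff q = 0)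
    (hP : ∀ m ≠ 0, modeBlock r P m =
      freq r m ^ (2 * p) • (1 + nilEval q ((freq r m)⁻¹ • A))) :
    IsZetaFunction ε r P fun s => ∑ e ∈ Finset.range K,
      (powCoeff q e s * circleZeta r p e s) • coeffTrace S T (A ^ e) where
  meromorphic l := by
    intro s _
    simp only [map_sum, map_smul, smul_eq_mul]
    refine MeromorphicAt.fun_sum fun e _ => ?_
    exact (((differentiable_powCoeff hq e).analyticAt s).meromorphicAt.mul
      (meromorphicAt_circleZeta hr hp e s)).mul (MeromorphicAt.const _ s)
  analyticAt_zero l := by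
    simp only [map_sum, map_smul, smul_eq_mul]
    refine Finset.analyticAt_fun_sum _ fun e _ => ?_
    exact (((differentiable_powCoeff hq e).analyticAt 0).mul
      (analyticAt_circleZeta_zero hr p e)).mul analyticAt_const
  hasSum := by
    refine ⟨1, fun s hs l => ?_⟩
    -- As `p ≥ 1`, the half plane `re s > 1` is more than enough for convergence of every mode sum.
    have hs' : 1 < (2 * p * s : ℂ).re := by
      have h1 : (2 * p * s : ℂ) = ((2 * p : ℝ) : ℂ) * s := by push_cast; ring
      rw [h1, Complex.re_ofReal_mul]
      have h2 : (1 : ℝ) ≤ p := by exact_mod_cast Nat.one_le_iff_ne_zero.2 hp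
      nlinarith
    simp only [map_sum, map_smul, smul_eq_mul]
    have h := hasSum_sum (s := Finset.range K) fun e (_ : e ∈ Finset.range K) =>
      ((hasSum_modes hr (p := p) e hs').mul_left (powCoeff q e s)).mul_right
        (l (coeffTrace S T (A ^ e)))
    refine h.congr_fun fun m => ?_
    rw [zetaTerm_eq hr hA hε hq m.2 (hP m m.2)]
    simp only [map_sum, map_smul, smul_eq_mul]

/-- The nilpotent part of `- ζ' (0)`. -/
def logDetSum (r : ℝ) (p : ℕ) (q : PowerSeries ℂ) (K : ℕ) (A : Coeff S T) : S :=
  ∑ e ∈ Finset.range K,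
    (PowerSeries.coeff e (logSeries.subst q) * circleZeta r p e 0) • coeffTrace S T (A ^ e)

/-- At `s = 0` the coefficient of `A^e` in `(1 + q A)^(-s)` is `0` for `e > 0`, so its derivative
alone contributes and produces the logarithm. For `e = 0` it is constantly `1` and the scalar mode
sum is differentiated. The condition `K ≠ 0` keeps that term in the sum. -/
lemma isZetaDet_sum (hr : 0 < r) (hp : p ≠ 0) (hA : A ^ K = 0)
    (hε : ∀ e ≠ 0, ε (coeffTrace S T (A ^ e)) = 0)
    (hq : PowerSeries.constantCoeff q = 0)
    (hP : ∀ m ≠ 0, modeBlock r P m =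
      freq r m ^ (2 * p) • (1 + nilEval q ((freq r m)⁻¹ • A))) (hK : K ≠ 0) :
    IsZetaDet ε r P (Complex.exp (-(finrank ℝ T * deriv (circleZeta r p 0) 0)) •
      nilEval (PowerSeries.exp ℂ) (logDetSum r p q K A)) := by
  have h0 : PowerSeries.coeff 0 (logSeries.subst q) = 0 := by
    rw [PowerSeries.coeff_zero_eq_constantCoeff_apply, constantCoeff_logSeries_subst hq]
  have hD : ∀ e, HasDerivAt (fun s => powCoeff q e s * circleZeta r p e s)
      ((if e = 0 then deriv (circleZeta r p 0) 0 else 0) -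
        PowerSeries.coeff e (logSeries.subst q) * circleZeta r p e 0) 0 := by
    intro e
    have h1 := (analyticAt_circleZeta_zero hr p e).differentiableAt.hasDerivAt
    rcases eq_or_ne e 0 with rfl | he
    · rw [if_pos rfl, h0, zero_mul, sub_zero]
      simpa only [powCoeff_zero_left hq, one_mul] using h1
    · refine ((hasDerivAt_powCoeff_zero hq he).mul h1).congr_deriv ?_
      rw [if_neg he, powCoeff_apply_zero hq he]
      ring
  have hsum : ∑ e ∈ Finset.range K, ((if e = 0 then deriv (circleZeta r p 0) 0 else 0) -
        PowerSeries.coeff e (logSeries.subst q) * circleZeta r p e 0) • coeffTrace S T (A ^ e) =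
      (finrank ℝ T * deriv (circleZeta r p 0) 0) • (1 : S) - logDetSum r p q K A := by
    simp only [sub_smul, Finset.sum_sub_distrib, logDetSum]
    congr 1
    rw [Finset.sum_eq_single 0]
    · rw [if_pos rfl, pow_zero, coeffTrace_one, smul_smul, mul_comm]
    · intro e _ he
      rw [if_neg he, zero_smul]
    · intro h
      exact absurd (Finset.mem_range.2 (Nat.pos_of_ne_zero hK)) h
  have hεz : ε (logDetSum r p q K A) = 0 := by
    rw [logDetSum, map_sum]
    refine Finset.sum_eq_zero fun e _ => ?_
    rcases eq_or_ne e 0 with rfl | he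
    · rw [h0, zero_mul, zero_smul, map_zero]
    · rw [map_smul, hε e he, smul_zero]
  refine ⟨_, ∑ e ∈ Finset.range K, ((if e = 0 then deriv (circleZeta r p 0) 0 else 0) -
    PowerSeries.coeff e (logSeries.subst q) * circleZeta r p e 0) • coeffTrace S T (A ^ e),
    isZetaFunction_sum hr hp hA hε hq hP, fun l => ?_, ?_⟩
  · simp only [map_sum, map_smul, smul_eq_mul]
    exact (HasDerivAt.fun_sum fun e _ => (hD e).mul_const _).deriv
  · rw [hsum, expAt]
    have h1 : ε (-((finrank ℝ T * deriv (circleZeta r p 0) 0) • (1 : S) - logDetSum r p q K A)) =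
        -(finrank ℝ T * deriv (circleZeta r p 0) 0) := by
      rw [map_neg, map_sub, hεz, map_smul, map_one, sub_zero, smul_eq_mul, mul_one]
    rw [h1, map_neg, Algebra.algebraMap_eq_smul_one]
    congr 2
    abel

end ZetaFormula


/-! ### Homogeneous forms -/

section HomogeneousForms

variable (T : Type*) [NormedAddCommGroup T] [InnerProductSpace ℝ T]

/-- The inclusion of the real forms, as an algebra homomorphism. -/
def realFormHom : ExteriorAlgebra ℝ (Module.Dual ℝ T) →ₐ[ℝ] Forms T :=
  (Algebra.TensorProduct.includeRight :
    ExteriorAlgebra ℝ (Module.Dual ℝ T) →ₐ[ℝ] ℂ ⊗[ℝ] ExteriorAlgebra ℝ (Module.Dual ℝ T))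

variable {T}

lemma Forms.induction {motive : Forms T → Prop} (zero : motive 0)
    (smul : ∀ (z : ℂ) w, motive (z • realForm w))
    (add : ∀ a b, motive a → motive b → motive (a + b)) (a : Forms T) : motive a := by
  refine TensorProduct.induction_on (R := ℝ) a zero (fun z w => ?_) add
  have h : (z ⊗ₜ[ℝ] w : ℂ ⊗[ℝ] ExteriorAlgebra ℝ (Module.Dual ℝ T)) =
      z • ((1 : ℂ) ⊗ₜ[ℝ] w) := by
    rw [TensorProduct.smul_tmul', smul_eq_mul, mul_one]
  rw [h]
  exact smul z w

/-- The real forms of degree `k`. -/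
def degreeForms (T : Type*) [NormedAddCommGroup T] [InnerProductSpace ℝ T] (k : ℕ) :
    Submodule ℝ (ExteriorAlgebra ℝ (Module.Dual ℝ T)) :=
  LinearMap.range (ExteriorAlgebra.ι ℝ (M := Module.Dual ℝ T)) ^ k

lemma mul_mem_degreeForms {j k : ℕ} {v w : ExteriorAlgebra ℝ (Module.Dual ℝ T)}
    (hv : v ∈ degreeForms T j) (hw : w ∈ degreeForms T k) : v * w ∈ degreeForms T (j + k) := by
  rw [degreeForms, pow_add]
  exact Submodule.mul_mem_mul hv hw

lemma ι_mem_degreeForms (v : Module.Dual ℝ T) : ExteriorAlgebra.ι ℝ v ∈ degreeForms T 1 := by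
  rw [degreeForms, pow_one]
  exact ⟨v, rfl⟩

lemma one_mem_degreeForms : 1 ∈ degreeForms T 0 := by
  rw [degreeForms, pow_zero]
  exact Submodule.one_le.1 le_rfl

lemma degreeForms_eq_bot [FiniteDimensional ℝ T] {k : ℕ} (hk : finrank ℝ T < k) :
    degreeForms T k = ⊥ := by
  have h := exteriorPower.finrank_eq (R := ℝ) (M := Module.Dual ℝ T) k
  rw [Subspace.dual_finrank_eq, Nat.choose_eq_zero_of_lt hk] at h
  have : Module.Finite ℝ (degreeForms T k) :=
    inferInstanceAs (Module.Finite ℝ (⋀[ℝ]^k (Module.Dual ℝ T)))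
  exact Submodule.finrank_eq_zero.1 h

/-- Algebra homomorphisms that agree up to a factor on the generators. -/
lemma map_eq_pow_smul_of_mem_degreeForms {B : Type*} [Ring B] [Algebra ℝ B] [Algebra ℂ B]
    [IsScalarTower ℝ ℂ B] (f h : ExteriorAlgebra ℝ (Module.Dual ℝ T) →ₐ[ℝ] B) (z : ℂ)
    (hf : ∀ v, f (ExteriorAlgebra.ι ℝ v) = z • h (ExteriorAlgebra.ι ℝ v)) {k : ℕ}
    {w : ExteriorAlgebra ℝ (Module.Dual ℝ T)} (hw : w ∈ degreeForms T k) :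
    f w = z ^ k • h w := by
  refine Submodule.pow_induction_on_left' _ (C := fun k w _ => f w = z ^ k • h w) ?_ ?_ ?_ hw
  · intro r
    rw [f.commutes, h.commutes, pow_zero, one_smul]
  · intro x y i _ _ hx hy
    rw [map_add, map_add, hx, hy, smul_add]
  · rintro _ ⟨v, rfl⟩ i x _ hx
    rw [map_mul, map_mul, hf, hx, smul_mul_smul_comm, Nat.succ_eq_add_one, pow_succ']

/-- The homomorphism `twistReal` with values in `Forms T`. -/
def twistHom (c : ℂ) : ExteriorAlgebra ℝ (Module.Dual ℝ T) →ₐ[ℝ] Forms T := twistReal c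

lemma twistHom_ι (c : ℂ) (v : Module.Dual ℝ T) :
    twistHom c (ExteriorAlgebra.ι ℝ v) = c • realForm (ExteriorAlgebra.ι ℝ v) := by
  have h1 : twistReal c (ExteriorAlgebra.ι ℝ v) = c ⊗ₜ[ℝ] ExteriorAlgebra.ι ℝ v := by
    rw [twistReal, ExteriorAlgebra.lift_ι_apply]
    rfl
  have h : c • ((1 : ℂ) ⊗ₜ[ℝ] ExteriorAlgebra.ι ℝ v) = (c ⊗ₜ[ℝ] ExteriorAlgebra.ι ℝ v :
      ℂ ⊗[ℝ] ExteriorAlgebra ℝ (Module.Dual ℝ T)) := by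
    rw [TensorProduct.smul_tmul', smul_eq_mul, mul_one]
  exact h1.trans h.symm

lemma formConj_tmul (c z : ℂ) (w : ExteriorAlgebra ℝ (Module.Dual ℝ T)) :
    formConj (T := T) c (z ⊗ₜ[ℝ] w : ℂ ⊗[ℝ] ExteriorAlgebra ℝ (Module.Dual ℝ T)) =
      algebraMap ℂ (Forms T) ((starRingEnd ℂ) z) * twistHom c w := by
  have h := Algebra.TensorProduct.lift_tmul
    ((Algebra.TensorProduct.includeLeft (R := ℝ) (S := ℝ) (A := ℂ)
      (B := ExteriorAlgebra ℝ (Module.Dual ℝ T))).comp Complex.conjAe.toAlgHom)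
    (twistReal c) (fun z w => by
      change Commute (algebraMap ℂ (ℂ ⊗[ℝ] ExteriorAlgebra ℝ (Module.Dual ℝ T)) _) _
      exact Algebra.commutes _ _) z w
  exact h

lemma formConj_smul (c z : ℂ) (a : Forms T) :
    formConj c (z • a) = (starRingEnd ℂ) z • formConj c a := by
  have h : z • a = algebraMap ℂ (Forms T) z * a := Algebra.smul_def z a
  have h2 : formConj c (algebraMap ℂ (Forms T) z) = algebraMap ℂ (Forms T) ((starRingEnd ℂ) z) := by
    refine (formConj_tmul c z 1).trans ?_
    rw [map_one, mul_one]
  rw [h, map_mul, h2, ← Algebra.smul_def]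

lemma formConj_realForm (c : ℂ) {k : ℕ} {w : ExteriorAlgebra ℝ (Module.Dual ℝ T)}
    (hw : w ∈ degreeForms T k) : formConj c (realForm w) = c ^ k • realForm w := by
  refine map_eq_pow_smul_of_mem_degreeForms (B := Forms T)
    ((formConj c).comp (realFormHom T)) (realFormHom T) c (fun v => ?_) hw
  refine (formConj_tmul c 1 _).trans ?_
  rw [map_one, map_one, one_mul]
  exact twistHom_ι c v

lemma mapForms_realForm {T' : Type*} [NormedAddCommGroup T'] [InnerProductSpace ℝ T']
    (φ : Module.Dual ℝ T →ₗ[ℝ] Module.Dual ℝ T') (w : ExteriorAlgebra ℝ (Module.Dual ℝ T)) :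
    mapForms φ (realForm w) = realForm (ExteriorAlgebra.map φ w) := by
  change (Algebra.TensorProduct.map (AlgHom.id ℂ ℂ) (ExteriorAlgebra.map φ)) ((1 : ℂ) ⊗ₜ[ℝ] w) = _
  rw [Algebra.TensorProduct.map_tmul]
  rfl

lemma scaleForms_realForm (c : ℝ) {k : ℕ} {w : ExteriorAlgebra ℝ (Module.Dual ℝ T)}
    (hw : w ∈ degreeForms T k) : scaleForms c (realForm w) = (c : ℂ) ^ k • realForm w := by
  refine map_eq_pow_smul_of_mem_degreeForms (B := Forms T)
    (((scaleForms c).restrictScalars ℝ).comp (realFormHom T)) (realFormHom T) c (fun v => ?_) hw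
  change mapForms _ (realForm _) = _
  rw [mapForms_realForm, ExteriorAlgebra.map_apply_ι]
  change realFormHom T (ExteriorAlgebra.ι ℝ (c • v)) = _
  rw [map_smul, map_smul, Algebra.smul_def, Algebra.smul_def,
    IsScalarTower.algebraMap_apply ℝ ℂ (Forms T)]
  rfl

lemma body_realForm {k : ℕ} (hk : k ≠ 0) {w : ExteriorAlgebra ℝ (Module.Dual ℝ T)}
    (hw : w ∈ degreeForms T k) : body T (realForm w) = 0 := by
  have h := map_eq_pow_smul_of_mem_degreeForms (B := ℂ)
    (((body T).restrictScalars ℝ).comp (realFormHom T))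
    (((body T).restrictScalars ℝ).comp (realFormHom T)) 0 (fun v => ?_) hw
  · rw [zero_pow hk, zero_smul] at h
    exact h
  · rw [zero_smul]
    refine (Algebra.TensorProduct.lift_tmul (AlgHom.id ℂ ℂ)
      ((Algebra.ofId ℝ ℂ).comp (ExteriorAlgebra.algebraMapInv (R := ℝ) (M := Module.Dual ℝ T)))
      (fun _ _ => Commute.all _ _) 1 (ExteriorAlgebra.ι ℝ v)).trans ?_
    simp [ExteriorAlgebra.algebraMapInv]

/-- Moving a generator past a product of two generators changes the sign twice, so degree two is
central, and so are products of degree two forms. -/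
lemma commute_of_mem_degreeForms {k : ℕ} {w : ExteriorAlgebra ℝ (Module.Dual ℝ T)}
    (hw : w ∈ degreeForms T (2 * k)) (v : ExteriorAlgebra ℝ (Module.Dual ℝ T)) :
    Commute w v := by
  let Z := Subalgebra.center ℝ (ExteriorAlgebra ℝ (Module.Dual ℝ T))
  have h2 : degreeForms T 2 ≤ Subalgebra.toSubmodule Z := by
    rw [degreeForms, pow_two, Submodule.mul_le]
    rintro _ ⟨a, rfl⟩ _ ⟨b, rfl⟩
    change _ ∈ Z
    rw [Subalgebra.mem_center_iff]
    intro x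
    induction x using ExteriorAlgebra.induction with
    | algebraMap r => exact Algebra.commutes r _
    | ι c =>
      have h1 := eq_neg_of_add_eq_zero_left (ExteriorAlgebra.ι_add_mul_swap (R := ℝ) c a)
      have h2 := eq_neg_of_add_eq_zero_left (ExteriorAlgebra.ι_add_mul_swap (R := ℝ) c b)
      rw [← mul_assoc, h1, neg_mul, mul_assoc, h2, mul_neg, neg_neg, mul_assoc]
    | mul x y hx hy => rw [mul_assoc, hy, ← mul_assoc, hx, mul_assoc]
    | add x y hx hy => rw [add_mul, mul_add, hx, hy]
  have h3 : degreeForms T 2 ^ k ≤ Subalgebra.toSubmodule Z := by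
    clear hw
    induction k with
    | zero => rw [pow_zero, Submodule.one_le]; exact Z.one_mem
    | succ k ih =>
      rw [pow_succ, Submodule.mul_le]
      intro x hx y hy
      exact Z.mul_mem (ih hx) (h2 hy)
  rw [degreeForms, pow_mul] at hw
  have h4 : w ∈ Z := h3 hw
  exact (Subalgebra.mem_center_iff.1 h4 v).symm

lemma realForm_commute {k : ℕ} {w : ExteriorAlgebra ℝ (Module.Dual ℝ T)}
    (hw : w ∈ degreeForms T (2 * k)) (a : Forms T) : Commute (realForm w) a := by
  induction a using Forms.induction with
  | zero => exact Commute.zero_right _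
  | smul z v =>
    refine Commute.smul_right ?_ z
    exact (commute_of_mem_degreeForms hw v).map (realFormHom T)
  | add a b ha hb => exact ha.add_right hb

/-- The span of the real forms of degree at least `k`. -/
def formFiltration (T : Type*) [NormedAddCommGroup T] [InnerProductSpace ℝ T] (k : ℕ) :
    Submodule ℂ (Forms T) :=
  Submodule.span ℂ {a | ∃ j ≥ k, ∃ w ∈ degreeForms T j, a = realForm w}

lemma realForm_mem_formFiltration {j k : ℕ} (h : k ≤ j)
    {w : ExteriorAlgebra ℝ (Module.Dual ℝ T)} (hw : w ∈ degreeForms T j) :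
    realForm w ∈ formFiltration T k :=
  Submodule.subset_span ⟨j, h, w, hw, rfl⟩

lemma mul_mem_formFiltration {j k : ℕ} {a b : Forms T} (ha : a ∈ formFiltration T j)
    (hb : b ∈ formFiltration T k) : a * b ∈ formFiltration T (j + k) := by
  rw [formFiltration] at ha hb
  induction ha, hb using Submodule.span_induction₂ with
  | mem_mem a b ha hb =>
    obtain ⟨j', hj, v, hv, rfl⟩ := ha
    obtain ⟨k', hk, w, hw, rfl⟩ := hb
    have : realForm v * realForm w = realForm (v * w) := (map_mul (realFormHom T) v w).symm
    rw [this]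
    exact realForm_mem_formFiltration (add_le_add hj hk) (mul_mem_degreeForms hv hw)
  | zero_left b _ => rw [zero_mul]; exact Submodule.zero_mem _
  | zero_right a _ => rw [mul_zero]; exact Submodule.zero_mem _
  | add_left a b c _ _ _ h1 h2 => rw [add_mul]; exact Submodule.add_mem _ h1 h2
  | add_right a b c _ _ _ h1 h2 => rw [mul_add]; exact Submodule.add_mem _ h1 h2
  | smul_left z a b _ _ h => rw [smul_mul_assoc]; exact Submodule.smul_mem _ _ h
  | smul_right z a b _ _ h => rw [mul_smul_comm]; exact Submodule.smul_mem _ _ h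

lemma pow_mem_formFiltration {a : Forms T} (ha : a ∈ formFiltration T 1) (k : ℕ) :
    a ^ k ∈ formFiltration T k := by
  induction k with
  | zero =>
    rw [pow_zero]
    have : (1 : Forms T) = realForm 1 := rfl
    rw [this]
    exact realForm_mem_formFiltration le_rfl one_mem_degreeForms
  | succ k ih => rw [pow_succ]; exact mul_mem_formFiltration ih ha

lemma pow_eq_zero_of_mem_formFiltration [FiniteDimensional ℝ T] {a : Forms T}
    (ha : a ∈ formFiltration T 1) : a ^ (finrank ℝ T + 1) = 0 := by
  have h := pow_mem_formFiltration ha (finrank ℝ T + 1)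
  have h0 : formFiltration T (finrank ℝ T + 1) = ⊥ := by
    rw [formFiltration, Submodule.span_eq_bot]
    rintro _ ⟨j, hj, w, hw, rfl⟩
    rw [degreeForms_eq_bot (by omega)] at hw
    rw [(Submodule.mem_bot ℝ).1 hw]
    exact map_zero (realFormHom T)
  rwa [h0, Submodule.mem_bot] at h

end HomogeneousForms

/-! ### Endomorphism-valued forms, their degrees, traces and adjoints -/

section HomogeneousCoeff

variable {T : Type*} [NormedAddCommGroup T] [InnerProductSpace ℝ T]

/-- The endomorphism valued real forms of degree `k`. -/
def degreeCoeff (T : Type*) [NormedAddCommGroup T] [InnerProductSpace ℝ T] (k : ℕ) :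
    Submodule ℝ (Coeff (Forms T) T) :=
  Submodule.span ℝ {A | ∃ w ∈ degreeForms T k, ∃ φ, A = Coeff.tmul (realForm w) φ}

lemma mul_mem_degreeCoeff {j k : ℕ} {A B : Coeff (Forms T) T} (hA : A ∈ degreeCoeff T j)
    (hB : B ∈ degreeCoeff T k) : A * B ∈ degreeCoeff T (j + k) := by
  rw [degreeCoeff] at hA hB
  induction hA, hB using Submodule.span_induction₂ with
  | mem_mem a b ha hb =>
    obtain ⟨v, hv, φ, rfl⟩ := ha
    obtain ⟨w, hw, ψ, rfl⟩ := hb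
    rw [Coeff.tmul_mul_tmul]
    have : realForm v * realForm w = realForm (v * w) := (map_mul (realFormHom T) v w).symm
    rw [this]
    exact Submodule.subset_span ⟨_, mul_mem_degreeForms hv hw, _, rfl⟩
  | zero_left b _ => rw [zero_mul]; exact Submodule.zero_mem _
  | zero_right a _ => rw [mul_zero]; exact Submodule.zero_mem _
  | add_left a b c _ _ _ h1 h2 => rw [add_mul]; exact Submodule.add_mem _ h1 h2
  | add_right a b c _ _ _ h1 h2 => rw [mul_add]; exact Submodule.add_mem _ h1 h2
  | smul_left z a b _ _ h => rw [smul_mul_assoc]; exact Submodule.smul_mem _ _ h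
  | smul_right z a b _ _ h => rw [mul_smul_comm]; exact Submodule.smul_mem _ _ h

lemma pow_mem_degreeCoeff {j : ℕ} {A : Coeff (Forms T) T} (hA : A ∈ degreeCoeff T j) (k : ℕ) :
    A ^ k ∈ degreeCoeff T (j * k) := by
  induction k with
  | zero =>
    rw [pow_zero, mul_zero]
    exact Submodule.subset_span ⟨1, one_mem_degreeForms, 1, rfl⟩
  | succ k ih => rw [pow_succ]; exact mul_mem_degreeCoeff ih hA

lemma exists_coeffTrace_eq {k : ℕ} {A : Coeff (Forms T) T} (hA : A ∈ degreeCoeff T k) :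
    ∃ w ∈ degreeForms T k, coeffTrace (Forms T) T A = realForm w := by
  rw [degreeCoeff] at hA
  induction hA using Submodule.span_induction with
  | mem A hA =>
    obtain ⟨w, hw, φ, rfl⟩ := hA
    refine ⟨LinearMap.trace ℝ T φ • w, Submodule.smul_mem _ _ hw, ?_⟩
    rw [coeffTrace_tmul]
    exact (map_smul (realFormHom T) _ w).symm
  | zero => exact ⟨0, Submodule.zero_mem _, by rw [map_zero]; exact (map_zero (realFormHom T)).symm⟩
  | add A B _ _ hA hB =>
    obtain ⟨v, hv, h1⟩ := hA
    obtain ⟨w, hw, h2⟩ := hB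
    refine ⟨v + w, Submodule.add_mem _ hv hw, ?_⟩
    rw [map_add, h1, h2]
    exact (map_add (realFormHom T) v w).symm
  | smul r A _ hA =>
    obtain ⟨w, hw, h⟩ := hA
    refine ⟨r • w, Submodule.smul_mem _ _ hw, ?_⟩
    rw [map_smul, h]
    exact (map_smul (realFormHom T) r w).symm

lemma degreeCoeff_eq_bot [FiniteDimensional ℝ T] {k : ℕ} (hk : finrank ℝ T < k) :
    degreeCoeff T k = ⊥ := by
  rw [degreeCoeff, Submodule.span_eq_bot]
  rintro _ ⟨w, hw, φ, rfl⟩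
  rw [degreeForms_eq_bot hk] at hw
  rw [(Submodule.mem_bot ℝ).1 hw]
  have h : realForm (0 : ExteriorAlgebra ℝ (Module.Dual ℝ T)) = 0 := map_zero (realFormHom T)
  rw [h]
  exact TensorProduct.zero_tmul _ _

/-- The exponent is larger than necessary, but it depends only on the dimension. It serves as a
common truncation over all points of the manifold. -/
lemma pow_eq_zero_of_mem_degreeCoeff [FiniteDimensional ℝ T] {A : Coeff (Forms T) T}
    (hA : A ∈ degreeCoeff T 2) : A ^ (finrank ℝ T + 1) = 0 := by
  have h := pow_mem_degreeCoeff hA (finrank ℝ T + 1)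
  rwa [degreeCoeff_eq_bot (by omega), Submodule.mem_bot] at h

lemma curvatureForm_mem_degreeCoeff [FiniteDimensional ℝ T] (R : T → T → T → T) :
    curvatureForm R ∈ degreeCoeff T 2 := by
  refine Submodule.sum_mem _ fun i _ => Submodule.sum_mem _ fun j _ => ?_
  refine Submodule.subset_span ⟨_, Submodule.smul_mem _ _ ?_, _, rfl⟩
  exact mul_mem_degreeForms (ι_mem_degreeForms _) (ι_mem_degreeForms _)

lemma coeffAdjoint_tmul [FiniteDimensional ℝ T] (conj : Forms T →ₐ[ℝ] Forms T) (a : Forms T)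
    (φ : Module.End ℝ T) :
    coeffAdjoint conj (Coeff.tmul a φ) = Coeff.tmul (conj a) (LinearMap.adjoint φ) := rfl

lemma coeffAdjoint_smul [FiniteDimensional ℝ T] (c z : ℂ) (A : Coeff (Forms T) T) :
    coeffAdjoint (formConj c) (z • A) = (starRingEnd ℂ) z • coeffAdjoint (formConj c) A := by
  induction A using Coeff.induction with
  | zero => simp
  | tmul a φ =>
    rw [Coeff.smul_tmul, coeffAdjoint_tmul, formConj_smul, coeffAdjoint_tmul, Coeff.smul_tmul]
  | add A B hA hB => rw [smul_add, map_add, map_add, smul_add, hA, hB]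

lemma coeffAdjoint_one [FiniteDimensional ℝ T] (conj : Forms T →ₐ[ℝ] Forms T) :
    coeffAdjoint conj (1 : Coeff (Forms T) T) = 1 := by
  rw [Coeff.one_eq, coeffAdjoint_tmul, map_one]
  congr 1
  exact LinearMap.adjoint_one

/-- The adjoint of the curvature form of a metric curvature tensor. -/
lemma coeffAdjoint_curvatureForm [FiniteDimensional ℝ T] (c : ℂ) (R : T → T → T →ₗ[ℝ] T)
    (hR : ∀ u v, LinearMap.adjoint (R u v) = -R u v) :
    coeffAdjoint (formConj c) (curvatureForm fun u v w => R u v w) =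
      -(c ^ 2) • curvatureForm fun u v w => R u v w := by
  -- For a tensor that is linear in its last slot, the endomorphism rebuilt from basis values is the
  -- original one.
  have hc : ∀ u v, ((finBasis ℝ T).constr ℝ fun k => R u v (finBasis ℝ T k)) = R u v := fun u v =>
    (finBasis ℝ T).ext fun k => by rw [Basis.constr_basis]
  simp only [curvatureForm, map_sum, Finset.smul_sum]
  refine Finset.sum_congr rfl fun i _ => Finset.sum_congr rfl fun j _ => ?_
  rw [hc, coeffAdjoint_tmul, formConj_realForm c (k := 2) (Submodule.smul_mem _ _
    (mul_mem_degreeForms (ι_mem_degreeForms _) (ι_mem_degreeForms _))), hR, neg_smul,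
    Coeff.smul_tmul]
  exact TensorProduct.tmul_neg _ _

end HomogeneousCoeff


/-! ### Mode blocks of products with adjoints -/

section Blocks

variable {S T : Type*} [Ring S] [Algebra ℝ S]

lemma coeff_opAdjoint [NormedAddCommGroup T] [InnerProductSpace ℝ T] [FiniteDimensional ℝ T]
    (conj : S →ₐ[ℝ] S) (P : (Coeff S T)[X]) (j : ℕ) :
    (opAdjoint conj P).coeff j = (-1) ^ j * coeffAdjoint conj (P.coeff j) := by
  rw [opAdjoint, Polynomial.finsetSum_coeff]
  simp only [Polynomial.coeff_monomial]
  rw [Finset.sum_ite_eq']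
  split_ifs with h
  · rfl
  · rw [Polynomial.notMem_support_iff.1 h, map_zero, mul_zero]

variable [Algebra ℂ S] [IsScalarTower ℝ ℂ S] [AddCommGroup T] [Module ℝ T]

lemma commute_smul_one (A : Coeff S T) (z : ℂ) : Commute A (z • (1 : Coeff S T)) :=
  (Commute.one_right A).smul_right z

/-- The coefficients do not commute, but evaluation takes place at a scalar, which is central. -/
lemma modeBlock_mul (r : ℝ) (P Q : (Coeff S T)[X]) (m : ℤ) :
    modeBlock r (P * Q) m = modeBlock r P m * modeBlock r Q m :=
  Polynomial.eval₂_mul_noncomm _ _ fun _ => commute_smul_one _ _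

lemma modeBlock_X (r : ℝ) (m : ℤ) :
    modeBlock r (Polynomial.X : (Coeff S T)[X]) m = (Complex.I * freq r m) • 1 := by
  rw [modeBlock, Polynomial.eval_X]
  congr 1
  simp only [freq]
  push_cast
  ring

lemma modeBlock_C (r : ℝ) (A : Coeff S T) (m : ℤ) :
    modeBlock r (Polynomial.C A) m = A := by
  rw [modeBlock, Polynomial.eval_C]

lemma modeBlock_add (r : ℝ) (P Q : (Coeff S T)[X]) (m : ℤ) :
    modeBlock r (P + Q) m = modeBlock r P m + modeBlock r Q m :=
  Polynomial.eval_add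

lemma modeBlock_neg (r : ℝ) (P : (Coeff S T)[X]) (m : ℤ) :
    modeBlock r (-P) m = -modeBlock r P m :=
  Polynomial.eval_neg _ _

lemma modeBlock_X_sq (r : ℝ) (m : ℤ) :
    modeBlock r (Polynomial.X ^ 2 : (Coeff S T)[X]) m = -(freq r m ^ 2 • 1) := by
  rw [pow_two, modeBlock_mul, modeBlock_X, smul_mul_smul_comm, one_mul, ← neg_smul]
  congr 1
  linear_combination (freq r m ^ 2) * Complex.I_mul_I

end Blocks

/-! ### Mode blocks of the bosonic operator, the metric factor and the Â-function -/

section Operators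

variable {T : Type*} [NormedAddCommGroup T] [InnerProductSpace ℝ T]

lemma opAdjoint_X_sq [FiniteDimensional ℝ T] (c : ℂ) :
    opAdjoint (formConj c) (Polynomial.X ^ 2 : (Coeff (Forms T) T)[X]) = Polynomial.X ^ 2 := by
  ext j : 1
  rw [coeff_opAdjoint, Polynomial.coeff_X_pow]
  split_ifs with h
  · rw [coeffAdjoint_one, h]; simp
  · rw [map_zero, mul_zero]

/-- In the first order term the sign from integration by parts cancels the one from conjugating `i`.
What remains is the adjoint `c²F` of `-F`. -/
lemma opAdjoint_bosonicOp [FiniteDimensional ℝ T] {c : ℂ} {F : Coeff (Forms T) T}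
    (hF : coeffAdjoint (formConj c) F = -(c ^ 2) • F) :
    opAdjoint (formConj c) (bosonicOp F) =
      -Polynomial.X ^ 2 + Polynomial.C ((Complex.I * c ^ 2) • F) * Polynomial.X := by
  ext j : 1
  rw [coeff_opAdjoint, bosonicOp]
  simp only [Polynomial.coeff_add, Polynomial.coeff_neg, Polynomial.coeff_X_pow,
    Polynomial.coeff_C_mul, Polynomial.coeff_X, map_add, map_neg]
  rcases j with _ | _ | _ | j
  · simp
  · simp [coeffAdjoint_smul, hF, mul_smul]
  · simp [coeffAdjoint_one]
  · simp

/-- The quadratic polynomial that describes the mode blocks of `Δ Δ^*`. -/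
def blockSeries (c : ℂ) : PowerSeries ℂ :=
  ((Polynomial.C (1 - c ^ 2) * Polynomial.X - Polynomial.C (c ^ 2) * Polynomial.X ^ 2 : ℂ[X]) :
    PowerSeries ℂ)

lemma constantCoeff_blockSeries (c : ℂ) : PowerSeries.constantCoeff (blockSeries c) = 0 := by
  simp [blockSeries]

lemma coeff_log_blockSeries {c : ℂ} (hc : c = 1 ∨ c = -Complex.I) {d : ℕ} (hd : d ≠ 0) :
    PowerSeries.coeff (2 * d) (logSeries.subst (blockSeries c)) = -(1 / (d : ℂ)) := by
  rcases hc with rfl | rfl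
  · rw [← coeff_logSeries_subst_neg_sq hd]
    congr 2
    simp [blockSeries]
  · rw [← coeff_logSeries_subst_two_mul_add_sq hd]
    congr 2
    simp [blockSeries, ← C_two]
    norm_num
    exact (map_ofNat PowerSeries.C 2).symm

/-- The two factors act on the mode by `λ² + λF` and `λ² - c²λF`. -/
lemma modeBlock_bosonicOp [FiniteDimensional ℝ T] {c : ℂ} {r : ℝ} {F : Coeff (Forms T) T}
    (hF : coeffAdjoint (formConj c) F = -(c ^ 2) • F) (hN : IsNilpotent F) (hr : 0 < r) {m : ℤ}
    (hm : m ≠ 0) :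
    modeBlock r (bosonicOp F * opAdjoint (formConj c) (bosonicOp F)) m =
      freq r m ^ (2 * 2) • (1 + nilEval (blockSeries c) ((freq r m)⁻¹ • F)) := by
  have hf := freq_ne_zero hr hm
  rw [opAdjoint_bosonicOp hF, modeBlock_mul, bosonicOp, modeBlock_add, modeBlock_add, modeBlock_neg,
    modeBlock_mul, modeBlock_mul, modeBlock_C, modeBlock_C, modeBlock_X, modeBlock_X_sq,
    blockSeries, nilEval_coe (hN.smul _)]
  generalize freq r m = x at hf
  simp only [map_sub, map_mul, Polynomial.aeval_C, Polynomial.aeval_X, map_pow, neg_neg,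
    Algebra.algebraMap_eq_smul_one, mul_smul_comm, mul_one, smul_neg, mul_add, add_mul,
    smul_mul_assoc, one_mul, one_pow, ← pow_two F, neg_mul, smul_smul, smul_add, smul_sub, smul_pow, sub_mul,
    one_smul]
  have hxy := mul_inv_cancel₀ hf
  match_scalars
  · ring
  · linear_combination (x ^ 3 * (-1 + c ^ 2)) * Complex.I_sq - x ^ 3 * (1 - c ^ 2) * hxy
  · linear_combination (x ^ 2 * c ^ 2 * (1 - Complex.I ^ 2)) * Complex.I_sq +
      x ^ 2 * c ^ 2 * (x * x⁻¹ + 1) * hxy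

/-- The coefficients of the power series `∑ ζ (2 d) (x / 2 π) ^ (2 d) / d`. -/
def tauCoeff (e : ℕ) : ℝ :=
  if Even e ∧ e ≠ 0 then (riemannZeta e).re * (2 / e) * (1 / (2 * Real.pi)) ^ e else 0

/-- The form `∑ ζ (2 d) (r / 2 π) ^ (2 d) / d tr (F ^ (2 d))`, the logarithm of the metric
factor. -/
def tauForm (r : ℝ) (F : Coeff (Forms T) T) : Forms T :=
  ∑ e ∈ Finset.range (finrank ℝ T + 1),
    ((tauCoeff e * r ^ e : ℝ) : ℂ) • coeffTrace (Forms T) T (F ^ e)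

lemma tauCoeff_two_mul {d : ℕ} (hd : d ≠ 0) :
    ((tauCoeff (2 * d) : ℝ) : ℂ) =
      riemannZeta (2 * d) * (1 / d) * (1 / (2 * (Real.pi : ℂ))) ^ (2 * d) := by
  -- Euler's formula shows that this zeta value is real, so taking the real part in `tauCoeff` loses
  -- nothing. Real coefficients are what conjugation invariance requires.
  have hz : riemannZeta (2 * d) = (((riemannZeta (2 * d)).re : ℝ) : ℂ) := by
    have h : riemannZeta (2 * d) = (((-1) ^ (d + 1) * 2 ^ (2 * d - 1) * Real.pi ^ (2 * d) *
        (bernoulli (2 * d) : ℝ) / (2 * d).factorial : ℝ) : ℂ) := by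
      rw [riemannZeta_two_mul_nat hd]
      push_cast
      ring
    rw [h, Complex.ofReal_re]
  have hd' : (d : ℂ) ≠ 0 := by exact_mod_cast hd
  rw [tauCoeff, if_pos ⟨even_two_mul d, by omega⟩]
  push_cast
  rw [← hz]
  field_simp

/-- In even degree the logarithm contributes `-1/d` and the mode sum `2 (r/2π)^(2d) ζ(2d)`; in odd
degree the mode sum is zero. The factor `-2` is undone by the inverse square root of the
determinant. -/
lemma neg_two_smul_tauForm {c : ℂ} (hc : c = 1 ∨ c = -Complex.I) {r : ℝ} (hr : 0 < r)
    (F : Coeff (Forms T) T) :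
    logDetSum r 2 (blockSeries c) (finrank ℝ T + 1) F = (-2 : ℂ) • tauForm r F := by
  rw [logDetSum, tauForm, Finset.smul_sum]
  refine Finset.sum_congr rfl fun e _ => ?_
  rw [smul_smul]
  congr 1
  by_cases he : Even e
  · obtain ⟨d, rfl⟩ := even_iff_two_dvd.1 he
    rcases eq_or_ne d 0 with rfl | hd
    · rw [mul_zero, PowerSeries.coeff_zero_eq_constantCoeff_apply,
        constantCoeff_logSeries_subst (constantCoeff_blockSeries c)]
      simp [tauCoeff]
    · have hr' : (r : ℂ) ≠ 0 := by exact_mod_cast hr.ne'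
      have hpi : (Real.pi : ℂ) ≠ 0 := by exact_mod_cast Real.pi_ne_zero
      have h1 : (((2 * Real.pi / r : ℝ) : ℂ)) ^ (-(2 * (2 : ℕ) * 0 + (2 * d : ℕ)) : ℂ) =
          (r / (2 * Real.pi)) ^ (2 * d) := by
        rw [mul_zero, zero_add, Complex.cpow_neg, Complex.cpow_natCast, ← inv_pow]
        push_cast
        rw [inv_div]
      rw [coeff_log_blockSeries hc hd, circleZeta, if_pos he, h1, Complex.ofReal_mul,
        tauCoeff_two_mul hd]
      push_cast
      rw [mul_zero, zero_add, div_pow, one_div_pow]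
      ring
  · have h1 : tauCoeff e = 0 := if_neg fun h => he h.1
    rw [circleZeta, if_neg he, h1]
    simp

variable {F : Coeff (Forms T) T}

lemma exists_coeffTrace_pow (hF : F ∈ degreeCoeff T 2) (e : ℕ) :
    ∃ w ∈ degreeForms T (2 * e), coeffTrace (Forms T) T (F ^ e) = realForm w :=
  exists_coeffTrace_eq (pow_mem_degreeCoeff hF e)

lemma tauCoeff_zero : tauCoeff 0 = 0 := by simp [tauCoeff]

lemma body_coeffTrace_pow (hF : F ∈ degreeCoeff T 2) {e : ℕ} (he : e ≠ 0) :
    body T (coeffTrace (Forms T) T (F ^ e)) = 0 := by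
  obtain ⟨w, hw, h⟩ := exists_coeffTrace_pow hF e
  rw [h, body_realForm (by omega) hw]

lemma tauForm_mem (hF : F ∈ degreeCoeff T 2) (r : ℝ) : tauForm r F ∈ formFiltration T 1 := by
  refine Submodule.sum_mem _ fun e _ => ?_
  rcases eq_or_ne e 0 with rfl | he
  · rw [tauCoeff_zero, zero_mul, Complex.ofReal_zero, zero_smul]
    exact Submodule.zero_mem _
  · obtain ⟨w, hw, h⟩ := exists_coeffTrace_pow hF e
    rw [h]
    exact Submodule.smul_mem _ _ (realForm_mem_formFiltration (by omega) hw)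

lemma smul_tauForm_pow [FiniteDimensional ℝ T] (hF : F ∈ degreeCoeff T 2) (r : ℝ) (z : ℂ) :
    (z • tauForm r F) ^ (finrank ℝ T + 1) = 0 :=
  pow_eq_zero_of_mem_formFiltration (Submodule.smul_mem _ _ (tauForm_mem hF r))

lemma isNilpotent_tauForm [FiniteDimensional ℝ T] (hF : F ∈ degreeCoeff T 2) (r : ℝ) :
    IsNilpotent (tauForm r F) :=
  ⟨_, pow_eq_zero_of_mem_formFiltration (tauForm_mem hF r)⟩

lemma tauForm_commute (hF : F ∈ degreeCoeff T 2) (r : ℝ) (a : Forms T) :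
    Commute (tauForm r F) a := by
  refine Commute.sum_left _ _ _ fun e _ => ?_
  obtain ⟨w, hw, h⟩ := exists_coeffTrace_pow hF e
  rw [h]
  exact (realForm_commute hw a).smul_left _

/-- Only traces of even powers of `F` occur. They are real forms of degree `4d`, on which both
conjugations act by `c^(4d) = 1`. -/
lemma formConj_tauForm {c : ℂ} (hc : c = 1 ∨ c = -Complex.I) (hF : F ∈ degreeCoeff T 2) (r : ℝ) :
    formConj c (tauForm r F) = tauForm r F := by
  have hc4 : c ^ 4 = 1 := by
    rcases hc with rfl | rfl
    · simp
    · rw [neg_pow, Complex.I_pow_four]; norm_num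
  rw [tauForm, map_sum]
  refine Finset.sum_congr rfl fun e _ => ?_
  rw [formConj_smul, Complex.conj_ofReal]
  by_cases he : Even e
  · obtain ⟨d, rfl⟩ := even_iff_two_dvd.1 he
    obtain ⟨w, hw, h⟩ := exists_coeffTrace_pow hF (2 * d)
    have h2 : c ^ (2 * (2 * d)) = 1 := by
      rw [show 2 * (2 * d) = 4 * d by ring, pow_mul, hc4, one_pow]
    rw [h, formConj_realForm c hw, h2, one_smul]
  · have h1 : tauCoeff e = 0 := if_neg fun h => he h.1
    rw [h1, zero_mul, Complex.ofReal_zero, zero_smul, zero_smul]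

/-- The exponential of multiples of `tauForm`. -/
def expTau (r : ℝ) (F : Coeff (Forms T) T) (z : ℂ) : Forms T :=
  nilEval (PowerSeries.exp ℂ) (z • tauForm r F)

lemma expTau_add [FiniteDimensional ℝ T] (hF : F ∈ degreeCoeff T 2) (r : ℝ) (z w : ℂ) :
    expTau r F (z + w) = expTau r F z * expTau r F w := by
  have h := isNilpotent_tauForm hF r
  rw [expTau, add_smul, nilEval_exp_add ((Commute.refl _).smul_left z |>.smul_right w) (h.smul z)
    (h.smul w)]
  rfl

lemma expTau_zero (r : ℝ) (F : Coeff (Forms T) T) : expTau r F 0 = 1 := by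
  rw [expTau, zero_smul, nilEval_exp_zero]

lemma inverse_expTau [FiniteDimensional ℝ T] (hF : F ∈ degreeCoeff T 2) (r : ℝ) (z : ℂ) :
    Ring.inverse (expTau r F z) = expTau r F (-z) := by
  rw [expTau, inverse_nilEval_exp ((isNilpotent_tauForm hF r).smul z), expTau, neg_smul]

lemma expTau_commute (hF : F ∈ degreeCoeff T 2) (r : ℝ) (z : ℂ) (a : Forms T) :
    Commute (expTau r F z) a := by
  rw [expTau, nilEval]
  refine Commute.sum_left _ _ _ fun e _ => ?_
  exact (((tauForm_commute hF r a).smul_left z).pow_left e).smul_left _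

lemma formConj_expTau {c : ℂ} (hc : c = 1 ∨ c = -Complex.I) (hF : F ∈ degreeCoeff T 2) (r : ℝ)
    (z : ℝ) : formConj c (expTau r F z) = expTau r F z := by
  rw [expTau, nilEval, map_sum]
  refine Finset.sum_congr rfl fun e _ => ?_
  rw [formConj_smul, map_pow, formConj_smul, formConj_tauForm hc hF, Complex.conj_ofReal,
    PowerSeries.coeff_exp]
  simp

lemma body_nilEval_exp {a : Forms T} (ha : IsNilpotent a) :
    body T (nilEval (PowerSeries.exp ℂ) a) = 1 := by
  have h : body T a = 0 := (ha.map (body T)).eq_zero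
  rw [map_nilEval _ _ ha, h, nilEval_exp_zero]

/-- The nilpotent part of the base is `e^a - 1`, so the power is the substitution of `e^x - 1` into
`(1 + x)^s`. -/
lemma powAt_smul_exp {a : Forms T} (ha : IsNilpotent a) {b : ℂ} (hb : b ≠ 0) (s : ℂ) :
    powAt (body T (b • nilEval (PowerSeries.exp ℂ) a)) (b • nilEval (PowerSeries.exp ℂ) a) s =
      b ^ s • nilEval (PowerSeries.exp ℂ) (s • a) := by
  rw [powAt, map_smul, body_nilEval_exp ha, smul_eq_mul, mul_one, smul_smul, inv_mul_cancel₀ hb,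
    one_smul]
  have h1 : nilEval (PowerSeries.exp ℂ) a - 1 = nilEval (PowerSeries.exp ℂ - 1) a := by
    rw [← nilHom_apply a ha, ← nilHom_apply a ha, map_sub, map_one]
  rw [h1, ← nilEval_subst _ (by simp) ha, powSeries_subst_exp_sub_one, nilEval_rescale _ _ ha]

/-- The metric factor of a metric curvature tensor. -/
lemma metricFactor_eq [FiniteDimensional ℝ T] {c : ℂ} (hc : c = 1 ∨ c = -Complex.I) {r : ℝ}
    (hr : 0 < r) (hF : F ∈ degreeCoeff T 2) (hadj : coeffAdjoint (formConj c) F = -(c ^ 2) • F) :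
    metricFactor c r F = expTau r F 1 := by
  have hD := (isZetaDet_sum (ε := body T) (P := bosonicOp F * opAdjoint (formConj c) (bosonicOp F))
    hr two_ne_zero (pow_eq_zero_of_mem_degreeCoeff hF) (fun e he => body_coeffTrace_pow hF he)
    (constantCoeff_blockSeries c) (fun m hm => modeBlock_bosonicOp hadj
      ⟨_, pow_eq_zero_of_mem_degreeCoeff hF⟩ hr hm) (Nat.succ_ne_zero _)).zetaDet_eq
  -- For `d²/dt²` the nilpotent part is zero and `p = 2` is the same, so its determinant is exactly
  -- the scalar `b` in front of the other determinant.
  have hN := (isZetaDet_sum (ε := body T) (A := 0) (q := 0) (K := 1) (p := 2)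
    (P := (Polynomial.X ^ 2 * opAdjoint (formConj c) (Polynomial.X ^ 2) : (Coeff (Forms T) T)[X]))
    hr two_ne_zero (pow_one 0) (fun e he => by rw [zero_pow he, map_zero, map_zero])
    (map_zero _) (fun m hm => by
      rw [opAdjoint_X_sq, modeBlock_mul, modeBlock_X_sq, smul_zero, nilEval_zero, neg_mul_neg,
        smul_mul_smul_comm, ← pow_add]
      simp) one_ne_zero).zetaDet_eq
  have hL : logDetSum r 2 0 1 (0 : Coeff (Forms T) T) = 0 := by
    rw [logDetSum, Finset.sum_range_one, PowerSeries.coeff_zero_eq_constantCoeff_apply,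
      constantCoeff_logSeries_subst (map_zero _), zero_mul, zero_smul]
  rw [neg_two_smul_tauForm hc hr] at hD
  rw [hL] at hN
  set b := Complex.exp (-(finrank ℝ T * deriv (circleZeta r 2 0) 0)) with hb
  have hb0 : b ≠ 0 := Complex.exp_ne_zero _
  have hb1 : b ^ (1 / 2 : ℂ) ≠ 0 := by
    rw [Ne, Complex.cpow_eq_zero_iff]
    exact fun h => hb0 h.1
  have hτ := isNilpotent_tauForm hF r
  rw [metricFactor, zetaDetSq, zetaDetSq, hD, hN, powAt_smul_exp IsNilpotent.zero hb0,
    powAt_smul_exp (hτ.smul _) hb0, smul_zero, nilEval_exp_zero, smul_smul,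
    show (1 / 2 : ℂ) * -2 = -1 by norm_num]
  change _ * Ring.inverse (_ • expTau r F (-1)) = _
  have h1 : expTau r F (-1) * expTau r F 1 = 1 := by
    rw [← expTau_add hF, neg_add_cancel, expTau_zero]
  have h2 : expTau r F 1 * expTau r F (-1) = 1 := by
    rw [← expTau_add hF, add_neg_cancel, expTau_zero]
  have h3 : Ring.inverse (b ^ (1 / 2 : ℂ) • expTau r F (-1)) =
      (b ^ (1 / 2 : ℂ))⁻¹ • expTau r F 1 :=
    Ring.inverse_unit ⟨b ^ (1 / 2 : ℂ) • expTau r F (-1), (b ^ (1 / 2 : ℂ))⁻¹ • expTau r F 1,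
      by rw [smul_mul_smul_comm, h1, mul_inv_cancel₀ hb1, one_smul],
      by rw [smul_mul_smul_comm, h2, inv_mul_cancel₀ hb1, one_smul]⟩
  rw [h3, smul_mul_smul_comm, mul_inv_cancel₀ hb1, one_smul, one_mul]

/-- The function `Â` as an exponential. -/
lemma formFunction_ahatForm [FiniteDimensional ℝ T] {r : ℝ} (hr : 0 < r)
    (hF : F ∈ degreeCoeff T 2) :
    formFunction r (ahatForm F) = expTau r F (1 / 2) := by
  have hK := pow_eq_zero_of_mem_degreeCoeff hF
  set w : ℂ := (2 * (Real.pi : ℂ) * Complex.I)⁻¹ with hw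
  have hK' : (w • F) ^ (finrank ℝ T + 1) = 0 := by rw [smul_pow, hK, smul_zero]
  have hN : IsNilpotent (w • F) := ⟨_, hK'⟩
  have hpi : (Real.pi : ℂ) ≠ 0 := by exact_mod_cast Real.pi_ne_zero
  have h1 : nilEval ahatSeries (w • F) - 1 = nilEval (ahatSeries - 1) (w • F) := by
    rw [← nilHom_apply _ hN, ← nilHom_apply _ hN, map_sub, map_one]
  have hL0 : PowerSeries.coeff 0 (logSeries.subst (ahatSeries - 1)) = 0 := by
    rw [PowerSeries.coeff_zero_eq_constantCoeff_apply,
      constantCoeff_logSeries_subst log_ahatSeries_constantCoeff]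
  -- The exponent has no component of degree zero and is therefore nilpotent. This permits moving
  -- the rescaling of forms inside the exponential.
  have hmem : (2⁻¹ : ℂ) • coeffTrace (Forms T) T
      (nilEval logSeries (nilEval ahatSeries (w • F) - 1)) ∈ formFiltration T 1 := by
    rw [h1, ← nilEval_subst _ log_ahatSeries_constantCoeff hN, coeffTrace_nilEval _ hK']
    refine Submodule.smul_mem _ _ (Submodule.sum_mem _ fun e _ => ?_)
    rcases eq_or_ne e 0 with rfl | he
    · rw [hL0, zero_smul]
      exact Submodule.zero_mem _
    · obtain ⟨v, hv, h⟩ := exists_coeffTrace_pow hF e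
      rw [smul_pow, coeffTrace_smul, h]
      exact Submodule.smul_mem _ _ (Submodule.smul_mem _ _
        (realForm_mem_formFiltration (by omega) hv))
  rw [formFunction, ahatForm, expAt, Complex.exp_zero, one_smul, map_zero, sub_zero,
    map_nilEval _ _ ⟨_, pow_eq_zero_of_mem_formFiltration hmem⟩, expTau]
  congr 1
  rw [h1, ← nilEval_subst _ log_ahatSeries_constantCoeff hN, coeffTrace_nilEval _ hK', map_smul,
    map_sum, one_div, tauForm]
  congr 1
  refine Finset.sum_congr rfl fun e _ => ?_
  obtain ⟨v, hv, h⟩ := exists_coeffTrace_pow hF e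
  rw [smul_pow, coeffTrace_smul, h, smul_smul, map_smul, scaleForms_realForm _ hv, smul_smul]
  congr 1
  by_cases he : Even e
  · obtain ⟨d, rfl⟩ := even_iff_two_dvd.1 he
    rcases eq_or_ne d 0 with rfl | hd
    · rw [mul_zero, hL0, tauCoeff_zero]
      simp
    · have hd' : (d : ℂ) ≠ 0 := by exact_mod_cast hd
      -- The trace of `F^(2d)` has form degree `4d`, so it is multiplied by `(2πr)^(2d)`. Together
      -- with `(2πi)^(-2d)` and the factor `(2π)^(-2d)` of the logarithm this gives `(r/2π)^(2d)`;
      -- the signs `(-1)^d` cancel.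
      have hs : ((Real.sqrt (2 * Real.pi * r) : ℝ) : ℂ) ^ (2 * (2 * d)) =
          (2 * Real.pi * r) ^ (2 * d) := by
        rw [pow_mul, ← Complex.ofReal_pow, Real.sq_sqrt (by have := Real.pi_pos; positivity)]
        push_cast
        rfl
      have hI : (Complex.I ^ (2 * d)) = (-1) ^ d := by rw [pow_mul, Complex.I_sq]
      have hm : ((-1 : ℂ) ^ d) * (-1) ^ d = 1 := by rw [← mul_pow]; simp
      have hm0 : ((-1 : ℂ) ^ d) ≠ 0 := pow_ne_zero _ (by norm_num)
      rw [coeff_log_ahatSeries_two_mul hd, hs, Complex.ofReal_mul, tauCoeff_two_mul hd, hw,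
        Complex.ofReal_pow, inv_pow, mul_pow _ Complex.I, hI, mul_pow _ (r : ℂ), one_div_pow]
      field_simp
  · rw [coeff_log_ahatSeries_of_odd (Nat.not_even_iff_odd.1 he)]
    have h1 : tauCoeff e = 0 := if_neg fun h => he h.1
    rw [h1]
    simp

end Operators

/-! ### The determinant of `d/dt` on ordinary loops -/

section ReducedDet

/-- The `ζ`-determinant of the reduced family. -/
lemma reducedZetaDet_eq {r : ℝ} (hr : 0 < r) (V : Type*) [NormedAddCommGroup V]
    [InnerProductSpace ℝ V] [FiniteDimensional ℝ V] :
    reducedZetaDet r V = ‖Complex.exp (-(finrank ℝ V * deriv (circleZeta r 1 0) 0))‖ := by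
  -- As `d/dt` is formally skew-adjoint, `D D*` is `-d²/dt²`, with blocks `λ²`: the case `p = 1`
  -- without nilpotent part.
  have hX : opAdjoint Complex.conjAe.toAlgHom (Polynomial.X : (Coeff ℂ V)[X]) = -Polynomial.X := by
    ext j : 1
    rw [coeff_opAdjoint, Polynomial.coeff_neg, Polynomial.coeff_X]
    split_ifs with h
    · have h1 : coeffAdjoint Complex.conjAe.toAlgHom (1 : Coeff ℂ V) = 1 := by
        change Coeff.tmul (Complex.conjAe.toAlgHom 1) (LinearMap.adjoint (1 : Module.End ℝ V)) = _
        rw [map_one, LinearMap.adjoint_one]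
        rfl
      rw [h1, ← h]; simp
    · rw [map_zero, mul_zero, neg_zero]
  have hN := (isZetaDet_sum (ε := AlgHom.id ℂ ℂ) (A := 0) (q := 0) (K := 1) (p := 1)
    (P := (Polynomial.X * opAdjoint Complex.conjAe.toAlgHom Polynomial.X : (Coeff ℂ V)[X]))
    hr one_ne_zero (pow_one 0) (fun e he => by rw [zero_pow he, map_zero, map_zero])
    (map_zero _) (fun m hm => by
      rw [hX, mul_neg, ← pow_two, modeBlock_neg, modeBlock_X_sq, smul_zero, nilEval_zero]
      simp) one_ne_zero).zetaDet_eq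
  have hL : logDetSum r 1 0 1 (0 : Coeff ℂ V) = 0 := by
    rw [logDetSum, Finset.sum_range_one, PowerSeries.coeff_zero_eq_constantCoeff_apply,
      constantCoeff_logSeries_subst (map_zero _), zero_mul, zero_smul]
  rw [reducedZetaDet, zetaDetSq, hN, hL, nilEval_exp_zero, smul_eq_mul, mul_one]

lemma reducedZetaDet_pos {r : ℝ} (hr : 0 < r) (V : Type*) [NormedAddCommGroup V]
    [InnerProductSpace ℝ V] [FiniteDimensional ℝ V] : 0 < reducedZetaDet r V := by
  rw [reducedZetaDet_eq hr]
  exact norm_pos_iff.2 (Complex.exp_ne_zero _)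

end ReducedDet


/-! ### Invertibility of the derivative on loops -/

section LoopDeriv

variable {r : ℝ} {V : Type*} [NormedAddCommGroup V] [NormedSpace ℝ V] [FiniteDimensional ℝ V]

/-- A constant loop with integral zero vanishes. -/
lemma ker_loopDeriv (hr : 0 < r) : LinearMap.ker (loopDeriv r V) = ⊥ := by
  rw [LinearMap.ker_eq_bot']
  rintro ⟨f, hf, hp, hi⟩ h
  have hd : ∀ t, deriv f t = 0 := fun t => congrFun (congrArg Subtype.val h) t
  have hc : ∀ t, f t = f 0 := fun t =>
    is_const_of_deriv_eq_zero (contDiff_infty_iff_deriv.1 hf).1 hd t 0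
  simp only [hc, intervalIntegral.integral_const, sub_zero] at hi
  ext t
  change f t = 0
  rw [hc]
  exact (smul_eq_zero.1 hi).resolve_left hr.ne'

lemma range_loopDeriv (hr : 0 < r) : LinearMap.range (loopDeriv r V) = ⊤ := by
  have : CompleteSpace V := FiniteDimensional.complete ℝ V
  rw [LinearMap.range_eq_top]
  rintro ⟨f, hf, hp, hi⟩
  set g : ℝ → V := fun t => ∫ s in (0 : ℝ)..t, f s with hg
  have hgd : ∀ t, HasDerivAt g (f t) t := fun t =>
    intervalIntegral.integral_hasDerivAt_right (hf.continuous.intervalIntegrable _ _)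
      (hf.continuous.stronglyMeasurableAtFilter _ _) hf.continuous.continuousAt
  have hgs : ContDiff ℝ ∞ g := by
    rw [contDiff_infty_iff_deriv]
    refine ⟨fun t => (hgd t).differentiableAt, ?_⟩
    rwa [show deriv g = f from funext fun t => (hgd t).deriv]
  -- The primitive is periodic exactly because `f` has integral zero over a period; subtracting its
  -- mean `a` makes it orthogonal to the constants.
  have hgp : Function.Periodic g r := fun t => by
    have h1 : g (t + r) = g t + ∫ s in t..(t + r), f s :=
      (intervalIntegral.integral_add_adjacent_intervals (hf.continuous.intervalIntegrable _ _)
        (hf.continuous.intervalIntegrable _ _)).symm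
    have h2 := hp.intervalIntegral_add_eq t 0
    rw [zero_add] at h2
    rw [h1, h2, hi, add_zero]
  set a : V := r⁻¹ • ∫ t in (0 : ℝ)..r, g t with ha
  refine ⟨⟨fun t => g t - a, hgs.sub contDiff_const, fun t => by simp [hgp t], ?_⟩, ?_⟩
  · rw [intervalIntegral.integral_sub (hgs.continuous.intervalIntegrable _ _)
      intervalIntegrable_const, intervalIntegral.integral_const, ha, smul_smul, sub_zero,
      mul_inv_cancel₀ hr.ne', one_smul, sub_self]
  · ext t
    exact ((hgd t).sub_const a).deriv

end LoopDeriv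

/-! ### Generators of lines -/

section Generators

variable {L L' : Type*} [AddCommGroup L] [Module ℝ L] [AddCommGroup L'] [Module ℝ L']

/-- The element `e` is a generator of the real line `L`. -/
def IsGenerator (e : L) : Prop := ∃ φ : L ≃ₗ[ℝ] ℝ, φ e = 1

lemma IsGenerator.tmul {e : L} {e' : L'} (h : IsGenerator e) (h' : IsGenerator e') :
    IsGenerator (e ⊗ₜ[ℝ] e') := by
  obtain ⟨φ, hφ⟩ := h
  obtain ⟨ψ, hψ⟩ := h'
  exact ⟨(TensorProduct.congr φ ψ).trans (TensorProduct.lid ℝ ℝ), by simp [hφ, hψ]⟩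

lemma IsGenerator.dual {e : L} (h : IsGenerator e) {f : Dual ℝ L} (hf : f e = 1) :
    IsGenerator f := by
  obtain ⟨φ, hφ⟩ := h
  refine ⟨φ.symm.dualMap.trans (LinearMap.ringLmapEquivSelf ℝ ℝ ℝ), ?_⟩
  have : φ.symm 1 = e := by rw [← hφ, φ.symm_apply_apply]
  simp [this, hf]

lemma IsGenerator.lineInv_self {e : L} (h : IsGenerator e) : lineInv e e = 1 := by
  obtain ⟨φ, hφ⟩ := h
  have h' : ∃ φ : Dual ℝ L, φ e = 1 := ⟨φ.toLinearMap, hφ⟩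
  rw [lineInv, dif_pos h']
  exact h'.choose_spec

lemma IsGenerator.lineInv {e : L} (h : IsGenerator e) : IsGenerator (lineInv e) :=
  h.dual h.lineInv_self

/-- The degree is a variable with an equation because it will be the rank of a kernel or cokernel,
which equals zero only by a proof. -/
lemma isGenerator_ιMulti {M : Type*} [AddCommGroup M] [Module ℝ M] {k : ℕ} (hk : k = 0)
    (v : Fin k → M) : IsGenerator (exteriorPower.ιMulti ℝ k v) := by
  subst hk
  exact ⟨exteriorPower.zeroEquiv ℝ M, exteriorPower.zeroEquiv_ιMulti v⟩

lemma isGenerator_topScalar {M : Type*} [AddCommGroup M] [Module ℝ M] {k : ℕ} (hk : k = 0) :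
    IsGenerator (topScalar k M) := by
  refine (isGenerator_ιMulti hk (fun _ => (0 : M))).dual ?_
  subst hk
  simp [topScalar, exteriorPower.ιMulti_apply_coe, ExteriorAlgebra.ιMulti_apply]

lemma metricWith_self {e : L} (h : IsGenerator e) (a : ℝ) : metricWith e a e e = a := by
  simp [metricWith, h.lineInv_self]

lemma dualMetric_lineInv {e : L} (h : IsGenerator e) (B : LinearMap.BilinForm ℝ L) :
    dualMetric B e (lineInv e) (lineInv e) = (B e e)⁻¹ := by
  simp [dualMetric, h.lineInv_self]

lemma IsGenerator.bijective_tmul {e : L} (h : IsGenerator e) (A : Type*) [AddCommGroup A]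
    [Module ℝ A] : Function.Bijective fun a : A => a ⊗ₜ[ℝ] e := by
  obtain ⟨φ, hφ⟩ := h
  have : (fun a : A => a ⊗ₜ[ℝ] e) =
      ((TensorProduct.congr (LinearEquiv.refl ℝ A) φ).trans (TensorProduct.rid ℝ A)).symm := by
    funext a
    rw [LinearEquiv.eq_symm_apply]
    simp [hφ]
  rw [this]
  exact LinearEquiv.bijective _

end Generators

/-! ### The relative line of the reduced family -/

section Reduced

variable {r : ℝ} (V : Type*) [NormedAddCommGroup V] [InnerProductSpace ℝ V]
  [FiniteDimensional ℝ V]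

lemma finrank_ker_loopDeriv (hr : 0 < r) : finrank ℝ (LinearMap.ker (loopDeriv r V)) = 0 := by
  rw [ker_loopDeriv hr, finrank_bot]

lemma finrank_coker_loopDeriv (hr : 0 < r) :
    finrank ℝ (Loop r V ⧸ LinearMap.range (loopDeriv r V)) = 0 := by
  have : Subsingleton (Loop r V ⧸ LinearMap.range (loopDeriv r V)) :=
    Submodule.Quotient.subsingleton_iff.2 (range_loopDeriv hr)
  exact finrank_zero_of_subsingleton

lemma isGenerator_pfSection (hr : 0 < r) : IsGenerator (pfSection (loopDeriv r V)) :=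
  isGenerator_topScalar (finrank_ker_loopDeriv V hr)

lemma isGenerator_detSection (hr : 0 < r) : IsGenerator (detSection (loopDeriv r V)) :=
  (isGenerator_topScalar (finrank_ker_loopDeriv V hr)).tmul
    (isGenerator_ιMulti (finrank_coker_loopDeriv V hr) _)

lemma isGenerator_sdetSection (hr : 0 < r) : IsGenerator (sdetSection r V) :=
  (isGenerator_pfSection V hr).tmul (isGenerator_detSection V hr).lineInv

lemma isGenerator_relSection (hr : 0 < r) (n : ℕ) : IsGenerator (relSection r V n) :=
  (isGenerator_sdetSection V hr).tmul (isGenerator_sdetSection _ hr).lineInv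

lemma bilinForm_tmul_apply {L L' : Type*} [AddCommGroup L] [Module ℝ L] [AddCommGroup L']
    [Module ℝ L'] (B : LinearMap.BilinForm ℝ L) (B' : LinearMap.BilinForm ℝ L') (e : L) (e' : L') :
    LinearMap.BilinForm.tmul B B' (e ⊗ₜ[ℝ] e') (e ⊗ₜ[ℝ] e') = B e e * B' e' e' := by
  simp [LinearMap.BilinForm.tmul, mul_comm]

lemma sdetMetric_self (hr : 0 < r) : sdetMetric r V (sdetSection r V) (sdetSection r V) =
    Real.sqrt (reducedZetaDet r V) * (reducedZetaDet r V)⁻¹ := by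
  rw [sdetMetric, sdetSection, bilinForm_tmul_apply, pfMetric,
    metricWith_self (isGenerator_pfSection V hr), dualMetric_lineInv (isGenerator_detSection V hr),
    detMetric, metricWith_self (isGenerator_detSection V hr)]

/-- The relative section of the reduced family has unit norm. -/
lemma relMetric_self (hr : 0 < r) : relMetric r V (finrank ℝ V) (relSection r V (finrank ℝ V))
    (relSection r V (finrank ℝ V)) = 1 := by
  -- The reduced determinant depends only on the length and the rank, so the norms of the two super
  -- determinant sections are equal and cancel.
  have h : reducedZetaDet r (EuclideanSpace ℝ (Fin (finrank ℝ V))) = reducedZetaDet r V := by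
    rw [reducedZetaDet_eq hr, reducedZetaDet_eq hr, finrank_euclideanSpace_fin]
  have hpos := reducedZetaDet_pos hr V
  refine (bilinForm_tmul_apply _ _ _ _).trans ?_
  rw [dualMetric_lineInv (isGenerator_sdetSection _ hr), sdetMetric_self V hr,
    sdetMetric_self _ hr, h, mul_inv_cancel₀]
  have := Real.sqrt_pos.2 hpos
  positivity

end Reduced

/-! ### The relative line over the super family -/

section SuperFamily

variable {r : ℝ} {T : Type*} [NormedAddCommGroup T] [InnerProductSpace ℝ T]
  [FiniteDimensional ℝ T]

lemma smul_superSection (n : ℕ) (a : Forms T) :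
    a • superSection r T n = a ⊗ₜ[ℝ] relSection r T n := by
  rw [superSection, TensorProduct.smul_tmul', smul_eq_mul, mul_one]

lemma bijective_smul_superSection (hr : 0 < r) (n : ℕ) :
    Function.Bijective fun a : Forms T => a • superSection r T n := by
  simp only [smul_superSection]
  exact (isGenerator_relSection T hr n).bijective_tmul _

lemma superConj_smul_superSection (c : ℂ) (n : ℕ) (a : Forms T) :
    superConj (L := RelLine r T n) c (a • superSection r T n) =
      formConj c a • superSection r T n := by
  rw [smul_superSection, smul_superSection]
  rfl

lemma superMetric_smul_superSection (hr : 0 < r) (c : ℂ) (ρ a b : Forms T) {n : ℕ}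
    (hn : finrank ℝ T = n) :
    superMetric c ρ (relMetric r T n) (a • superSection r T n) (b • superSection r T n) =
      a * ρ * formConj c b := by
  subst hn
  rw [smul_superSection, smul_superSection]
  have h := relMetric_self T hr
  simp only [superMetric, LinearMap.BilinMap.tmul, LinearMap.compr₂_apply,
    LinearMap.BilinMap.tensorDistrib_tmul, h, LinearEquiv.coe_coe, TensorProduct.rid_tmul, one_smul]
  rfl

end SuperFamily


/-! ### Vector fields that are smooth near a point -/

section SmoothNear

open VectorField
open scoped Topology

variable {E : Type*} [NormedAddCommGroup E] [NormedSpace ℝ E]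
  {H : Type*} [TopologicalSpace H] {I : ModelWithCorners ℝ E H}
  {M : Type*} [TopologicalSpace M] [ChartedSpace H M]

/-- The vector field `W` is smooth in a neighbourhood of `x`. -/
def SmoothNear (x : M) (W : (y : M) → TangentSpace I y) [IsManifold I ∞ M] : Prop :=
  ∀ᶠ y in 𝓝 x, CMDiffAt ∞ (T% W) y

variable [IsManifold I ∞ M] {x : M} {U V W W' : (y : M) → TangentSpace I y} {f : M → ℝ}

lemma SmoothNear.contMDiffAt (h : SmoothNear x W) : CMDiffAt ∞ (T% W) x := h.self_of_nhds

lemma SmoothNear.mdifferentiableAt (h : SmoothNear x W) : MDiffAt (T% W) x :=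
  h.contMDiffAt.mdifferentiableAt (by simp)

lemma SmoothNear.eventually (h : SmoothNear x W) : ∀ᶠ y in 𝓝 x, SmoothNear y W :=
  eventually_eventually_nhds.2 h

lemma SmoothNear.add (h : SmoothNear x W) (h' : SmoothNear x W') : SmoothNear x (W + W') := by
  filter_upwards [h, h'] with y hy hy' using hy.add_section hy'

lemma SmoothNear.smul (hf : ∀ᶠ y in 𝓝 x, CMDiffAt ∞ f y) (h : SmoothNear x W) :
    SmoothNear x (f • W) := by
  filter_upwards [hf, h] with y hy hy' using hy.smul_section hy'

lemma SmoothNear.sum {ι : Type*} {s : Finset ι} {W : ι → (y : M) → TangentSpace I y}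
    (h : ∀ i, SmoothNear x (W i)) : SmoothNear x (fun y => ∑ i ∈ s, W i y) := by
  have h' : ∀ᶠ y in 𝓝 x, ∀ i ∈ s, CMDiffAt ∞ (T% (W i)) y :=
    (Filter.eventually_all_finset s).2 fun i _ => h i
  filter_upwards [h'] with y hy using ContMDiffAt.sum_section hy

lemma SmoothNear.congr (h : SmoothNear x W) (hW : ∀ᶠ y in 𝓝 x, W' y = W y) : SmoothNear x W' := by
  filter_upwards [h, eventually_eventually_nhds.2 hW] with y hy hy'
  exact hy.congr_of_eventuallyEq (hy'.mono fun z hz => by simp [hz])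

lemma smoothNear_extend (w : TangentSpace I x) : SmoothNear x (FiberBundle.extend E w) := by
  obtain ⟨u, hu, h⟩ := FiberBundle.exists_contMDiffOn_extend (k := ∞) I E w
  filter_upwards [eventually_mem_nhds_iff.2 hu] with y hy using h.contMDiffAt hy

lemma minSmoothness_two_le : minSmoothness ℝ 2 ≤ ∞ := by
  rw [minSmoothness_of_isRCLikeNormedField]
  exact WithTop.coe_le_coe.2 (le_top : (2 : ℕ∞) ≤ ⊤)

omit [IsManifold I ∞ M] in
lemma isManifold_minSmoothness (k : ℕ) [IsManifold I ∞ M] : IsManifold I (minSmoothness ℝ k) M := by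
  rw [minSmoothness_of_isRCLikeNormedField]
  infer_instance

lemma SmoothNear.mlieBracket [CompleteSpace E] (hU : SmoothNear x U) (hV : SmoothNear x V) :
    SmoothNear x (mlieBracket I U V) := by
  have : IsManifold I (((⊤ : ℕ∞) : ℕ∞ω) + 1) M := inferInstanceAs (IsManifold I ∞ M)
  have := isManifold_minSmoothness (I := I) (M := M) 2
  filter_upwards [hU, hV] with y hy hy'
  exact ContMDiffAt.mlieBracket_vectorField (m := ⊤) (n := ⊤) hy hy' (by simp)

/-- Multiplication by a bump function supported where `W` is smooth. Global fields are what the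
smoothness condition on a connection takes as input. -/
lemma SmoothNear.exists_contMDiff [FiniteDimensional ℝ E] [T2Space M] (h : SmoothNear x W) :
    ∃ W' : (y : M) → TangentSpace I y, CMDiff ∞ (T% W') ∧ ∀ᶠ y in 𝓝 x, W' y = W y := by
  obtain ⟨u, hu, huo, hxu⟩ := eventually_nhds_iff.1 h
  obtain ⟨ψ, -, hψ⟩ := (SmoothBumpFunction.nhds_basis_tsupport (I := I) x).mem_iff.1
    (huo.mem_nhds hxu)
  refine ⟨(ψ : M → ℝ) • W, ?_, ?_⟩
  · exact ContMDiffOn.smul_section_of_tsupport ψ.contMDiff.contMDiffOn huo hψ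
      (fun y hy => (hu y hy).contMDiffWithinAt)
  · filter_upwards [ψ.eventuallyEq_one] with y hy
    simp [hy]

/-- This is `[U,V] f = U(V f) - V(U f)`, multiplied by `W`. It is the difference between the Jacobi
identity for `U, V, f W` and `f` times that for `U, V, W`. -/
lemma mvfderiv_commutator_smul [CompleteSpace E] (hU : SmoothNear x U) (hV : SmoothNear x V)
    (hW : SmoothNear x W) (hf : ∀ᶠ y in 𝓝 x, CMDiffAt ∞ f y)
    (hfU : MDiffAt (fun y => d% f y (U y)) x) (hfV : MDiffAt (fun y => d% f y (V y)) x) :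
    (d% (fun y => d% f y (V y)) x (U x) - d% (fun y => d% f y (U y)) x (V x)
      - d% f x (mlieBracket I U V x)) • W x = 0 := by
  have hfd : ∀ᶠ y in 𝓝 x, MDiffAt f y := hf.mono fun y hy => hy.mdifferentiableAt (by simp)
  have key : ∀ {U V : (y : M) → TangentSpace I y}, SmoothNear x U → SmoothNear x V →
      MDiffAt (fun y => d% f y (V y)) x →
      mlieBracket I U (mlieBracket I V (f • W)) x =
        d% (fun y => d% f y (V y)) x (U x) • W x + d% f x (V x) • mlieBracket I U W x +
          (d% f x (U x) • mlieBracket I V W x + f x • mlieBracket I U (mlieBracket I V W) x) := by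
    intro U V hU hV hfV
    have h1 : mlieBracket I V (f • W) =ᶠ[𝓝 x]
        (fun y => d% f y (V y)) • W + f • mlieBracket I V W := by
      filter_upwards [hfd, hW.eventually] with y hy hy'
      exact mlieBracket_smul_right hy hy'.mdifferentiableAt
    rw [Filter.EventuallyEq.mlieBracket_vectorField_eq (Filter.EventuallyEq.refl _ U) h1,
      mlieBracket_add_right (hfV.smul_section hW.mdifferentiableAt)
        (hfd.self_of_nhds.smul_section (hV.mlieBracket hW).mdifferentiableAt),
      mlieBracket_smul_right hfV hW.mdifferentiableAt,
      mlieBracket_smul_right hfd.self_of_nhds (hV.mlieBracket hW).mdifferentiableAt]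
  have := isManifold_minSmoothness (I := I) (M := M) 3
  have hJ := leibniz_identity_mlieBracket_apply (hU.contMDiffAt.of_le minSmoothness_two_le)
    (hV.contMDiffAt.of_le minSmoothness_two_le) ((hW.smul hf).contMDiffAt.of_le minSmoothness_two_le)
  have hJ' := leibniz_identity_mlieBracket_apply (hU.contMDiffAt.of_le minSmoothness_two_le)
    (hV.contMDiffAt.of_le minSmoothness_two_le) (hW.contMDiffAt.of_le minSmoothness_two_le)
  rw [key hU hV hfV, key hV hU hfU, mlieBracket_smul_right hfd.self_of_nhds hW.mdifferentiableAt,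
    hJ'] at hJ
  rw [sub_smul, sub_smul, ← sub_eq_zero.2 hJ]
  module

end SmoothNear


/-! ### The curvature operator of a connection -/

section CurvatureOp

open VectorField
open scoped Topology

variable {E : Type*} [NormedAddCommGroup E] [NormedSpace ℝ E] [FiniteDimensional ℝ E]
  {H : Type*} [TopologicalSpace H] {I : ModelWithCorners ℝ E H}
  {M : Type*} [TopologicalSpace M] [ChartedSpace H M] [IsManifold I ∞ M]
  (conn : CovariantDerivative I E (fun x : M ↦ TangentSpace I x))
  {x : M} {U V W W' : (y : M) → TangentSpace I y} {f : M → ℝ}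

/-- The operator `∇_U ∇_V - ∇_V ∇_U - ∇_{[U, V]}` on vector fields. -/
def curvatureOp (U V W : (y : M) → TangentSpace I y) (x : M) : TangentSpace I x :=
  conn (fun y => conn W y (V y)) x (U x) - conn (fun y => conn W y (U y)) x (V x)
    - conn W x (mlieBracket I U V x)

variable {conn}

omit [FiniteDimensional ℝ E] in
lemma conn_eventuallyEq (hW : SmoothNear x W) (h : ∀ᶠ y in 𝓝 x, W' y = W y) :
    ∀ᶠ y in 𝓝 x, conn W' y = conn W y := by
  filter_upwards [hW.eventually, (hW.congr h).eventually, eventually_eventually_nhds.2 h]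
    with y hy hy' h'
  exact conn.isCovariantDerivativeOn.congr_of_eventuallyEq (s := Set.univ) hy'.mdifferentiableAt
    hy.mdifferentiableAt Filter.univ_mem h'

variable [T2Space M] [hsmooth : conn.ContMDiffCovariantDerivative ∞]

/-- A connection is local, so `W` may be replaced by a globally smooth field that agrees with it
near `x`. -/
lemma contMDiffAt_conn (h : SmoothNear x W) :
    ContMDiffAt I (I.prod 𝓘(ℝ, E →L[ℝ] E)) ∞
      (fun y => (⟨y, conn W y⟩ : TotalSpace (E →L[ℝ] E)
        fun x : M ↦ TangentSpace I x →L[ℝ] TangentSpace I x)) x := by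
  obtain ⟨W', hW', h'⟩ := h.exists_contMDiff
  have h1 := (hsmooth.contMDiff.contMDiff (σ := W') hW'.contMDiffOn).contMDiffAt
    (Filter.univ_mem (f := 𝓝 x))
  refine h1.congr_of_eventuallyEq ?_
  filter_upwards [conn_eventuallyEq (conn := conn) h h'] with y hy
  rw [hy]

lemma SmoothNear.covDeriv (hV : SmoothNear x V) (hW : SmoothNear x W) :
    SmoothNear x (fun y => conn W y (V y)) := by
  filter_upwards [hV, hW.eventually] with y hy hy'
  exact (contMDiffAt_conn (conn := conn) hy').clm_bundle_apply hy

lemma mdifferentiableAt_conn (hV : MDiffAt (T% V) x) (hW : SmoothNear x W) :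
    MDiffAt (T% (fun y => conn W y (V y))) x :=
  ((contMDiffAt_conn (conn := conn) hW).mdifferentiableAt (by simp)).clm_bundle_apply hV

variable (conn) in
omit [FiniteDimensional ℝ E] [T2Space M] hsmooth in
lemma curvatureOp_swap (U V W : (y : M) → TangentSpace I y) :
    curvatureOp conn U V W x = -curvatureOp conn V U W x := by
  rw [curvatureOp, curvatureOp, mlieBracket_swap_apply, map_neg]
  module

/-- The derivative of `f` along `V` appears once in `∇_V (f ∇_U W)` and once in `[f U, V]`, and the
two contributions cancel. The second slot follows by antisymmetry. -/
lemma tensorialAt_curvatureOp (hW : SmoothNear x W) :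
    TensorialAt I E (fun U => curvatureOp conn U V W x) x where
  smul {f U} hf hU := by
    have h1 : (fun y => conn W y ((f • U) y)) = f • fun y => conn W y (U y) :=
      funext fun y => map_smul (conn W y) (f y) (U y)
    simp only [curvatureOp]
    rw [h1, conn.isCovariantDerivativeOn.leibniz (mdifferentiableAt_conn hU hW) hf,
      mlieBracket_smul_left hf hU]
    simp
    module
  add {U U'} hU hU' := by
    have h1 : (fun y => conn W y ((U + U') y)) =
        (fun y => conn W y (U y)) + fun y => conn W y (U' y) :=
      funext fun y => map_add (conn W y) (U y) (U' y)
    simp only [curvatureOp]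
    rw [h1, conn.isCovariantDerivativeOn.add (mdifferentiableAt_conn hU hW)
      (mdifferentiableAt_conn hU' hW), mlieBracket_add_left hU hU']
    simp
    module

lemma curvatureOp_congr_left {U' V' : (y : M) → TangentSpace I y} (hU : MDiffAt (T% U) x)
    (hU' : MDiffAt (T% U') x) (hV : MDiffAt (T% V) x) (hV' : MDiffAt (T% V') x)
    (hW : SmoothNear x W) (h : U x = U' x) (h' : V x = V' x) :
    curvatureOp conn U V W x = curvatureOp conn U' V' W x := by
  rw [(tensorialAt_curvatureOp hW).pointwise hU hU' h, curvatureOp_swap conn U' V,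
    (tensorialAt_curvatureOp hW).pointwise hV hV' h', curvatureOp_swap conn V' U', neg_neg]

lemma curvatureOp_add_right (hU : SmoothNear x U) (hV : SmoothNear x V) (hW : SmoothNear x W)
    (hW' : SmoothNear x W') :
    curvatureOp conn U V (W + W') x = curvatureOp conn U V W x + curvatureOp conn U V W' x := by
  have key : ∀ {V : (y : M) → TangentSpace I y}, SmoothNear x V →
      conn (fun y => conn (W + W') y (V y)) x =
        conn (fun y => conn W y (V y)) x + conn (fun y => conn W' y (V y)) x := by
    intro V hV
    have h1 : ∀ᶠ y in 𝓝 x, conn (W + W') y (V y) =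
        ((fun y => conn W y (V y)) + fun y => conn W' y (V y)) y := by
      filter_upwards [hW.eventually, hW'.eventually] with y hy hy'
      rw [conn.isCovariantDerivativeOn.add hy.mdifferentiableAt hy'.mdifferentiableAt]
      rfl
    rw [(conn_eventuallyEq ((hV.covDeriv hW).add (hV.covDeriv hW')) h1).self_of_nhds,
      conn.isCovariantDerivativeOn.add (hV.covDeriv hW).mdifferentiableAt
        (hV.covDeriv hW').mdifferentiableAt]
  rw [curvatureOp, key hU, key hV, conn.isCovariantDerivativeOn.add hW.mdifferentiableAt
    hW'.mdifferentiableAt]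
  simp [curvatureOp]
  module

lemma curvatureOp_congr_right (hU : SmoothNear x U) (hV : SmoothNear x V) (hW : SmoothNear x W)
    (h : ∀ᶠ y in 𝓝 x, W' y = W y) : curvatureOp conn U V W' x = curvatureOp conn U V W x := by
  have h1 := conn_eventuallyEq (conn := conn) hW h
  have key : ∀ {V : (y : M) → TangentSpace I y}, SmoothNear x V →
      conn (fun y => conn W' y (V y)) x = conn (fun y => conn W y (V y)) x := by
    intro V hV
    exact (conn_eventuallyEq (hV.covDeriv hW) (h1.mono fun y hy => by rw [hy])).self_of_nhds
  rw [curvatureOp, key hU, key hV, h1.self_of_nhds, curvatureOp]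

section Riemannian

variable [RiemannianBundle (fun x : M ↦ TangentSpace I x)]
  [IsContMDiffRiemannianBundle I ∞ E (fun x : M ↦ TangentSpace I x)]

omit [FiniteDimensional ℝ E] [T2Space M] in
lemma contMDiffAt_inner (hV : CMDiffAt ∞ (T% V) x) (hW : CMDiffAt ∞ (T% W) x) :
    CMDiffAt ∞ (fun y => inner ℝ (V y) (W y)) x :=
  ContMDiffAt.inner_bundle (E := fun x : M ↦ TangentSpace I x) (F := E) (IB := I) (b := id) hV hW

/-- By the Leibniz rule `(V f) W = ∇_V (f W) - f ∇_V W`. Pairing with a nonvanishing `W` exhibits `V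
f` as a quotient of smooth functions. -/
lemma mdifferentiableAt_mvfderiv (conn : CovariantDerivative I E (fun x : M ↦ TangentSpace I x))
    [conn.ContMDiffCovariantDerivative ∞] (hV : SmoothNear x V) (hf : ∀ᶠ y in 𝓝 x, CMDiffAt ∞ f y) :
    MDiffAt (fun y => d% f y (V y)) x := by
  -- In dimension zero no nonvanishing `W` exists, but then `V f` is zero.
  rcases subsingleton_or_nontrivial E with hE | hE
  · have h : (fun y => d% f y (V y)) = fun _ => 0 := funext fun y => by
      rw [show V y = 0 from Subsingleton.elim (α := E) _ _, map_zero]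
    rw [h]
    exact mdifferentiableAt_const
  · have : Nontrivial (TangentSpace I x) := hE
    obtain ⟨e, he⟩ := exists_ne (0 : TangentSpace I x)
    have hW := smoothNear_extend (I := I) (x := x) e
    set W : (y : M) → TangentSpace I y := FiberBundle.extend E e with hWdef
    have hWx : W x ≠ 0 := by rwa [hWdef, FiberBundle.extend_apply_self]
    have h1 : ∀ᶠ y in 𝓝 x, d% f y (V y) =
        inner ℝ (conn (f • W) y (V y) - f y • conn W y (V y)) (W y) / inner ℝ (W y) (W y) := by
      have hc := (contMDiffAt_inner hW.contMDiffAt hW.contMDiffAt).continuousAt.eventually_ne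
        (inner_self_ne_zero (𝕜 := ℝ).2 hWx)
      filter_upwards [hc, hW.eventually, hf] with y hy hy' hfy
      rw [conn.isCovariantDerivativeOn.leibniz hy'.mdifferentiableAt
        (hfy.mdifferentiableAt (by simp)), eq_div_iff hy]
      simp [inner_smul_left]
    have h2 : CMDiffAt ∞ (T% (fun y => conn (f • W) y (V y) - f y • conn W y (V y))) x :=
      (hV.covDeriv (hW.smul hf)).contMDiffAt.sub_section
        (hf.self_of_nhds.smul_section (hV.covDeriv hW).contMDiffAt)
    exact (((contMDiffAt_inner h2 hW.contMDiffAt).div₀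
      (contMDiffAt_inner hW.contMDiffAt hW.contMDiffAt)
      (inner_self_ne_zero (𝕜 := ℝ).2 hWx)).congr_of_eventuallyEq h1).mdifferentiableAt (by simp)

/-- The terms with one derivative of `f` are symmetric in `U` and `V` or cancel against the bracket
term. The rest is the commutator identity applied to `f`. -/
lemma curvatureOp_smul_right (hU : SmoothNear x U) (hV : SmoothNear x V) (hW : SmoothNear x W)
    (hf : ∀ᶠ y in 𝓝 x, CMDiffAt ∞ f y) :
    curvatureOp conn U V (f • W) x = f x • curvatureOp conn U V W x := by
  have hfd : ∀ᶠ y in 𝓝 x, MDiffAt f y := hf.mono fun y hy => hy.mdifferentiableAt (by simp)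
  have hfU := mdifferentiableAt_mvfderiv conn hU hf
  have hfV := mdifferentiableAt_mvfderiv conn hV hf
  have key : ∀ {U V : (y : M) → TangentSpace I y}, SmoothNear x U → SmoothNear x V →
      MDiffAt (fun y => d% f y (V y)) x →
      conn (fun y => conn (f • W) y (V y)) x (U x) =
        f x • conn (fun y => conn W y (V y)) x (U x) + d% f x (U x) • conn W x (V x) +
          (d% f x (V x) • conn W x (U x) + d% (fun y => d% f y (V y)) x (U x) • W x) := by
    intro U V hU hV hfV
    have h1 : ∀ᶠ y in 𝓝 x, conn (f • W) y (V y) =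
        (f • (fun y => conn W y (V y)) + (fun y => d% f y (V y)) • W) y := by
      filter_upwards [hfd, hW.eventually] with y hy hy'
      rw [conn.isCovariantDerivativeOn.leibniz hy'.mdifferentiableAt hy]
      simp
    have h2 := hV.covDeriv (conn := conn) (hW.smul hf)
    have h3 : MDiffAt (T% (f • (fun y => conn W y (V y)) + (fun y => d% f y (V y)) • W)) x :=
      mdifferentiableAt_add_section
        (hfd.self_of_nhds.smul_section (hV.covDeriv hW).mdifferentiableAt)
        (hfV.smul_section hW.mdifferentiableAt)
    rw [conn.isCovariantDerivativeOn.congr_of_eventuallyEq (s := Set.univ) h2.mdifferentiableAt h3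
      Filter.univ_mem h1, conn.isCovariantDerivativeOn.add
        (hfd.self_of_nhds.smul_section (hV.covDeriv hW).mdifferentiableAt)
        (hfV.smul_section hW.mdifferentiableAt),
      conn.isCovariantDerivativeOn.leibniz (hV.covDeriv hW).mdifferentiableAt hfd.self_of_nhds,
      conn.isCovariantDerivativeOn.leibniz hW.mdifferentiableAt hfV]
    simp
  have h0 := mvfderiv_commutator_smul hU hV hW hf hfU hfV
  rw [sub_smul, sub_smul] at h0
  rw [curvatureOp, key hU hV hfV, key hV hU hfU,
    conn.isCovariantDerivativeOn.leibniz hW.mdifferentiableAt hfd.self_of_nhds, curvatureOp,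
    ← sub_eq_zero, ← h0]
  simp
  module

end Riemannian

end CurvatureOp


/-! ### The curvature tensor -/

section Tensoriality

open VectorField
open scoped Topology

variable {E : Type*} [NormedAddCommGroup E] [NormedSpace ℝ E] [FiniteDimensional ℝ E]
  {H : Type*} [TopologicalSpace H] {I : ModelWithCorners ℝ E H}
  {M : Type*} [TopologicalSpace M] [ChartedSpace H M] [IsManifold I ∞ M] [T2Space M]
  [RiemannianBundle (fun x : M ↦ TangentSpace I x)]
  [IsContMDiffRiemannianBundle I ∞ E (fun x : M ↦ TangentSpace I x)]
  {conn : CovariantDerivative I E (fun x : M ↦ TangentSpace I x)}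
  [conn.ContMDiffCovariantDerivative ∞]
  {x : M} {U V W U' V' W' : (y : M) → TangentSpace I y}

lemma curvatureOp_sum_smul {ι : Type*} (s : Finset ι) {f : ι → M → ℝ}
    {W : ι → (y : M) → TangentSpace I y} (hU : SmoothNear x U) (hV : SmoothNear x V)
    (hf : ∀ i, ∀ᶠ y in 𝓝 x, CMDiffAt ∞ (f i) y) (hW : ∀ i, SmoothNear x (W i)) :
    curvatureOp conn U V (fun y => ∑ i ∈ s, f i y • W i y) x =
      ∑ i ∈ s, f i x • curvatureOp conn U V (W i) x := by
  classical
  induction s using Finset.induction_on with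
  | empty =>
    have h : (fun y => ∑ i ∈ (∅ : Finset ι), f i y • W i y) = 0 := funext fun y => by simp
    have h' : (fun y : M => (0 : TangentSpace I y)) = 0 := rfl
    rw [h, Finset.sum_empty, curvatureOp]
    simp [h']
  | insert a s ha ih =>
    have h : (fun y => ∑ i ∈ insert a s, f i y • W i y) =
        f a • W a + fun y => ∑ i ∈ s, f i y • W i y := funext fun y => by
      rw [Finset.sum_insert ha]
      rfl
    have hsum : SmoothNear x fun y => ∑ i ∈ s, f i y • W i y :=
      SmoothNear.sum (W := fun i => f i • W i) fun i => (hW i).smul (hf i)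
    rw [h, curvatureOp_add_right hU hV ((hW a).smul (hf a))
      hsum, ih, curvatureOp_smul_right hU hV (hW a) (hf a),
      Finset.sum_insert ha]

/-- The curvature operator is tensorial. -/
lemma curvatureOp_congr (hU : SmoothNear x U) (hV : SmoothNear x V) (hW : SmoothNear x W)
    (hU' : SmoothNear x U') (hV' : SmoothNear x V') (hW' : SmoothNear x W')
    (h1 : U x = U' x) (h2 : V x = V' x) (h3 : W x = W' x) :
    curvatureOp conn U V W x = curvatureOp conn U' V' W' x := by
  let t := trivializationAt E (fun x : M ↦ TangentSpace I x) x
  have hx : x ∈ t.baseSet := FiberBundle.mem_baseSet_trivializationAt' x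
  have ht : ∀ᶠ y in 𝓝 x, y ∈ t.baseSet := t.open_baseSet.mem_nhds hx
  let b := finBasis ℝ E
  have hs : ∀ i, SmoothNear x (t.localFrame b i) := fun i =>
    ht.mono fun y hy => contMDiffAt_localFrame_of_mem ∞ t b i hy
  -- Near `x` the field `W` is a combination of a local frame with smooth coefficients, so only the
  -- coefficients at `x` enter.
  have key : ∀ {W : (y : M) → TangentSpace I y}, SmoothNear x W → curvatureOp conn U V W x =
      ∑ i, t.localFrameCoeff I b i x (W x) • curvatureOp conn U V (t.localFrame b i) x := by
    intro W hW
    have hc : ∀ i, ∀ᶠ y in 𝓝 x, CMDiffAt ∞ (fun y => t.localFrameCoeff I b i y (W y)) y := by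
      intro i
      filter_upwards [ht, hW] with y hy hy' using contMDiffAt_localFrameCoeff b hy hy' i
    rw [← curvatureOp_sum_smul Finset.univ hU hV hc hs]
    exact curvatureOp_congr_right hU hV (SmoothNear.sum fun i => (hs i).smul (hc i))
      (t.eventually_eq_localFrame_sum_coeff_smul b hx)
  rw [key hW, h3, ← key hW']
  exact curvatureOp_congr_left hU.mdifferentiableAt hU'.mdifferentiableAt hV.mdifferentiableAt
    hV'.mdifferentiableAt hW' h1 h2

/-- The curvature operator of a metric connection is skew-symmetric. -/
lemma inner_curvatureOp_self
    (hmet : ∀ {x : M} (X : (y : M) → TangentSpace I y) {σ τ : (y : M) → TangentSpace I y},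
      MDiffAt (T% σ) x → MDiffAt (T% τ) x → d% (fun y => inner ℝ (σ y) (τ y)) x (X x) =
        inner ℝ (conn σ x (X x)) (τ x) + inner ℝ (σ x) (conn τ x (X x)))
    (hU : SmoothNear x U) (hV : SmoothNear x V) (hW : SmoothNear x W) :
    inner ℝ (curvatureOp conn U V W x) (W x) = 0 := by
  rcases eq_or_ne (W x) 0 with h0 | h0
  · rw [h0, inner_zero_right]
  have hf : ∀ᶠ y in 𝓝 x, CMDiffAt ∞ (fun y => inner ℝ (W y) (W y)) y := by
    filter_upwards [hW] with y hy using contMDiffAt_inner hy hy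
  -- The commutator identity for `|W|²` carries the factor `W x`, which can be dropped because it is
  -- nonzero here.
  have h1 := (smul_eq_zero.1 (mvfderiv_commutator_smul hU hV hW hf
    (mdifferentiableAt_mvfderiv conn hU hf) (mdifferentiableAt_mvfderiv conn hV hf))).resolve_right
      h0
  -- The second derivative of `|W|²` has a part symmetric in `U` and `V`, which disappears in the
  -- commutator and leaves twice the curvature term.
  have key : ∀ {U V : (y : M) → TangentSpace I y}, SmoothNear x U → SmoothNear x V →
      d% (fun y => d% (fun y => inner ℝ (W y) (W y)) y (V y)) x (U x) =
        2 * inner ℝ (conn (fun y => conn W y (V y)) x (U x)) (W x) +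
          2 * inner ℝ (conn W x (V x)) (conn W x (U x)) := by
    intro U V hU hV
    have hVW := hV.covDeriv (conn := conn) hW
    have h2 : (fun y => d% (fun y => inner ℝ (W y) (W y)) y (V y)) =ᶠ[𝓝 x]
        (fun y => inner ℝ (conn W y (V y)) (W y) + inner ℝ (conn W y (V y)) (W y)) := by
      filter_upwards [hW.eventually] with y hy
      rw [hmet V hy.mdifferentiableAt hy.mdifferentiableAt, real_inner_comm (W y)]
    have h3 : MDiffAt (fun y => inner ℝ (conn W y (V y)) (W y)) x :=
      (contMDiffAt_inner hVW.contMDiffAt hW.contMDiffAt).mdifferentiableAt (by simp)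
    have h4 : d% (fun y => d% (fun y => inner ℝ (W y) (W y)) y (V y)) x =
        d% (fun y => inner ℝ (conn W y (V y)) (W y) + inner ℝ (conn W y (V y)) (W y)) x :=
      ContinuousLinearMap.ext fun v =>
        congrArg (fun L : TangentSpace I x →L[ℝ] ℝ => L v) h2.mfderiv_eq
    rw [h4, mvfderiv_fun_add h3 h3, add_apply,
      hmet U hVW.mdifferentiableAt hW.mdifferentiableAt]
    ring
  rw [key hU hV, key hV hU, hmet _ hW.mdifferentiableAt hW.mdifferentiableAt,
    real_inner_comm (conn W x (V x)), real_inner_comm (conn W x _) (W x)] at h1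
  rw [curvatureOp, inner_sub_left, inner_sub_left]
  linarith

end Tensoriality

/-! ### The curvature tensor of a Riemannian manifold -/

section Curvature

variable {n : ℕ} {M : Type*} [TopologicalSpace M] [T2Space M]
  [ChartedSpace (EuclideanSpace ℝ (Fin n)) M] [IsManifold (𝓡 n) ∞ M]
  [RiemannianBundle (fun x : M ↦ TangentSpace (𝓡 n) x)]
  [IsContMDiffRiemannianBundle (𝓡 n) ∞ (EuclideanSpace ℝ (Fin n))
    (fun x : M ↦ TangentSpace (𝓡 n) x)]
  {conn : Connection (n := n) M} [conn.ContMDiffCovariantDerivative ∞] {x : M}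

/-- By tensoriality the extensions in the definition may be replaced by any fields smooth near the
point, such as linear combinations of extensions or local frames. -/
lemma curvature_eq_curvatureOp {U V W : (y : M) → TangentSpace (𝓡 n) y}
    (hU : SmoothNear x U) (hV : SmoothNear x V) (hW : SmoothNear x W) :
    curvature conn x (U x) (V x) (W x) = curvatureOp conn U V W x :=
  curvatureOp_congr (smoothNear_extend _) (smoothNear_extend _) (smoothNear_extend _) hU hV hW
    (FiberBundle.extend_apply_self _ _) (FiberBundle.extend_apply_self _ _)
    (FiberBundle.extend_apply_self _ _)

variable (conn x) in
omit [T2Space M] [RiemannianBundle (fun x : M ↦ TangentSpace (𝓡 n) x)]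
  [IsContMDiffRiemannianBundle (𝓡 n) ∞ (EuclideanSpace ℝ (Fin n))
    (fun x : M ↦ TangentSpace (𝓡 n) x)] [conn.ContMDiffCovariantDerivative ∞] in
lemma curvature_swap (u v w : TangentSpace (𝓡 n) x) :
    curvature conn x u v w = -curvature conn x v u w :=
  curvatureOp_swap conn _ _ _

lemma curvature_smul_add_right (a : ℝ) (u v w w' : TangentSpace (𝓡 n) x) :
    curvature conn x u v (a • w + w') = a • curvature conn x u v w + curvature conn x u v w' := by
  have hU := smoothNear_extend (I := 𝓡 n) u
  have hV := smoothNear_extend (I := 𝓡 n) v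
  have hW := smoothNear_extend (I := 𝓡 n) w
  have hW' := smoothNear_extend (I := 𝓡 n) w'
  have ha : ∀ᶠ y in nhds x, ContMDiffAt (𝓡 n) 𝓘(ℝ, ℝ) ∞ (fun _ : M => a) y :=
    Filter.Eventually.of_forall fun y => contMDiffAt_const
  have h := curvature_eq_curvatureOp (conn := conn) hU hV ((hW.smul ha).add hW')
  rw [curvatureOp_add_right hU hV (hW.smul ha) hW', curvatureOp_smul_right hU hV hW ha] at h
  simp only [Pi.add_apply, Pi.smul_apply', FiberBundle.extend_apply_self] at h
  exact h

lemma curvature_smul_add_left (a : ℝ) (u u' v w : TangentSpace (𝓡 n) x) :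
    curvature conn x (a • u + u') v w = a • curvature conn x u v w + curvature conn x u' v w := by
  have hU := smoothNear_extend (I := 𝓡 n) u
  have hV := smoothNear_extend (I := 𝓡 n) v
  have hW := smoothNear_extend (I := 𝓡 n) w
  have hU' := smoothNear_extend (I := 𝓡 n) u'
  have ha : ∀ᶠ y in nhds x, ContMDiffAt (𝓡 n) 𝓘(ℝ, ℝ) ∞ (fun _ : M => a) y :=
    Filter.Eventually.of_forall fun y => contMDiffAt_const
  have h := curvature_eq_curvatureOp (conn := conn) ((hU.smul ha).add hU') hV hW
  have ht := tensorialAt_curvatureOp (conn := conn) (x := x)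
    (V := FiberBundle.extend (EuclideanSpace ℝ (Fin n)) v) hW
  rw [ht.add (hU.smul ha).mdifferentiableAt hU'.mdifferentiableAt,
    ht.smul (ha.self_of_nhds.mdifferentiableAt (by simp)) hU.mdifferentiableAt] at h
  simp only [Pi.add_apply, Pi.smul_apply', FiberBundle.extend_apply_self] at h
  exact h

lemma curvature_smul_add_middle (a : ℝ) (u v v' w : TangentSpace (𝓡 n) x) :
    curvature conn x u (a • v + v') w = a • curvature conn x u v w + curvature conn x u v' w := by
  rw [curvature_swap conn x u, curvature_smul_add_left, curvature_swap conn x v,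
    curvature_swap conn x v']
  module

/-- The curvature tensor as an endomorphism of the tangent space. -/
def curvatureEnd (conn : Connection (n := n) M) [conn.ContMDiffCovariantDerivative ∞] (x : M)
    (u v : TangentSpace (𝓡 n) x) : Module.End ℝ (TangentSpace (𝓡 n) x) where
  toFun w := curvature conn x u v w
  map_add' w w' := by simpa using curvature_smul_add_right (conn := conn) 1 u v w w'
  map_smul' a w := by
    have h0 : curvature conn x u v 0 = 0 := by
      simpa using curvature_smul_add_right (conn := conn) 1 u v 0 0
    simpa [h0] using curvature_smul_add_right (conn := conn) a u v w 0

/-- The curvature of a metric connection is skew-adjoint. -/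
lemma adjoint_curvatureEnd (hmet : conn.IsMetricCompatible) (u v : TangentSpace (𝓡 n) x) :
    LinearMap.adjoint (curvatureEnd conn x u v) = -curvatureEnd conn x u v := by
  have h0 : ∀ w, inner ℝ (curvatureEnd conn x u v w) w = 0 := by
    intro w
    have hW := smoothNear_extend (I := 𝓡 n) w
    have h := inner_curvatureOp_self (conn := conn) (fun X σ τ => hmet.mvfderiv_inner_eq X)
      (smoothNear_extend (I := 𝓡 n) u) (smoothNear_extend (I := 𝓡 n) v) hW
    rwa [FiberBundle.extend_apply_self] at h
  refine ((LinearMap.eq_adjoint_iff _ _).2 fun w w' => ?_).symm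
  -- Polarization of the vanishing quadratic form.
  have h := h0 (w + w')
  rw [map_add, inner_add_left, inner_add_right, inner_add_right, h0, h0] at h
  rw [LinearMap.neg_apply, inner_neg_left, real_inner_comm (curvatureEnd conn x u v w')] at *
  linarith

end Curvature


/-! ### Finiteness of the algebras of forms -/

section Finite

variable (T : Type*) [NormedAddCommGroup T] [InnerProductSpace ℝ T] [FiniteDimensional ℝ T]

lemma finite_exteriorAlgebra_dual : Module.Finite ℝ (ExteriorAlgebra ℝ (Module.Dual ℝ T)) := by
  have h1 : (⨆ k, degreeForms T k) = ⊤ :=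
    (DirectSum.Decomposition.isInternal
      (fun k => (⋀[ℝ]^k (Module.Dual ℝ T) : Submodule ℝ (ExteriorAlgebra ℝ (Module.Dual ℝ T)))
      )).submodule_iSup_eq_top
  have h2 : (⨆ k ∈ Finset.range (finrank ℝ T + 1), degreeForms T k) = ⊤ := by
    rw [eq_top_iff, ← h1]
    refine iSup_le fun k => ?_
    rcases lt_or_ge (finrank ℝ T) k with hk | hk
    · rw [degreeForms_eq_bot hk]
      exact bot_le
    · exact le_biSup (fun k => degreeForms T k) (Finset.mem_range.2 (Nat.lt_succ_of_le hk))
  refine ⟨?_⟩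
  rw [← h2]
  refine Submodule.fg_biSup _ _ fun k _ => ?_
  rw [← Module.Finite.iff_fg]
  exact inferInstanceAs (Module.Finite ℝ (⋀[ℝ]^k (Module.Dual ℝ T)))

instance finite_real_forms : Module.Finite ℝ (Forms T) :=
  have := finite_exteriorAlgebra_dual T
  inferInstanceAs (Module.Finite ℝ (ℂ ⊗[ℝ] ExteriorAlgebra ℝ (Module.Dual ℝ T)))

instance finite_complex_forms : Module.Finite ℂ (Forms T) :=
  Module.Finite.of_restrictScalars_finite ℝ ℂ _

instance finite_complex_coeff : Module.Finite ℂ (Coeff (Forms T) T) := by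
  let e := finBasis ℝ (Module.End ℝ T)
  let g : (Fin (finrank ℝ (Module.End ℝ T)) → Forms T) →ₗ[ℂ] Coeff (Forms T) T :=
    { toFun := fun f => ∑ j, Coeff.tmul (f j) (e j)
      map_add' := fun f f' => by
        rw [← Finset.sum_add_distrib]
        exact Finset.sum_congr rfl fun j _ => TensorProduct.add_tmul _ _ _
      map_smul' := fun z f => by
        rw [RingHom.id_apply, Finset.smul_sum]
        exact Finset.sum_congr rfl fun j _ => (Coeff.smul_tmul _ _ _).symm }
  refine Module.Finite.of_surjective g fun A => ?_
  induction A using Coeff.induction with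
  | zero => exact ⟨0, map_zero g⟩
  | tmul x φ =>
    let _ : SMul ℝ (Forms T) := Algebra.toSMul
    refine ⟨fun j => e.repr φ j • x, ?_⟩
    have h : Coeff.tmul x φ = ∑ j, Coeff.tmul x (e.repr φ j • e j) := by
      conv_lhs => rw [← e.sum_repr φ]
      exact map_sum (TensorProduct.mk ℝ (Forms T) (Module.End ℝ T) x) _ _
    rw [h]
    change ∑ j, Coeff.tmul (e.repr φ j • x) (e j) = _
    refine Finset.sum_congr rfl fun j _ => ?_
    exact TensorProduct.smul_tmul (R := ℝ) (M := Forms T) (N := Module.End ℝ T) (e.repr φ j) x (e j)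
  | add A B hA hB =>
    obtain ⟨f, rfl⟩ := hA
    obtain ⟨f', rfl⟩ := hB
    exact ⟨f + f', map_add g _ _⟩

end Finite

/-! ### The curvature form in an arbitrary basis -/

section Basis

/-- The sum `∑ e^i ⊗ e_i` is the identity of `T` and does not depend on the basis. It is needed
because trivializations do not preserve the basis used to define the curvature form. -/
lemma sum_coord_eq {T X ι ι' : Type*} [AddCommGroup T] [Module ℝ T] [AddCommGroup X] [Module ℝ X]
    [Fintype ι] [Fintype ι'] (b : Basis ι ℝ T) (b' : Basis ι' ℝ T)
    (g : Module.Dual ℝ T →ₗ[ℝ] T →ₗ[ℝ] X) :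
    ∑ i, g (b.coord i) (b i) = ∑ j, g (b'.coord j) (b' j) := by
  have h1 : ∀ i, g (b.coord i) (b i) = ∑ j, b'.coord j (b i) • g (b.coord i) (b' j) := fun i => by
    conv_lhs => rw [← b'.sum_repr (b i), map_sum]
    simp
  have h2 : ∀ j, ∑ i, b'.coord j (b i) • b.coord i = b'.coord j := fun j => by
    classical
    refine b.ext fun k => ?_
    simp [LinearMap.sum_apply, Finsupp.single_apply]
  rw [Finset.sum_congr rfl fun i _ => h1 i, Finset.sum_comm]
  refine Finset.sum_congr rfl fun j _ => ?_
  conv_rhs => rw [← h2 j, map_sum, LinearMap.sum_apply]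
  simp

variable {T : Type*} [NormedAddCommGroup T] [InnerProductSpace ℝ T]

/-- The `End T`-valued form `½ ∑ R (e_i, e_j) θ^i θ^j` in the basis `e`. -/
def curvatureFormIn {ι : Type*} [Fintype ι] (b : Basis ι ℝ T)
    (R : T →ₗ[ℝ] T →ₗ[ℝ] Module.End ℝ T) : Coeff (Forms T) T :=
  ∑ i, ∑ j, Coeff.tmul (realForm ((2⁻¹ : ℝ) • (ExteriorAlgebra.ι ℝ (b.coord i) *
    ExteriorAlgebra.ι ℝ (b.coord j)))) (R (b i) (b j))

lemma curvatureForm_eq_curvatureFormIn [FiniteDimensional ℝ T] {R : T → T → T → T}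
    {R' : T →ₗ[ℝ] T →ₗ[ℝ] Module.End ℝ T} (h : ∀ u v w, R' u v w = R u v w) :
    curvatureForm R = curvatureFormIn (finBasis ℝ T) R' := by
  rw [curvatureForm, curvatureFormIn]
  refine Finset.sum_congr rfl fun i _ => Finset.sum_congr rfl fun j _ => ?_
  congr 1
  refine (finBasis ℝ T).ext fun k => ?_
  rw [Basis.constr_basis, h]

/-- The bilinear map `(α, u) ↦ L α ⊗ G u`. -/
def tmulBilin {X : Type*} [AddCommGroup X] [Module ℝ X]
    (L : X →ₗ[ℝ] ExteriorAlgebra ℝ (Module.Dual ℝ T)) (G : T →ₗ[ℝ] Module.End ℝ T) :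
    X →ₗ[ℝ] T →ₗ[ℝ] Coeff (Forms T) T :=
  (TensorProduct.mk ℝ (Forms T) (Module.End ℝ T)).compl₁₂ ((realFormHom T).toLinearMap ∘ₗ L) G

lemma curvatureFormIn_eq {ι ι' : Type*} [Fintype ι] [Fintype ι'] (b : Basis ι ℝ T)
    (b' : Basis ι' ℝ T) (R : T →ₗ[ℝ] T →ₗ[ℝ] Module.End ℝ T) :
    curvatureFormIn b R = curvatureFormIn b' R := by
  let ε := ExteriorAlgebra.ι ℝ (M := Module.Dual ℝ T)
  -- The two summation indices are changed one after the other, each time with the other index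
  -- fixed.
  have h1 : ∀ j, ∑ i, tmulBilin ((2⁻¹ : ℝ) • (LinearMap.mulRight ℝ (ε (b.coord j)) ∘ₗ ε))
      (R.flip (b j)) (b.coord i) (b i) = ∑ i, tmulBilin
        ((2⁻¹ : ℝ) • (LinearMap.mulRight ℝ (ε (b.coord j)) ∘ₗ ε)) (R.flip (b j)) (b'.coord i)
          (b' i) := fun j => sum_coord_eq b b' _
  have h2 : ∀ i, ∑ j, tmulBilin ((2⁻¹ : ℝ) • (LinearMap.mulLeft ℝ (ε (b'.coord i)) ∘ₗ ε))
      (R (b' i)) (b.coord j) (b j) = ∑ j, tmulBilin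
        ((2⁻¹ : ℝ) • (LinearMap.mulLeft ℝ (ε (b'.coord i)) ∘ₗ ε)) (R (b' i)) (b'.coord j)
          (b' j) := fun i => sum_coord_eq b b' _
  rw [curvatureFormIn, curvatureFormIn, Finset.sum_comm]
  refine (Finset.sum_congr rfl fun j _ => h1 j).trans ?_
  rw [Finset.sum_comm]
  exact Finset.sum_congr rfl fun i _ => h2 i

end Basis

/-! ### Change of the fibre -/

section ChangeOfFibre

/-- The algebra homomorphism between coefficient algebras induced by homomorphisms of the
factors. -/
def Coeff.mapHom {S S' T T' : Type*} [Ring S] [Algebra ℝ S] [Ring S'] [Algebra ℝ S']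
    [AddCommGroup T] [Module ℝ T] [AddCommGroup T'] [Module ℝ T'] (f : S →ₐ[ℝ] S')
    (g : Module.End ℝ T →ₐ[ℝ] Module.End ℝ T') : Coeff S T →ₐ[ℝ] Coeff S' T' :=
  (Algebra.TensorProduct.map f g : S ⊗[ℝ] Module.End ℝ T →ₐ[ℝ] S' ⊗[ℝ] Module.End ℝ T')

variable {T T' : Type*} [NormedAddCommGroup T] [InnerProductSpace ℝ T]
  [NormedAddCommGroup T'] [InnerProductSpace ℝ T'] (φ : T ≃ₗ[ℝ] T')

/-- The pull-back of forms along the inverse of a linear isomorphism. -/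
def pushForms : Forms T →ₐ[ℂ] Forms T' := mapForms φ.symm.toLinearMap.dualMap

/-- The transport of coefficients along a linear isomorphism. -/
def pushCoeff : Coeff (Forms T) T →ₐ[ℝ] Coeff (Forms T') T' :=
  Coeff.mapHom ((pushForms φ).restrictScalars ℝ) (φ.conjAlgEquiv ℝ).toAlgHom

lemma pushCoeff_tmul (a : Forms T) (ψ : Module.End ℝ T) :
    pushCoeff φ (Coeff.tmul a ψ) = Coeff.tmul (pushForms φ a) (φ.conj ψ) := rfl

lemma coeffTrace_pushCoeff (A : Coeff (Forms T) T) :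
    coeffTrace (Forms T') T' (pushCoeff φ A) = pushForms φ (coeffTrace (Forms T) T A) := by
  induction A using Coeff.induction with
  | zero => simp
  | tmul a ψ =>
    rw [pushCoeff_tmul, coeffTrace_tmul, coeffTrace_tmul, LinearMap.trace_conj']
    exact (map_smul ((pushForms φ).restrictScalars ℝ) _ _).symm
  | add A B hA hB => rw [map_add, map_add, map_add, map_add, hA, hB]

lemma pushCoeff_curvatureFormIn {ι : Type*} [Fintype ι] (b : Basis ι ℝ T)
    (R : T →ₗ[ℝ] T →ₗ[ℝ] Module.End ℝ T) (R' : T' →ₗ[ℝ] T' →ₗ[ℝ] Module.End ℝ T')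
    (h : ∀ u v, R' (φ u) (φ v) = φ.conj (R u v)) :
    pushCoeff φ (curvatureFormIn b R) = curvatureFormIn (b.map φ) R' := by
  have hc : ∀ i, φ.symm.toLinearMap.dualMap (b.coord i) = (b.map φ).coord i := fun i => by
    ext v
    simp
  rw [curvatureFormIn, map_sum, curvatureFormIn]
  refine Finset.sum_congr rfl fun i _ => ?_
  rw [map_sum]
  refine Finset.sum_congr rfl fun j _ => ?_
  rw [pushCoeff_tmul, pushForms, mapForms_realForm, map_smul, map_mul, ExteriorAlgebra.map_apply_ι,
    ExteriorAlgebra.map_apply_ι, hc, hc, Basis.map_apply, Basis.map_apply, h]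

lemma pushForms_tauForm (r : ℝ) (F : Coeff (Forms T) T) :
    pushForms φ (tauForm r F) = tauForm r (pushCoeff φ F) := by
  rw [tauForm, map_sum, tauForm, φ.finrank_eq]
  refine Finset.sum_congr rfl fun e _ => ?_
  rw [map_smul, ← coeffTrace_pushCoeff, map_pow]

lemma pushForms_expTau [FiniteDimensional ℝ T] {F : Coeff (Forms T) T} (hF : F ∈ degreeCoeff T 2)
    (r : ℝ) (z : ℂ) : pushForms φ (expTau r F z) = expTau r (pushCoeff φ F) z := by
  rw [expTau, map_nilEval _ _ ((isNilpotent_tauForm hF r).smul z), map_smul, pushForms_tauForm,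
    expTau]

end ChangeOfFibre

/-! ### Smooth families in finite-dimensional spaces -/

section SmoothFamily

variable {E : Type*} [NormedAddCommGroup E] [NormedSpace ℝ E] {H : Type*} [TopologicalSpace H]
  {I : ModelWithCorners ℝ E H} {P : Type*} [TopologicalSpace P] [ChartedSpace H P] {s : Set P}
  {X Y Z : Type*} [AddCommGroup X] [Module ℂ X] [AddCommGroup Y] [Module ℂ Y]
  [AddCommGroup Z] [Module ℂ Z]

variable (I s) in
/-- A map to a finite-dimensional space whose composition with all linear functionals is smooth. -/
def SmoothFamily (g : P → X) : Prop :=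
  ∀ l : X →ₗ[ℂ] ℂ, ContMDiffOn I 𝓘(ℝ, ℂ) ∞ (fun p => l (g p)) s

lemma SmoothFamily.map {g : P → X} (hg : SmoothFamily I s g) (L : X →ₗ[ℂ] Y) :
    SmoothFamily I s fun p => L (g p) := fun l => hg (l ∘ₗ L)

lemma SmoothFamily.congr {g g' : P → X} (hg : SmoothFamily I s g) (h : ∀ p ∈ s, g' p = g p) :
    SmoothFamily I s g' := fun l => (hg l).congr fun p hp => by rw [h p hp]

lemma smoothFamily_const (x : X) : SmoothFamily I s fun _ : P => x := fun _ => contMDiffOn_const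

lemma SmoothFamily.sum {ι : Type*} {t : Finset ι} {g : ι → P → X}
    (hg : ∀ i ∈ t, SmoothFamily I s (g i)) : SmoothFamily I s fun p => ∑ i ∈ t, g i p := fun l => by
  simp only [map_sum]
  exact contMDiffOn_finsetSum fun i hi => hg i hi l

lemma SmoothFamily.smul {a : P → ℂ} (ha : ContMDiffOn I 𝓘(ℝ, ℂ) ∞ a s) {g : P → X}
    (hg : SmoothFamily I s g) : SmoothFamily I s fun p => a p • g p := fun l => by
  simp only [map_smul, smul_eq_mul]
  exact (contDiff_mul (𝕜 := ℝ) (𝔸 := ℂ)).contMDiff.comp_contMDiffOn (ha.prodMk_space (hg l))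

/-- Expanding the first argument in a basis reduces bilinear operations to scalar multiplication by
smooth functions. -/
lemma SmoothFamily.bilin [Module.Finite ℂ X] {g : P → X} {h : P → Y} (hg : SmoothFamily I s g)
    (hh : SmoothFamily I s h) (B : X →ₗ[ℂ] Y →ₗ[ℂ] Z) :
    SmoothFamily I s fun p => B (g p) (h p) := by
  have h1 : ∀ p, B (g p) (h p) =
      ∑ i, (finBasis ℂ X).coord i (g p) • B (finBasis ℂ X i) (h p) := fun p => by
    conv_lhs => rw [← (finBasis ℂ X).sum_repr (g p), map_sum, LinearMap.sum_apply]
    simp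
  simp only [h1]
  exact SmoothFamily.sum fun i _ => (hh.map _).smul (hg ((finBasis ℂ X).coord i))

lemma SmoothFamily.mul {A : Type*} [Ring A] [Algebra ℂ A] [Module.Finite ℂ A] {g h : P → A}
    (hg : SmoothFamily I s g) (hh : SmoothFamily I s h) : SmoothFamily I s fun p => g p * h p :=
  hg.bilin hh (LinearMap.mul ℂ A)

lemma SmoothFamily.pow {A : Type*} [Ring A] [Algebra ℂ A] [Module.Finite ℂ A] {g : P → A}
    (hg : SmoothFamily I s g) (k : ℕ) : SmoothFamily I s fun p => g p ^ k := by
  induction k with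
  | zero => simpa using smoothFamily_const _
  | succ k ih => simpa only [pow_succ] using ih.mul hg

end SmoothFamily

/-! ### Smoothness of the exponentials in the curvature form -/

section SmoothExp

variable {E : Type*} [NormedAddCommGroup E] [NormedSpace ℝ E] {H : Type*} [TopologicalSpace H]
  {I : ModelWithCorners ℝ E H} {P : Type*} [TopologicalSpace P] [ChartedSpace H P] {s : Set P}
  {T : Type*} [NormedAddCommGroup T] [InnerProductSpace ℝ T] [FiniteDimensional ℝ T]

/-- The trace as a complex-linear map. -/
def coeffTraceComplex (T : Type*) [NormedAddCommGroup T] [InnerProductSpace ℝ T] :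
    Coeff (Forms T) T →ₗ[ℂ] Forms T where
  toFun := coeffTrace (Forms T) T
  map_add' := map_add _
  map_smul' z A := coeffTrace_smul z A

/-- The exponent is a polynomial in `r` and `F`. The exponential is cut off at a degree independent
of the point, whereas the nilpotency class in `nilEval` may jump. -/
lemma smoothFamily_expTau {F : P → Coeff (Forms T) T} {r : P → ℝ}
    (hr : ContMDiffOn I 𝓘(ℝ, ℝ) ∞ r s) (hF : SmoothFamily I s F)
    (hF2 : ∀ p ∈ s, F p ∈ degreeCoeff T 2) (z : ℂ) :
    SmoothFamily I s fun p => expTau (r p) (F p) z := by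
  have hτ : SmoothFamily I s fun p => tauForm (r p) (F p) := by
    refine SmoothFamily.sum fun e _ => SmoothFamily.smul ?_ ((hF.pow e).map (coeffTraceComplex T))
    have h : ContMDiff 𝓘(ℝ, ℝ) 𝓘(ℝ, ℂ) ∞ fun t : ℝ => ((tauCoeff e * t ^ e : ℝ) : ℂ) :=
      (Complex.ofRealCLM.contDiff.comp (contDiff_const.mul (contDiff_id.pow e))).contMDiff
    exact h.comp_contMDiffOn hr
  refine SmoothFamily.congr (SmoothFamily.sum (t := Finset.range (finrank ℝ T + 1)) fun d _ =>
    ((hτ.map (z • LinearMap.id)).pow d).map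
      (PowerSeries.coeff d (PowerSeries.exp ℂ) • LinearMap.id)) fun p hp => ?_
  rw [expTau, nilEval_eq_sum _ (smul_tauForm_pow (hF2 p hp) (r p) z)]
  rfl

end SmoothExp


/-! ### Smoothness of the curvature form -/

section LocalFrame

variable {E : Type*} [NormedAddCommGroup E] [NormedSpace ℝ E]
  {H : Type*} [TopologicalSpace H] {I : ModelWithCorners ℝ E H}
  {M : Type*} [TopologicalSpace M] [ChartedSpace H M] [IsManifold I ∞ M]

variable (I) in
/-- The trivialization of the tangent bundle around `x₀`, at a point `x` near `x₀`. -/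
def fibreEquiv {x₀ x : M}
    (hx : x ∈ (trivializationAt E (fun y : M ↦ TangentSpace I y) x₀).baseSet) :
    TangentSpace I x ≃ₗ[ℝ] E :=
  ((trivializationAt E (fun y : M ↦ TangentSpace I y) x₀).continuousLinearEquivAt ℝ x
    hx).toLinearEquiv

variable (x₀ : M) {ι : Type*} (b : Basis ι ℝ E)

lemma smoothNear_localFrame {x : M}
    (hx : x ∈ (trivializationAt E (fun y : M ↦ TangentSpace I y) x₀).baseSet) (i : ι) :
    SmoothNear x ((trivializationAt E (fun y : M ↦ TangentSpace I y) x₀).localFrame b i) := by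
  filter_upwards [(trivializationAt E (fun y : M ↦ TangentSpace I y) x₀).open_baseSet.mem_nhds hx]
    with y hy using contMDiffAt_localFrame_of_mem ∞ _ b i hy

lemma localFrame_eq_fibreEquiv_symm {x : M}
    (hx : x ∈ (trivializationAt E (fun y : M ↦ TangentSpace I y) x₀).baseSet) (i : ι) :
    (trivializationAt E (fun y : M ↦ TangentSpace I y) x₀).localFrame b i x =
      (fibreEquiv I hx).symm (b i) := by
  rw [Trivialization.localFrame_apply_of_mem_baseSet _ _ hx]
  simp [Trivialization.basisAt, fibreEquiv]

variable [FiniteDimensional ℝ E] [T2Space M]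
  {conn : CovariantDerivative I E (fun x : M ↦ TangentSpace I x)}
  [conn.ContMDiffCovariantDerivative ∞]

lemma SmoothNear.curvatureOp {x : M} {U V W : (y : M) → TangentSpace I y} (hU : SmoothNear x U)
    (hV : SmoothNear x V) (hW : SmoothNear x W) : SmoothNear x (curvatureOp conn U V W) := by
  filter_upwards [hU.covDeriv (conn := conn) (hV.covDeriv (conn := conn) hW),
    hV.covDeriv (conn := conn) (hU.covDeriv (conn := conn) hW),
    (hU.mlieBracket hV).covDeriv (conn := conn) hW]
    with y h1 h2 h3 using (h1.sub_section h2).sub_section h3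

lemma contMDiffOn_coord_curvatureOp (i j k l : ι) :
    CMDiff[(trivializationAt E (fun y : M ↦ TangentSpace I y) x₀).baseSet] ∞ (fun y =>
      (trivializationAt E (fun y : M ↦ TangentSpace I y) x₀).localFrameCoeff I b l y
        (curvatureOp conn
          ((trivializationAt E (fun y : M ↦ TangentSpace I y) x₀).localFrame b i)
          ((trivializationAt E (fun y : M ↦ TangentSpace I y) x₀).localFrame b j)
          ((trivializationAt E (fun y : M ↦ TangentSpace I y) x₀).localFrame b k) y)) := by
  intro x hx
  exact (contMDiffAt_localFrameCoeff b hx ((smoothNear_localFrame x₀ b hx i).curvatureOp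
    (smoothNear_localFrame x₀ b hx j) (smoothNear_localFrame x₀ b hx k)).contMDiffAt
      l).contMDiffWithinAt

end LocalFrame

/-! ### Expansion of the curvature form into constant forms with scalar coefficients -/

section MatrixUnits

variable {T : Type*} [NormedAddCommGroup T] [InnerProductSpace ℝ T] {ι : Type*} [Fintype ι]

/-- The `End T`-valued two-form `½ β^i β^j ⊗ (β^k ⊗ β_l)` of a basis `β`. -/
def basicCurvature (b : Basis ι ℝ T) (i j k l : ι) : Coeff (Forms T) T :=
  Coeff.tmul (realForm ((2⁻¹ : ℝ) • (ExteriorAlgebra.ι ℝ (b.coord i) *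
    ExteriorAlgebra.ι ℝ (b.coord j)))) ((b.coord k).smulRight (b l))

lemma Coeff.tmul_smul_real {S T : Type*} [Ring S] [Algebra ℝ S] [AddCommGroup T] [Module ℝ T]
    (x : ℝ) (a : S) (φ : Module.End ℝ T) :
    Coeff.tmul a (x • φ) = Coeff.tmul (algebraMap ℝ S x * a) φ := by
  rw [← Algebra.smul_def]
  exact (TensorProduct.smul_tmul x a φ).symm

lemma Coeff.tmul_smul {S T : Type*} [Ring S] [Algebra ℝ S] [Algebra ℂ S] [IsScalarTower ℝ ℂ S]
    [AddCommGroup T] [Module ℝ T] (x : ℝ) (a : S) (φ : Module.End ℝ T) :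
    Coeff.tmul a (x • φ) = (x : ℂ) • Coeff.tmul a φ := by
  rw [Coeff.smul_tmul, Coeff.tmul_smul_real, IsScalarTower.algebraMap_apply ℝ ℂ S,
    ← Algebra.smul_def]
  rfl

lemma Coeff.tmul_sum {S T κ : Type*} [Ring S] [Algebra ℝ S] [AddCommGroup T] [Module ℝ T]
    [Fintype κ] (a : S) (φ : κ → Module.End ℝ T) :
    Coeff.tmul a (∑ k, φ k) = ∑ k, Coeff.tmul a (φ k) :=
  map_sum (TensorProduct.mk ℝ S (Module.End ℝ T) a) _ _

lemma curvatureFormIn_eq_sum (b : Basis ι ℝ T) (R : T →ₗ[ℝ] T →ₗ[ℝ] Module.End ℝ T) :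
    curvatureFormIn b R = ∑ i, ∑ j, ∑ k, ∑ l,
      (b.coord l (R (b i) (b j) (b k)) : ℂ) • basicCurvature b i j k l := by
  refine Finset.sum_congr rfl fun i _ => Finset.sum_congr rfl fun j _ => ?_
  have h : R (b i) (b j) = ∑ k, ∑ l, b.coord l (R (b i) (b j) (b k)) •
      (b.coord k).smulRight (b l) := by
    classical
    refine b.ext fun k => ?_
    simp [LinearMap.sum_apply, Finsupp.single_apply, ite_smul, b.sum_repr]
  conv_lhs => rw [h]
  rw [Coeff.tmul_sum]
  refine Finset.sum_congr rfl fun k _ => ?_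
  rw [Coeff.tmul_sum]
  exact Finset.sum_congr rfl fun l _ => Coeff.tmul_smul _ _ _

end MatrixUnits

/-! ### Bilinearity of the curvature tensor -/

section Curvature

variable {n : ℕ} {M : Type*} [TopologicalSpace M] [T2Space M]
  [ChartedSpace (EuclideanSpace ℝ (Fin n)) M] [IsManifold (𝓡 n) ∞ M]
  [RiemannianBundle (fun x : M ↦ TangentSpace (𝓡 n) x)]
  [IsContMDiffRiemannianBundle (𝓡 n) ∞ (EuclideanSpace ℝ (Fin n))
    (fun x : M ↦ TangentSpace (𝓡 n) x)]
  (conn : Connection (n := n) M) [conn.ContMDiffCovariantDerivative ∞]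

/-- The curvature tensor as a bilinear map. -/
def curvatureBilin (x : M) : TangentSpace (𝓡 n) x →ₗ[ℝ] TangentSpace (𝓡 n) x →ₗ[ℝ]
    Module.End ℝ (TangentSpace (𝓡 n) x) :=
  LinearMap.mk₂ ℝ (curvatureEnd conn x)
    (fun u u' v => LinearMap.ext fun w => by
      have h := curvature_smul_add_left (conn := conn) 1 u u' v w
      rwa [one_smul, one_smul] at h)
    (fun a u v => LinearMap.ext fun w => by
      have h0 : curvature conn x 0 v w = 0 := by
        simpa using curvature_smul_add_left (conn := conn) 1 0 0 v w
      have h := curvature_smul_add_left (conn := conn) a u 0 v w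
      rwa [add_zero, h0, add_zero] at h)
    (fun u v v' => LinearMap.ext fun w => by
      have h := curvature_smul_add_middle (conn := conn) 1 u v v' w
      rwa [one_smul, one_smul] at h)
    (fun a u v => LinearMap.ext fun w => by
      have h0 : curvature conn x u 0 w = 0 := by
        simpa using curvature_smul_add_middle (conn := conn) 1 u 0 0 w
      have h := curvature_smul_add_middle (conn := conn) a u v 0 w
      rwa [add_zero, h0, add_zero] at h)

end Curvature


/-! ### Smooth functions on the superspace and the curvature form in local frames -/

section SmoothFunctions

variable {n : ℕ} {M : Type*} [TopologicalSpace M]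
  [ChartedSpace (EuclideanSpace ℝ (Fin n)) M] [IsManifold (𝓡 n) ∞ M]

section LocalCurvature

variable [T2Space M] (conn : Connection (n := n) M)

/-- The component of the curvature tensor in the local frame around `x₀`. -/
def curvatureComponent (x₀ : M) (i j k l : Fin n) (x : M) : ℝ :=
  let t := trivializationAt (EuclideanSpace ℝ (Fin n)) (fun y : M ↦ TangentSpace (𝓡 n) y) x₀
  let b := (EuclideanSpace.basisFun (Fin n) ℝ).toBasis
  t.localFrameCoeff (𝓡 n) b l x
    (curvatureOp conn (t.localFrame b i) (t.localFrame b j) (t.localFrame b k) x)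

/-- The curvature form in the trivialization of the tangent bundle around `x₀`. -/
def localCurvatureForm (x₀ x : M) :
    Coeff (Forms (EuclideanSpace ℝ (Fin n))) (EuclideanSpace ℝ (Fin n)) :=
  ∑ i, ∑ j, ∑ k, ∑ l, (curvatureComponent conn x₀ i j k l x : ℂ) •
    basicCurvature (EuclideanSpace.basisFun (Fin n) ℝ).toBasis i j k l

variable [conn.ContMDiffCovariantDerivative ∞]

lemma smoothFamily_localCurvatureForm (x₀ : M) :
    SmoothFamily (𝓘(ℝ, ℝ).prod (𝓡 n)) (Set.Ioi 0 ×ˢ (trivializationAt (EuclideanSpace ℝ (Fin n))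
      (fun y : M ↦ TangentSpace (𝓡 n) y) x₀).baseSet)
      fun p : ℝ × M => localCurvatureForm conn x₀ p.2 := by
  refine SmoothFamily.sum fun i _ => SmoothFamily.sum fun j _ => SmoothFamily.sum fun k _ =>
    SmoothFamily.sum fun l _ => SmoothFamily.smul ?_ (smoothFamily_const _)
  have h : ContMDiffOn (𝓡 n) 𝓘(ℝ, ℝ) ∞ (curvatureComponent conn x₀ i j k l)
      (trivializationAt (EuclideanSpace ℝ (Fin n))
        (fun y : M ↦ TangentSpace (𝓡 n) y) x₀).baseSet :=
    contMDiffOn_coord_curvatureOp x₀ _ i j k l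
  exact Complex.ofRealCLM.contDiff.contMDiff.comp_contMDiffOn
    (h.comp contMDiffOn_snd fun p hp => hp.2)

end LocalCurvature

variable [RiemannianBundle (fun x : M ↦ TangentSpace (𝓡 n) x)]

lemma trivForms_eq_pushForms {x₀ x : M} (hx : x ∈ (trivializationAt (EuclideanSpace ℝ (Fin n))
    (fun y : M ↦ TangentSpace (𝓡 n) y) x₀).baseSet) :
    trivForms x₀ x = pushForms (fibreEquiv (𝓡 n) hx) := by
  have h : ((trivializationAt (EuclideanSpace ℝ (Fin n)) (fun y : M ↦ TangentSpace (𝓡 n) y)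
      x₀).symmL ℝ x : EuclideanSpace ℝ (Fin n) →ₗ[ℝ] TangentSpace (𝓡 n) x) =
      (fibreEquiv (𝓡 n) hx).symm.toLinearMap := by
    ext v : 1
    exact (congrFun (Trivialization.symm_continuousLinearEquivAt_eq (R := ℝ) _ hx) v).symm
  rw [trivForms, pushForms, h]

lemma SuperFunction.IsSmooth.mul {f g : SuperFunction n M} (hf : f.IsSmooth) (hg : g.IsSmooth) :
    SuperFunction.IsSmooth fun r x => f r x * g r x := fun x₀ l => by
  have h := SmoothFamily.mul (hf x₀) (hg x₀) l
  simpa only [map_mul] using h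

lemma SuperFunction.IsSmooth.congr {f g : SuperFunction n M} (hf : f.IsSmooth)
    (h : ∀ r, 0 < r → ∀ x, g r x = f r x) : g.IsSmooth := fun x₀ l =>
  (hf x₀ l).congr fun p hp => by rw [h p.1 hp.1]

variable [T2Space M]
  [IsContMDiffRiemannianBundle (𝓡 n) ∞ (EuclideanSpace ℝ (Fin n))
    (fun x : M ↦ TangentSpace (𝓡 n) x)]
  (conn : Connection (n := n) M) [conn.ContMDiffCovariantDerivative ∞]

lemma curvatureComponent_eq {x₀ x : M} (i j k l : Fin n)
    (hx : x ∈ (trivializationAt (EuclideanSpace ℝ (Fin n))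
      (fun y : M ↦ TangentSpace (𝓡 n) y) x₀).baseSet) :
    curvatureComponent conn x₀ i j k l x =
      (EuclideanSpace.basisFun (Fin n) ℝ).toBasis.coord l (fibreEquiv (𝓡 n) hx (curvature conn x
        ((fibreEquiv (𝓡 n) hx).symm ((EuclideanSpace.basisFun (Fin n) ℝ).toBasis i))
        ((fibreEquiv (𝓡 n) hx).symm ((EuclideanSpace.basisFun (Fin n) ℝ).toBasis j))
        ((fibreEquiv (𝓡 n) hx).symm ((EuclideanSpace.basisFun (Fin n) ℝ).toBasis k)))) := by
  rw [← localFrame_eq_fibreEquiv_symm, ← localFrame_eq_fibreEquiv_symm,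
    ← localFrame_eq_fibreEquiv_symm, curvature_eq_curvatureOp (smoothNear_localFrame x₀ _ hx i)
      (smoothNear_localFrame x₀ _ hx j) (smoothNear_localFrame x₀ _ hx k), curvatureComponent]
  rw [Trivialization.localFrameCoeff_eq_coeff _ hx]
  rfl

variable {conn} in
-- Transport to the model fibre turns the curvature form into one with smooth coefficients on fixed
-- forms. The transported defining basis is exchanged for the standard one by independence of the
-- basis.
lemma pushCoeff_curvatureForm {x₀ x : M} (hx : x ∈ (trivializationAt (EuclideanSpace ℝ (Fin n))
    (fun y : M ↦ TangentSpace (𝓡 n) y) x₀).baseSet) :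
    pushCoeff (fibreEquiv (𝓡 n) hx) (curvatureForm (curvature conn x)) =
      localCurvatureForm conn x₀ x ∧
    localCurvatureForm conn x₀ x ∈ degreeCoeff (EuclideanSpace ℝ (Fin n)) 2 := by
  let φ := fibreEquiv (𝓡 n) hx
  let R' : EuclideanSpace ℝ (Fin n) →ₗ[ℝ] EuclideanSpace ℝ (Fin n) →ₗ[ℝ]
      Module.End ℝ (EuclideanSpace ℝ (Fin n)) :=
    ((curvatureBilin conn x).compl₁₂ φ.symm.toLinearMap φ.symm.toLinearMap).compr₂
      φ.conj.toLinearMap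
  have h1 : curvatureFormIn (EuclideanSpace.basisFun (Fin n) ℝ).toBasis R' =
      localCurvatureForm conn x₀ x := by
    rw [curvatureFormIn_eq_sum]
    refine Finset.sum_congr rfl fun i _ => Finset.sum_congr rfl fun j _ =>
      Finset.sum_congr rfl fun k _ => Finset.sum_congr rfl fun l _ => ?_
    rw [curvatureComponent_eq conn i j k l hx]
    rfl
  constructor
  · rw [curvatureForm_eq_curvatureFormIn (R := curvature conn x) (R' := curvatureBilin conn x)
      fun _ _ _ => rfl,
      pushCoeff_curvatureFormIn φ _ _ R' fun u v => by simp [R'], ← h1]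
    exact curvatureFormIn_eq _ _ _
  · rw [← h1, curvatureFormIn_eq _ (finBasis ℝ (EuclideanSpace ℝ (Fin n))),
      ← curvatureForm_eq_curvatureFormIn (R := fun u v w => R' u v w) fun _ _ _ => rfl]
    exact curvatureForm_mem_degreeCoeff _

/-- The exponential of the logarithm of the `Â`-form is a smooth function. -/
lemma isSmooth_expTau (z : ℂ) : SuperFunction.IsSmooth (n := n) (M := M) fun r x =>
    expTau r (curvatureForm (curvature conn x)) z := fun x₀ l => by
  refine (smoothFamily_expTau contMDiffOn_fst (smoothFamily_localCurvatureForm conn x₀)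
    (fun p hp => (pushCoeff_curvatureForm hp.2).2) z l).congr fun p hp => ?_
  rw [trivForms_eq_pushForms hp.2, pushForms_expTau _ (curvatureForm_mem_degreeCoeff _),
    (pushCoeff_curvatureForm hp.2).1]

end SmoothFunctions


/-! ### The geometric trivialization -/

section Trivialization

variable {n : ℕ} {M : Type*} [TopologicalSpace M]
  [ChartedSpace (EuclideanSpace ℝ (Fin n)) M] [IsManifold (𝓡 n) ∞ M]
  [RiemannianBundle (fun x : M ↦ TangentSpace (𝓡 n) x)]
  (conn : Connection (n := n) M) {c : ℂ} {r : ℝ}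

/-- The section is `exp (-τ/2)` times the frame. The exponent is written as a cast real number so
that conjugation invariance applies. -/
lemma ahatSection_eq (hr : 0 < r) (x : M) : ahatSection conn r x =
    expTau r (curvatureForm (curvature conn x)) ((-(1 / 2) : ℝ) : ℂ) •
      superSection r (TangentSpace (𝓡 n) x) n := by
  rw [ahatSection, ahatFunction, formFunction_ahatForm hr (curvatureForm_mem_degreeCoeff _),
    inverse_expTau (curvatureForm_mem_degreeCoeff _)]
  push_cast
  rfl

lemma smul_ahatSection (hr : 0 < r) (x : M) (f : Forms (TangentSpace (𝓡 n) x)) :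
    f • ahatSection conn r x =
      (f * expTau r (curvatureForm (curvature conn x)) ((-(1 / 2) : ℝ) : ℂ)) •
        superSection r (TangentSpace (𝓡 n) x) n := by
  rw [ahatSection_eq conn hr, smul_smul]

lemma lineConj_smul_ahatSection (hc : c = 1 ∨ c = -Complex.I) (hr : 0 < r) (x : M)
    (f : Forms (TangentSpace (𝓡 n) x)) :
    lineConj c r x (f • ahatSection conn r x) = formConj c f • ahatSection conn r x := by
  rw [smul_ahatSection conn hr, smul_ahatSection conn hr, lineConj, superConj_smul_superSection,
    map_mul, formConj_expTau hc (curvatureForm_mem_degreeCoeff _)]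

lemma bijective_smul_ahatSection (hr : 0 < r) (x : M) :
    Function.Bijective fun f : Forms (TangentSpace (𝓡 n) x) => f • ahatSection conn r x := by
  have hF := curvatureForm_mem_degreeCoeff (curvature conn x)
  have h : ∀ z : ℂ, expTau r (curvatureForm (curvature conn x)) z *
      expTau r (curvatureForm (curvature conn x)) (-z) = 1 := fun z => by
    rw [← expTau_add hF, add_neg_cancel, expTau_zero]
  have hu : IsUnit (expTau r (curvatureForm (curvature conn x)) ((-(1 / 2) : ℝ) : ℂ)) :=
    ⟨⟨_, _, h _, by simpa using h (-((-(1 / 2) : ℝ) : ℂ))⟩, rfl⟩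
  simp only [smul_ahatSection conn hr]
  exact (bijective_smul_superSection hr n).comp (IsUnit.isUnit_iff_mulRight_bijective.1 hu)

variable [T2Space M] [IsContMDiffRiemannianBundle (𝓡 n) ∞ (EuclideanSpace ℝ (Fin n))
    (fun x : M ↦ TangentSpace (𝓡 n) x)] [conn.ContMDiffCovariantDerivative ∞]

/-- The metric factor `exp τ` meets `exp (-τ/2)` from each argument. The exponentials are central,
so they can be collected although forms do not commute. -/
lemma lineMetric_smul_ahatSection (hmet : conn.IsMetricCompatible) (hc : c = 1 ∨ c = -Complex.I)
    (hr : 0 < r) (x : M) (f g : Forms (TangentSpace (𝓡 n) x)) :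
    lineMetric conn c r x (f • ahatSection conn r x) (g • ahatSection conn r x) =
      f * formConj c g := by
  have hF := curvatureForm_mem_degreeCoeff (curvature conn x)
  have hn : finrank ℝ (TangentSpace (𝓡 n) x) = n := finrank_euclideanSpace_fin (𝕜 := ℝ) (n := n)
  have hadj : coeffAdjoint (formConj c) (curvatureForm (curvature conn x)) =
      -(c ^ 2) • curvatureForm (curvature conn x) :=
    coeffAdjoint_curvatureForm c (curvatureEnd conn x) (adjoint_curvatureEnd hmet)
  rw [smul_ahatSection conn hr, smul_ahatSection conn hr, lineMetric,
    superMetric_smul_superSection hr _ _ _ _ hn, metricFactor_eq hc hr hF hadj, map_mul,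
    formConj_expTau hc hF, mul_assoc f, ← expTau_add hF, mul_assoc f,
    ← (expTau_commute hF r _ (formConj c g)).eq, ← mul_assoc (expTau _ _ _), ← expTau_add hF]
  norm_num
  rw [expTau_zero, one_mul]

lemma isSmooth_smul_ahatSection (f : SuperFunction n M) :
    f.IsSmooth ↔ SuperLineSection.IsSmooth fun r x => f r x • ahatSection conn r x := by
  constructor
  · exact fun hf => ⟨_, hf.mul (isSmooth_expTau conn ((-(1 / 2) : ℝ) : ℂ)), fun r hr x =>
      smul_ahatSection conn hr x _⟩
  · rintro ⟨g, hg, h⟩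
    -- Injectivity of multiplication on the frame gives `f exp (-τ/2) = g`, hence `f = g exp (τ/2)`
    -- is smooth.
    refine (hg.mul (isSmooth_expTau conn ((1 / 2 : ℝ) : ℂ))).congr fun r hr x => ?_
    have hF := curvatureForm_mem_degreeCoeff (curvature conn x)
    have h1 := (smul_ahatSection conn hr x (f r x)).symm.trans (h r hr x)
    rw [← (bijective_smul_superSection hr n).1 h1, mul_assoc, ← expTau_add hF, ← Complex.ofReal_add]
    norm_num
    rw [expTau_zero, mul_one]

lemma isGeometricTrivialization_ahatSection (hmet : conn.IsMetricCompatible)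
    (hc : c = 1 ∨ c = -Complex.I) : IsGeometricTrivialization conn c (ahatSection conn) where
  bijective _ hr x := bijective_smul_ahatSection conn hr x
  smooth f := isSmooth_smul_ahatSection conn f
  real _ hr x f := lineConj_smul_ahatSection conn hc hr x f
  isometry _ hr x f g := lineMetric_smul_ahatSection conn hmet hc hr x f g

lemma isSmooth_ahatSection : (ahatSection conn).IsSmooth :=
  ⟨_, isSmooth_expTau conn ((-(1 / 2) : ℝ) : ℂ), fun _ hr x => ahatSection_eq conn hr x⟩

end Trivialization

end SigmaModel

theorem mainTheorem7 {n : ℕ} {M : Type*} [TopologicalSpace M] [T2Space M]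
    [ChartedSpace (EuclideanSpace ℝ (Fin n)) M] [IsManifold (𝓡 n) ∞ M]
    [RiemannianBundle (fun x : M ↦ TangentSpace (𝓡 n) x)]
    [IsContMDiffRiemannianBundle (𝓡 n) ∞ (EuclideanSpace ℝ (Fin n))
      (fun x : M ↦ TangentSpace (𝓡 n) x)]
    (conn : SigmaModel.Connection (n := n) M) (hconn : SigmaModel.IsLeviCivita conn)
    (c : ℂ) (hc : c = 1 ∨ c = -Complex.I) :
    (SigmaModel.ahatSection conn).IsSmooth ∧
    (∀ r, 0 < r → ∀ x, SigmaModel.lineConj c r x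
      (SigmaModel.ahatSection conn r x) = SigmaModel.ahatSection conn r x) ∧
    (∀ r, 0 < r → ∀ x, SigmaModel.lineMetric conn c r x
      (SigmaModel.ahatSection conn r x) (SigmaModel.ahatSection conn r x) = 1) ∧
    SigmaModel.IsGeometricTrivialization conn c (SigmaModel.ahatSection conn) := by
  have := hconn.smooth
  have h := SigmaModel.isGeometricTrivialization_ahatSection conn hconn.metric hc
  refine ⟨SigmaModel.isSmooth_ahatSection conn, fun r hr x => ?_, fun r hr x => ?_, h⟩
  -- Reality and unit norm are the trivialization statements for the constant function `1`.
  · simpa using h.real r hr x 1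
  · simpa using h.isometry r hr x 1 1
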